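/- Let $k=\mathbb F_q$ with $q$ odd and $q>3$, let $n\ge 1$, and let $\psi$ be a non-trivial character of $k^+$. **The group.** Put $A=M_{2n}(k)$, $J=\begin{pmatrix}0&I_n\\-I_n&0\end{pmatrix}$, $a^\sim=Ja^tJ^{-1}$ for $a\in A$, and $F=\begin{pmatrix}0&J\\-J&0\end{pmatrix}$. Let $O_q(2n,2n)=\{g\in GL_{4n}(k): gFg^t=F\}$. It contains $$h_a=\begin{pmatrix}a&0\\0&(a^\sim)^{-1}\end{pmatrix}\ (a\in A^\times),\qquad u_s=\begin{pmatrix}1&s\\0&1\end{pmatrix}\ (s=s^\sim\in A),\qquad w=\begin{pmatrix}0&1\\-1&0\end{pmatrix}.$$ **The generalized Weil representation.** Let $V=k^{2n}$ (row vectors), $[x,y]=x(yJ)^t$, and let $M=V^2$ be the right $A$-module with $(x,y)a=(xa,ya)$. Put $\chi((x,y),(v,z))=\psi([x,z]-[y,v])$ and $\gamma(s,(x,y))=\psi([xs,y])$. A generalized Weil representation of $O_q(2n,2n)$ for these data is a representation $\rho$ of $O_q(2n,2n)$ on $L^2(M)$ such that, for all $f\in L^2(M)$, $m\in M$, $$\rho(h_a)f(m)=f(ma),\qquad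 \rho(u_s)f(m)=\gamma(s,m)f(m),\qquad \rho(w)f(m)=q^{-2n}\sum_{m'\in M}\chi(m,m')f(m').$$ Let $U(\gamma,\chi)$ be the group of $A$-linear automorphisms $\beta$ of $M$ that preserve $\chi$ and satisfy $\gamma(s,\beta m)=\gamma(s,m)$ for all $s=s^\sim$ and $m\in M$. It acts on $L^2(M)$ by $\sigma_\beta f=f\circ\beta^{-1}$. **The Weil representation.** Let $W=\mathrm{Hom}(k^{4n},k^2)=M_{2,4n}(k)$ with the symplectic form $\langle\!\langle w_1,w_2\rangle\!\rangle=\mathrm{tr}(w_1Fw_2^tJ_2)$, $J_2=\begin{pmatrix}0&1\\-1&0\end{pmatrix}$. The groups $O_q(2n,2n)$ and $SL_2(k)=Sp(2,k)$ act on $W$ by $w_1\mapsto w_1g^{-1}$ and $w_1\mapsto gw_1$; this gives homomorphisms to $Sp(W)$. Let $X=\{(x,0)\}$ and $Y=\{(0,y)\}$ with $x,y\in M_{2,2n}(k)$, so that $W=X\oplus Y$ is a complete polarization. Identify $X$ with $M$ (the rows of $x\in M_{2,2n}(k)$ are the two components), and hence $L^2(X)$ with $L^2(M)$. Let $S$ be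 the Schrödinger representation on $L^2(X)$, with central character $\psi$, of the Heisenberg group $W\times k$ with product $(w_1,t_1)(w_2,t_2)=(w_1+w_2,\,t_1+t_2+\tfrac12\langle\!\langle w_1,w_2\rangle\!\rangle)$: $(x_0,0)$ with $x_0\in X$ acts by $f\mapsto f(\cdot-x_0)$, and $(y_0,0)$ with $y_0\in Y$ acts as multiplication by $x\mapsto\psi(\langle\!\langle y_0,x\rangle\!\rangle)$. The Schrödinger model of the Weil representation is the representation $\omega$ of $Sp(W)$ on $L^2(X)$ with $\omega(g)S(w_1,t)\omega(g)^{-1}=S(gw_1,t)$ for all $g\in Sp(W)$, $w_1\in W$, $t\in k$. **Theorem.** The Weil representation $\omega$ exists, and: 1. The restriction of $\omega$ to $O_q(2n,2n)$ is a generalized Weil representation of $O_q(2n,2n)$: the operators $\omega(h_a)$, $\omega(u_s)$ and $\omega(w)$ are given by the above formulas for $\rho(h_a)$, $\rho(u_s)$ and $\rho(w)$. Moreover, every generalized Weil representation $\rho$ of $O_q(2n,2n)$ satisfies $\rho(g)=\omega(g)$ for all $g\in O_q(2n,2n)$ with $\det g=1$. 2. Left multiplication $x\mapsto gx$ on $X=M$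 defines an isomorphism $\varphi:SL_2(k)\to U(\gamma,\chi)$, and $\omega(g)=\sigma_{\varphi(g)}$ for all $g\in SL_2(k)$. Consequently the decomposition of $L^2(M)$ with respect to $U(\gamma,\chi)$ is the decomposition with respect to $SL_2(k)$ acting by $\omega$: the two families of isotypic components are equal, and $L^2(M)$ is their direct sum. Each component is stable under $\omega(g)$ for all $g\in O_q(2n,2n)$. For every finite-dimensional complex representation $(V_\pi,\pi)$ of $U(\gamma,\chi)$, $\pi$ is irreducible if and only if $\pi\circ\varphi$ is; the $\pi$-isotypic part of $\sigma$ is the $(\pi\circ\varphi)$-isotypic part of $\omega|_{SL_2(k)}$; and $\mathrm{Hom}_{U(\gamma,\chi)}(L^2(M),V_\pi)=\mathrm{Hom}_{SL_2(k)}(L^2(M),V_{\pi\circ\varphi})$. This last space, regarded as a space of functions $\theta:M\to V_\pi$ by $\theta(x)=\Theta(e_x)$ (with $e_x$ the delta function at $x$), is stable under $\theta\mapsto\sum_{y\in M}K_g(\cdot,y)\theta(y)$ for every $g\in O_q(2n,2n)$, where $K_g(x,y)=(\omega(g)e_y)(x)$. -/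

import Mathlib

open Matrix

namespace WeilO

section Ring

variable (k : Type*) [Field k] (n : ℕ)

/-- The index set of the coordinates of `k^{2n}`. -/
abbrev Idx (n : ℕ) : Type := Fin n ⊕ Fin n

/-- The ring `A = M_{2n}(k)`. -/
abbrev A : Type _ := Matrix (Idx n) (Idx n) k

/-- The matrix `J_{2n} = (0, I; -I, 0)`. -/
def J : A k n := fromBlocks 0 1 (-1) 0

/-- The split symmetric matrix `F = (0, J; -J, 0)` of size `4n`. -/
def F : Matrix (Idx n ⊕ Idx n) (Idx n ⊕ Idx n) k := fromBlocks 0 (J k n) (-J k n) 0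

variable {k n}

/-- The involution `a ↦ a^~ = J aᵗ J⁻¹` of `A`. -/
noncomputable def tilde (a : A k n) : A k n := J k n * aᵀ * (J k n)⁻¹

lemma J_mul_J : J k n * J k n = -1 := by
  rw [← fromBlocks_one, fromBlocks_neg]
  simp [J, fromBlocks_multiply]

lemma J_inv : (J k n)⁻¹ = -J k n := by
  apply Matrix.inv_eq_right_inv
  rw [mul_neg, J_mul_J, neg_neg]

lemma J_transpose : (J k n)ᵀ = -J k n := by
  simp [J, fromBlocks_transpose, fromBlocks_neg]

lemma F_mul_F : F k n * F k n = 1 := by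
  rw [← fromBlocks_one]
  simp [F, fromBlocks_multiply, J_mul_J]

lemma F_transpose : (F k n)ᵀ = F k n := by
  simp [F, fromBlocks_transpose, J_transpose]

/-- `F` is congruent to the hyperbolic matrix `(0, I; I, 0)`, so that it is split. -/
lemma F_split : F k n =
    fromBlocks (J k n) 0 0 1 * fromBlocks 0 1 1 0 * (fromBlocks (J k n) 0 0 1)ᵀ := by
  simp [F, fromBlocks_transpose, fromBlocks_multiply, J_transpose]

lemma tilde_eq (a : A k n) : tilde a = -(J k n * aᵀ * J k n) := by
  simp [tilde, J_inv]

lemma tilde_mul (a b : A k n) : tilde (a * b) = tilde b * tilde a := by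
  have h : J k n * bᵀ * J k n * (J k n * aᵀ * J k n) =
      J k n * bᵀ * (J k n * J k n) * aᵀ * J k n := by simp only [Matrix.mul_assoc]
  rw [tilde_eq, tilde_eq, tilde_eq, neg_mul_neg, h, J_mul_J, transpose_mul]
  simp [Matrix.mul_assoc]

lemma tilde_one : tilde (1 : A k n) = 1 := by
  simp [tilde_eq, J_mul_J]

lemma mul_J_transpose (a : A k n) : J k n * aᵀ = tilde a * J k n := by
  rw [tilde_eq, neg_mul, Matrix.mul_assoc, J_mul_J]
  simp

end Ring

section Orthogonal

variable (k : Type*) [Field k] (n : ℕ)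

/-- The split orthogonal group `O_q(2n,2n)`, realised as `{g | g F gᵗ = F}`. -/
def Oq : Subgroup (GL (Idx n ⊕ Idx n) k) where
  carrier := {g | g.1 * F k n * g.1ᵀ = F k n}
  one_mem' := by simp
  mul_mem' := by
    intro a b ha hb
    simp only [Set.mem_ofPred_eq, Units.val_mul, transpose_mul] at ha hb ⊢
    calc a.1 * b.1 * F k n * (b.1ᵀ * a.1ᵀ) = a.1 * (b.1 * F k n * b.1ᵀ) * a.1ᵀ := by
          simp only [Matrix.mul_assoc]
      _ = F k n := by rw [hb, ha]
  inv_mem' := by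
    intro a ha
    simp only [Set.mem_ofPred_eq] at ha ⊢
    have h1 : a⁻¹.1 * a.1 = 1 := by simp
    have h2 : a.1ᵀ * a⁻¹.1ᵀ = 1 := by rw [← transpose_mul, h1, transpose_one]
    calc a⁻¹.1 * F k n * a⁻¹.1ᵀ = a⁻¹.1 * (a.1 * F k n * a.1ᵀ) * a⁻¹.1ᵀ := by rw [ha]
      _ = (a⁻¹.1 * a.1) * F k n * (a.1ᵀ * a⁻¹.1ᵀ) := by simp only [Matrix.mul_assoc]
      _ = F k n := by rw [h1, h2]; simp

variable {k n}

/-- `O_q(2n,2n)` is the group `SL_~^-(2, A)` of the `g = (a, b; c, d)` with `g J₋ g^~ = J₋`, where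
`J₋ = (0, 1; -1, 0)` and `g^~ = (a^~, c^~; b^~, d^~)`. -/
lemma fromBlocks_mem_iff (a b c d : A k n) :
    fromBlocks a b c d * F k n * (fromBlocks a b c d)ᵀ = F k n ↔
      fromBlocks a b c d * fromBlocks 0 1 (-1) 0 *
        fromBlocks (tilde a) (tilde c) (tilde b) (tilde d) = fromBlocks 0 1 (-1) 0 := by
  have hU : fromBlocks (J k n) 0 0 (J k n) * fromBlocks (-J k n) 0 0 (-J k n) = 1 := by
    rw [← fromBlocks_one]
    simp [fromBlocks_multiply, J_mul_J]
  have hF : F k n = fromBlocks 0 1 (-1) 0 * fromBlocks (J k n) 0 0 (J k n) := by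
    simp [F, fromBlocks_multiply]
  have hT : fromBlocks (J k n) 0 0 (J k n) * (fromBlocks a b c d)ᵀ =
      fromBlocks (tilde a) (tilde c) (tilde b) (tilde d) * fromBlocks (J k n) 0 0 (J k n) := by
    simp [fromBlocks_transpose, fromBlocks_multiply, mul_J_transpose]
  have hL : fromBlocks a b c d * F k n * (fromBlocks a b c d)ᵀ =
      fromBlocks a b c d * fromBlocks 0 1 (-1) 0 *
        fromBlocks (tilde a) (tilde c) (tilde b) (tilde d) * fromBlocks (J k n) 0 0 (J k n) := by
    rw [hF, Matrix.mul_assoc, Matrix.mul_assoc, hT]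
    simp only [Matrix.mul_assoc]
  rw [hL, hF]
  refine ⟨fun h => ?_, fun h => by rw [h]⟩
  have h' := congrArg (· * fromBlocks (-J k n) 0 0 (-J k n)) h
  simp only [Matrix.mul_assoc, hU, Matrix.mul_one] at h'
  simpa only [Matrix.mul_assoc] using h'

/-- A matrix `g` with `g F gᵗ = F` as an element of `O_q(2n,2n)`. -/
def Oq.ofMatrix (g : Matrix (Idx n ⊕ Idx n) (Idx n ⊕ Idx n) k)
    (hg : g * F k n * gᵀ = F k n) : Oq k n :=
  have h1 : g * (F k n * gᵀ * F k n) = 1 := by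
    rw [← Matrix.mul_assoc, ← Matrix.mul_assoc, hg, F_mul_F]
  ⟨⟨g, F k n * gᵀ * F k n, h1, mul_eq_one_comm.mp h1⟩, hg⟩

/-- `h_a = (a, 0; 0, (a^~)⁻¹)` for `a ∈ A^×`. -/
noncomputable def hElt (a : (A k n)ˣ) : Oq k n :=
  Oq.ofMatrix (fromBlocks a.1 0 0 (tilde a.1)⁻¹) (by
    rw [fromBlocks_mem_iff]
    have h1 : tilde a.1 * tilde a⁻¹.1 = 1 := by
      rw [← tilde_mul, Units.inv_mul, tilde_one]
    have h2 : (tilde a.1)⁻¹ = tilde a⁻¹.1 := Matrix.inv_eq_right_inv h1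
    have h3 : tilde (tilde a⁻¹.1) = a⁻¹.1 := by
      have h4 : J k n * (J k n * a⁻¹.1 * J k n) * J k n =
        (J k n * J k n) * a⁻¹.1 * (J k n * J k n) := by simp only [Matrix.mul_assoc]
      rw [tilde_eq, tilde_eq, transpose_neg, transpose_mul, transpose_mul, transpose_transpose,
        J_transpose]
      simp only [neg_mul, mul_neg, neg_neg] at h4 ⊢
      rw [← Matrix.mul_assoc (J k n) a⁻¹.1, h4, J_mul_J]
      simp
    have h0 : tilde (0 : A k n) = 0 := by simp [tilde_eq]
    rw [h2, h3, h0]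
    have h5 : tilde a⁻¹.1 * tilde a.1 = 1 := by
      rw [← tilde_mul, Units.mul_inv, tilde_one]
    generalize tilde a⁻¹.1 = b at h5
    simp [fromBlocks_multiply, h5])

/-- `u_s = (1, s; 0, 1)` for `s = s^~`. -/
def uElt (s : A k n) (hs : tilde s = s) : Oq k n :=
  Oq.ofMatrix (fromBlocks 1 s 0 1) (by
    have h0 : tilde (0 : A k n) = 0 := by simp [tilde_eq]
    rw [fromBlocks_mem_iff, hs, tilde_one, h0]
    simp [fromBlocks_multiply])

/-- `w = (0, 1; -1, 0)`. -/
def wElt : Oq k n :=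
  Oq.ofMatrix (fromBlocks 0 1 (-1) 0) (by
    have h0 : tilde (0 : A k n) = 0 := by simp [tilde_eq]
    have h1 : tilde (-1 : A k n) = -1 := by simp [tilde_eq, J_mul_J]
    rw [fromBlocks_mem_iff, tilde_one, h0, h1]
    simp [fromBlocks_multiply])

end Orthogonal

section GeneralizedWeil

variable {k : Type*} [Field k] {n : ℕ}

/-- The symplectic form `[x, y] = ⟨x, y J⟩` on the space `V = k^{2n}` of row vectors. -/
def brk (x y : Idx n → k) : k := x ⬝ᵥ (y ᵥ* J k n)

variable (k n) in
/-- The right `A`-module `M = V²`. -/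
abbrev M : Type _ := (Idx n → k) × (Idx n → k)

/-- The right action `(x, y) a = (x a, y a)` of `A` on `M`. -/
def rsmul (m : M k n) (a : A k n) : M k n := (m.1 ᵥ* a, m.2 ᵥ* a)

/-- `χ((x, y), (v, z)) = ψ([x, z] - [y, v])`. -/
def chi (ψ : AddChar k ℂ) (m m' : M k n) : ℂ := ψ (brk m.1 m'.2 - brk m.2 m'.1)

/-- `γ(u, (x, y)) = ψ([x u, y])`. -/
def gam (ψ : AddChar k ℂ) (u : A k n) (m : M k n) : ℂ := ψ (brk (m.1 ᵥ* u) m.2)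

/-- `ρ` is a generalized Weil representation of `O_q(2n,2n)` for the data `(M, 1, γ, χ)`, with
constant `c = q^{-2n}`: the elements `h_a`, `u_s` and `w` act by the prescribed formulas. -/
structure IsGeneralizedWeil [Fintype k] (ψ : AddChar k ℂ)
    (ρ : Representation ℂ (Oq k n) (M k n → ℂ)) : Prop where
  apply_h : ∀ (a : (A k n)ˣ) (f : M k n → ℂ) (m : M k n), ρ (hElt a) f m = f (rsmul m a.1)
  apply_u : ∀ (s : A k n) (hs : tilde s = s) (f : M k n → ℂ) (m : M k n),
    ρ (uElt s hs) f m = gam ψ s m * f m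
  apply_w : ∀ (f : M k n → ℂ) (m : M k n),
    ρ wElt f m = ((Fintype.card k : ℂ) ^ (2 * n))⁻¹ * ∑ m' : M k n, chi ψ m m' * f m'

variable (n) in
/-- The unitary group `U(γ, χ)`: the `A`-linear automorphisms of `M` that preserve `γ` and `χ`. -/
def U (ψ : AddChar k ℂ) : Subgroup (Equiv.Perm (M k n)) where
  carrier := {β | (∀ m m' : M k n, β (m + m') = β m + β m') ∧
    (∀ (m : M k n) (a : A k n), β (rsmul m a) = rsmul (β m) a) ∧
    (∀ (u : A k n), tilde u = u → ∀ m : M k n, gam ψ u (β m) = gam ψ u m) ∧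
    ∀ m m' : M k n, chi ψ (β m) (β m') = chi ψ m m'}
  one_mem' := by simp
  mul_mem' := by
    rintro β β' ⟨h0, h1, h2, h3⟩ ⟨h0', h1', h2', h3'⟩
    refine ⟨fun m m' => ?_, fun m a => ?_, fun u hu m => ?_, fun m m' => ?_⟩
    · rw [Equiv.Perm.mul_apply, h0', h0, Equiv.Perm.mul_apply, Equiv.Perm.mul_apply]
    · rw [Equiv.Perm.mul_apply, h1', h1, Equiv.Perm.mul_apply]
    · rw [Equiv.Perm.mul_apply, h2 u hu, h2' u hu]
    · rw [Equiv.Perm.mul_apply, Equiv.Perm.mul_apply, h3, h3']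
  inv_mem' := by
    rintro β ⟨h0, h1, h2, h3⟩
    have hβ : ∀ m, β (β⁻¹ m) = m := β.apply_symm_apply
    refine ⟨fun m m' => ?_, fun m a => ?_, fun u hu m => ?_, fun m m' => ?_⟩
    · apply β.injective
      rw [h0, hβ, hβ, hβ]
    · apply β.injective
      rw [h1, hβ, hβ]
    · rw [← h2 u hu, hβ]
    · rw [← h3, hβ, hβ]

variable (n) in
/-- The natural action `σ_β f = f ∘ β⁻¹` of `U(γ, χ)` on `L²(M)`. -/
def natAction (ψ : AddChar k ℂ) : Representation ℂ (U n ψ) (M k n → ℂ) where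
  toFun β := LinearMap.funLeft ℂ ℂ fun m => β⁻¹.1 m
  map_one' := by
    ext f m
    simp [LinearMap.funLeft]
  map_mul' := by
    intro β β'
    ext f m
    simp [LinearMap.funLeft]

end GeneralizedWeil

section Symplectic

variable (k : Type*) [Field k] (n : ℕ)

/-- `W = Hom(k^{4n}, k²)`. -/
abbrev W : Type _ := Matrix (Fin 2) (Idx n ⊕ Idx n) k

variable {k n}

/-- The symplectic form `⟪w₁, w₂⟫ = tr(w₁ F w₂ᵗ J₂)` on `W`. -/
def form (w₁ w₂ : W k n) : k := trace (w₁ * F k n * w₂ᵀ * !![0, 1; -1, 0])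

lemma form_add_left (a b c : W k n) : form (a + b) c = form a c + form b c := by
  simp [form, Matrix.add_mul]

lemma form_add_right (a b c : W k n) : form a (b + c) = form a b + form a c := by
  simp [form, Matrix.add_mul, Matrix.mul_add]

lemma form_neg_left (a b : W k n) : form (-a) b = -form a b := by
  simp [form]

lemma form_neg_right (a b : W k n) : form a (-b) = -form a b := by
  simp [form]

lemma form_swap (a b : W k n) : form b a = -form a b := by
  have hJ : (!![0, 1; -1, 0] : Matrix (Fin 2) (Fin 2) k)ᵀ = -!![0, 1; -1, 0] := by
    ext i j
    fin_cases i <;> fin_cases j <;> simp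
  unfold form
  rw [← trace_transpose, transpose_mul, transpose_mul, transpose_mul, transpose_transpose,
    F_transpose, hJ, neg_mul, trace_neg, trace_mul_comm, ← Matrix.mul_assoc]

variable (k n) in
/-- The symplectic group `Sp(W)`. -/
def Sp : Subgroup (W k n ≃ₗ[k] W k n) where
  carrier := {g | ∀ w₁ w₂, form (g w₁) (g w₂) = form w₁ w₂}
  one_mem' := by simp
  mul_mem' := by
    intro a b ha hb w₁ w₂
    rw [LinearEquiv.mul_apply, LinearEquiv.mul_apply, ha, hb]
  inv_mem' := by
    intro a ha w₁ w₂
    have h : ∀ w, a (a⁻¹ w) = w := fun w => a.apply_symm_apply w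
    rw [← ha, h, h]

/-- The action `g(w) = w g⁻¹` of `O_q(2n,2n)` on `W`, as a homomorphism to `Sp(W)`. -/
def orthToSp : Oq k n →* Sp k n where
  toFun g := ⟨
    { toFun := fun w => w * g⁻¹.1.1
      invFun := fun w => w * g.1.1
      map_add' := fun a b => Matrix.add_mul a b _
      map_smul' := fun c a => Matrix.smul_mul c a _
      left_inv := fun w => by
        have h : g⁻¹.1.1 * g.1.1 = 1 := by
          rw [← Units.val_mul, ← Subgroup.coe_mul, inv_mul_cancel]; rfl
        change w * g⁻¹.1.1 * g.1.1 = w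
        rw [Matrix.mul_assoc, h, Matrix.mul_one]
      right_inv := fun w => by
        have h : g.1.1 * g⁻¹.1.1 = 1 := by
          rw [← Units.val_mul, ← Subgroup.coe_mul, mul_inv_cancel]; rfl
        change w * g.1.1 * g⁻¹.1.1 = w
        rw [Matrix.mul_assoc, h, Matrix.mul_one] }, by
    intro w₁ w₂
    have h : g⁻¹.1.1 * F k n * g⁻¹.1.1ᵀ = F k n := g⁻¹.2
    change trace (w₁ * g⁻¹.1.1 * F k n * (w₂ * g⁻¹.1.1)ᵀ * _) = trace _
    have e : w₁ * g⁻¹.1.1 * F k n * (w₂ * g⁻¹.1.1)ᵀ =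
        w₁ * (g⁻¹.1.1 * F k n * g⁻¹.1.1ᵀ) * w₂ᵀ := by
      rw [transpose_mul]
      simp only [Matrix.mul_assoc]
    rw [e, h]⟩
  map_one' := by
    apply Subtype.ext
    apply LinearEquiv.ext
    intro w
    change w * ((1 : Oq k n)⁻¹).1.1 = w
    rw [inv_one]
    exact Matrix.mul_one w
  map_mul' := by
    intro g g'
    apply Subtype.ext
    apply LinearEquiv.ext
    intro w
    change w * ((g * g')⁻¹).1.1 = w * g'⁻¹.1.1 * g⁻¹.1.1
    rw [_root_.mul_inv_rev, Subgroup.coe_mul, Units.val_mul, Matrix.mul_assoc]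

lemma sl_form (g : SpecialLinearGroup (Fin 2) k) :
    g.1ᵀ * !![0, 1; -1, 0] * g.1 = !![0, 1; -1, 0] := by
  have h := g.2
  rw [det_fin_two] at h
  ext i j
  fin_cases i <;> fin_cases j <;> simp [Matrix.mul_apply, Fin.sum_univ_two]
  · ring
  · linear_combination h
  · linear_combination -h
  · ring

/-- The action `g(w) = g w` of `SL₂(k) = Sp(2, k)` on `W`, as a homomorphism to `Sp(W)`. -/
def slToSp : SpecialLinearGroup (Fin 2) k →* Sp k n where
  toFun g := ⟨
    { toFun := fun w => g.1 * w
      invFun := fun w => g⁻¹.1 * w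
      map_add' := fun a b => Matrix.mul_add _ a b
      map_smul' := fun c a => Matrix.mul_smul _ c a
      left_inv := fun w => by
        have h : g⁻¹.1 * g.1 = 1 := by
          exact congrArg Subtype.val (inv_mul_cancel g)
        change g⁻¹.1 * (g.1 * w) = w
        rw [← Matrix.mul_assoc, h, Matrix.one_mul]
      right_inv := fun w => by
        have h : g.1 * g⁻¹.1 = 1 := by
          exact congrArg Subtype.val (mul_inv_cancel g)
        change g.1 * (g⁻¹.1 * w) = w
        rw [← Matrix.mul_assoc, h, Matrix.one_mul] }, by
    intro w₁ w₂
    change trace (g.1 * w₁ * F k n * (g.1 * w₂)ᵀ * _) = trace _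
    have e : g.1 * w₁ * F k n * (g.1 * w₂)ᵀ * !![0, 1; -1, 0] =
        g.1 * (w₁ * F k n * w₂ᵀ * (g.1ᵀ * !![0, 1; -1, 0])) := by
      rw [transpose_mul]
      simp only [Matrix.mul_assoc]
    rw [e, trace_mul_comm, Matrix.mul_assoc, sl_form]⟩
  map_one' := by
    apply Subtype.ext
    apply LinearEquiv.ext
    intro w
    exact Matrix.one_mul w
  map_mul' := by
    intro g g'
    apply Subtype.ext
    apply LinearEquiv.ext
    intro w
    exact Matrix.mul_assoc g.1 g'.1 w

end Symplectic

section Heisenberg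

variable (k : Type*) [Field k] (n : ℕ)

/-- The Heisenberg group `W × k` of the symplectic space `W`, with the product
`(w, t) (w', t') = (w + w', t + t' + ⟪w, w'⟫ / 2)`. -/
@[ext]
structure Heis where
  vec : W k n
  cen : k

variable {k n}

instance : Mul (Heis k n) := ⟨fun a b => ⟨a.vec + b.vec, a.cen + b.cen + form a.vec b.vec / 2⟩⟩

instance : One (Heis k n) := ⟨⟨0, 0⟩⟩

instance : Inv (Heis k n) := ⟨fun a => ⟨-a.vec, -a.cen + form a.vec a.vec / 2⟩⟩

lemma Heis.mul_def (a b : Heis k n) :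
    a * b = ⟨a.vec + b.vec, a.cen + b.cen + form a.vec b.vec / 2⟩ := rfl

lemma form_zero_left (a : W k n) : form 0 a = 0 := by simp [form]

lemma form_zero_right (a : W k n) : form a 0 = 0 := by simp [form]

instance : Group (Heis k n) :=
  Group.ofLeftAxioms
    (by
      intro a b c
      simp only [Heis.mul_def, form_add_left, form_add_right, Heis.mk.injEq]
      exact ⟨add_assoc _ _ _, by ring⟩)
    (by
      intro a
      change (⟨0 + a.vec, 0 + a.cen + form 0 a.vec / 2⟩ : Heis k n) = a
      simp [form_zero_left])
    (by
      intro a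
      change (⟨-a.vec + a.vec, -a.cen + form a.vec a.vec / 2 + a.cen + form (-a.vec) a.vec / 2⟩ :
        Heis k n) = ⟨0, 0⟩
      rw [form_neg_left]
      congr 1
      · simp
      · ring)

/-- The action `g · (w, t) = (g w, t)` of `Sp(W)` on the Heisenberg group. -/
def spAct (g : Sp k n) (h : Heis k n) : Heis k n := ⟨g.1 h.vec, h.cen⟩

variable (k n) in
/-- The Lagrangian subspace `X = {(x, 0)}` of `W`, identified with `M_{2,2n}(k)`. -/
abbrev X : Type _ := Matrix (Fin 2) (Idx n) k

/-- The inclusion `x ↦ (x, 0)` of `X` in `W`. -/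
def inX (x : X k n) : W k n := fromCols x 0

/-- The inclusion `y ↦ (0, y)` of the complementary Lagrangian subspace `Y` in `W`. -/
def inY (y : X k n) : W k n := fromCols 0 y

lemma eq_inX_add_inY (w : W k n) : w = inX w.toCols₁ + inY w.toCols₂ := by
  ext i (j | j) <;> simp [inX, inY]

lemma inX_add (x x' : X k n) : inX (x + x') = inX x + inX x' := by
  ext i (j | j) <;> simp [inX]

lemma inX_sub (x x' : X k n) : inX (x - x') = inX x - inX x' := by
  ext i (j | j) <;> simp [inX]

lemma inY_add (x x' : X k n) : inY (x + x') = inY x + inY x' := by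
  ext i (j | j) <;> simp [inY]

lemma form_sub_right (a b c : W k n) : form a (b - c) = form a b - form a c := by
  rw [sub_eq_add_neg, form_add_right, form_neg_right, sub_eq_add_neg]

lemma form_inX (x x' : X k n) : form (inX x) (inX x') = 0 := by
  have h : inX x * F k n * (inX x')ᵀ = 0 := by
    simp [inX, F, fromCols_mul_fromBlocks, transpose_fromCols, fromCols_mul_fromRows]
  rw [form, h]
  simp

lemma form_inY (x x' : X k n) : form (inY x) (inY x') = 0 := by
  have h : inY x * F k n * (inY x')ᵀ = 0 := by
    simp [inY, F, fromCols_mul_fromBlocks, transpose_fromCols, fromCols_mul_fromRows]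
  rw [form, h]
  simp

/-- The Schrödinger representation, with central character `ψ`, of the Heisenberg group on `L²(X)`:
`(x₀, 0)` acts by `f ↦ f(· - x₀)`, and `(y₀, 0)` acts as multiplication by `x ↦ ψ(⟪y₀, x⟫)`. -/
def schrodinger [NeZero (2 : k)] (ψ : AddChar k ℂ) : Representation ℂ (Heis k n) (X k n → ℂ) where
  toFun h :=
    { toFun := fun f x =>
        ψ (h.cen + form (inY h.vec.toCols₂) (inX x) -
          form (inY h.vec.toCols₂) (inX h.vec.toCols₁) / 2) * f (x - h.vec.toCols₁)
      map_add' := fun f f' => by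
        funext x
        simp [mul_add]
      map_smul' := fun c f => by
        funext x
        simp only [Pi.smul_apply, smul_eq_mul, RingHom.id_apply]
        ring }
  map_one' := by
    apply LinearMap.ext
    intro f
    funext x
    have h1 : (1 : Heis k n).vec = 0 := rfl
    have h2 : (1 : Heis k n).cen = 0 := rfl
    have h3 : (0 : W k n).toCols₁ = 0 := rfl
    have h4 : (0 : W k n).toCols₂ = 0 := rfl
    have h5 : inY (0 : X k n) = 0 := by
      ext i (j | j) <;> simp [inY]
    change ψ _ * f _ = f x
    simp [h1, h2, h3, h4, h5, form_zero_left]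
  map_mul' := by
    intro a b
    apply LinearMap.ext
    intro f
    funext x
    have h2 : (2 : k) ≠ 0 := NeZero.ne 2
    have e1 : (a * b).vec.toCols₁ = a.vec.toCols₁ + b.vec.toCols₁ := rfl
    have e2 : (a * b).vec.toCols₂ = a.vec.toCols₂ + b.vec.toCols₂ := rfl
    have e3 : (a * b).cen = a.cen + b.cen + form a.vec b.vec / 2 := rfl
    have e4 : form a.vec b.vec =
        form (inY a.vec.toCols₂) (inX b.vec.toCols₁) -
          form (inY b.vec.toCols₂) (inX a.vec.toCols₁) := by
      conv_lhs => rw [eq_inX_add_inY a.vec, eq_inX_add_inY b.vec]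
      rw [form_add_left, form_add_right, form_add_right, form_inX, form_inY,
        form_swap (inY b.vec.toCols₂) (inX a.vec.toCols₁)]
      ring
    change ψ _ * f (x - (a * b).vec.toCols₁) =
      ψ _ * (ψ _ * f (x - a.vec.toCols₁ - b.vec.toCols₁))
    rw [← mul_assoc, ← AddChar.map_add_eq_mul, e1, e2, e3, e4, sub_sub, inY_add, inX_add, inX_sub]
    simp only [form_add_left, form_add_right, form_sub_right]
    congr 2
    field_simp
    ring

/-- `ω` is the (Schrödinger model of the) Weil representation of `Sp(W)` attached to `ψ` and to the
complete polarization `W = X ⊕ Y`: the representation of `Sp(W)` on `L²(X)` with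
`ω(g) S(h) ω(g)⁻¹ = S(g · h)` for the Schrödinger representation `S` of the Heisenberg group.
Two such `ω` differ by a character of `Sp(W)`, which is trivial as `Sp(W)` is perfect. -/
def IsWeil [NeZero (2 : k)] (ψ : AddChar k ℂ) (ω : Representation ℂ (Sp k n) (X k n → ℂ)) : Prop :=
  ∀ (g : Sp k n) (h : Heis k n), ω g ∘ₗ schrodinger ψ h = schrodinger ψ (spAct g h) ∘ₗ ω g

/-- The canonical identification of `M` with `X`: `(x, y)` is the matrix with rows `x` and `y`. -/
def toX : M k n ≃ X k n where
  toFun m := Matrix.of ![m.1, m.2]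
  invFun x := (x 0, x 1)
  left_inv _ := rfl
  right_inv x := by
    ext i j
    fin_cases i <;> rfl

/-- A representation on `L²(X)`, regarded as a representation on `L²(M)`. -/
def onM {H : Type*} [Group H] (R : Representation ℂ H (X k n → ℂ)) :
    Representation ℂ H (M k n → ℂ) where
  toFun g := (LinearEquiv.funCongrLeft ℂ ℂ toX).conj (R g)
  map_one' := by rw [map_one]; exact LinearEquiv.conj_id _
  map_mul' a b := by rw [map_mul]; exact LinearEquiv.conj_comp _ _ _

/-- The restriction to `O_q(2n,2n)` of a representation of `Sp(W)` on `L²(X) = L²(M)`. -/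
def resO (ω : Representation ℂ (Sp k n) (X k n → ℂ)) : Representation ℂ (Oq k n) (M k n → ℂ) :=
  onM (ω.comp orthToSp)

/-- The restriction to `SL₂(k)` of a representation of `Sp(W)` on `L²(X) = L²(M)`. -/
def resSL (ω : Representation ℂ (Sp k n) (X k n → ℂ)) :
    Representation ℂ (SpecialLinearGroup (Fin 2) k) (M k n → ℂ) :=
  onM (ω.comp slToSp)

end Heisenberg

section Decomposition

variable {H L V : Type*} [Group H] [AddCommGroup L] [Module ℂ L] [AddCommGroup V] [Module ℂ V]

/-- The representation `π ∘ φ` of `H'` obtained from a representation `π` of `H`. -/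
def pull {H' : Type*} [Group H'] (φ : H' →* H) (π : Representation ℂ H V) :
    Representation ℂ H' V := π.comp φ

/-- The space `Hom_H(L, V)` of intertwining operators from `σ` to `π`. -/
def homSpace (σ : Representation ℂ H L) (π : Representation ℂ H V) : Submodule ℂ (L →ₗ[ℂ] V) where
  carrier := {Θ | ∀ h, Θ ∘ₗ σ h = π h ∘ₗ Θ}
  zero_mem' h := by simp
  add_mem' ha hb h := by rw [LinearMap.add_comp, LinearMap.comp_add, ha h, hb h]
  smul_mem' c _ ha h := by rw [LinearMap.smul_comp, LinearMap.comp_smul, ha h]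

/-- The `π`-isotypic part of `σ`: the sum of the images of all intertwining operators `V → L`. -/
def isotypic (σ : Representation ℂ H L) (π : Representation ℂ H V) : Submodule ℂ L :=
  ⨆ Φ ∈ homSpace π σ, LinearMap.range Φ

/-- The isotypic decomposition of `σ`: the set of its non-zero `π`-isotypic parts, for the
irreducible finite-dimensional complex representations `π` of `H`. -/
def isotypicDecomposition (σ : Representation ℂ H L) : Set (Submodule ℂ L) :=
  {N | N ≠ ⊥ ∧ ∃ (d : ℕ) (π : Representation ℂ H (Fin d → ℂ)), π.IsIrreducible ∧ N = isotypic σ π}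

/-- The action of an operator `R` on `L²(S)` on the linear maps `Θ : L²(S) → V`, regarded as the
functions `θ(x) = Θ(e_x)` from `S` to `V`: the function `θ` is sent to `x ↦ ∑ y, K(x, y) θ(y)`,
where `K(x, y) = (R e_y)(x)` is the kernel of `R`. -/
def kernelAct {S : Type*} [Fintype S] [DecidableEq S] (R : (S → ℂ) →ₗ[ℂ] (S → ℂ))
    (Θ : (S → ℂ) →ₗ[ℂ] V) : (S → ℂ) →ₗ[ℂ] V :=
  ∑ x, (LinearMap.proj x).smulRight (∑ y, R (Pi.single y 1) x • Θ (Pi.single y 1))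

end Decomposition

end WeilO

open WeilO

/-!
The proof constructs the Weil representation from the representation theory of the Heisenberg group,
and computes it on the two commuting groups `O_q(2n,2n)` and `SL₂(k)` without determining any
cocycle.

Averaging an operator over the Heisenberg group gives a multiple of its trace
(`sum_schrodinger_conj`). This is Schur's lemma for the Schrödinger representation `S`, and with the
character of `S`, which is supported on the centre, it provides for each `g ∈ Sp(W)` an invertible
operator `T` with `T S(h) = S(g · h) T`, unique up to a scalar (`exists_intertwines`,
`Intertwines.exists_eq_smul`). To choose the scalars coherently, observe that such operators commute
with the parity operator `f ↦ f(-·)`, whose trace is `1`. The even functions therefore have one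
dimension more than the odd functions, so that exactly one multiple of `T` has the same determinant
on the even and on the odd functions. These normalised operators are closed under composition, and
form the Weil representation (`exists_isWeil`).

An operator of the Weil representation on a commutator is the commutator of arbitrary intertwining
operators (`IsWeil.eq_of_commutator`), since the scalars cancel. As `q > 3`, this determines the
action of the unipotent elements of `SL₂(k)`, which generate that group (`IsWeil.apply_sl`), of the
elements `u_s` (`IsWeil.apply_u`), and of `h_a` for a transvection `a`. A diagonal `h_a` need not be
a commutator of suitable elements. It is the product of two conjugates of the symplectic
automorphism `rowSp a`, which is conjugate to its inverse, so that its scalar is a sign; this sign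
is squared in `h_a` (`IsWeil.apply_rowSp`, `IsWeil.apply_h`). The scalar of `w` follows from the relation
`w u₋₁ w = u₁ w u₁` (`IsWeil.apply_w`).

The elements `h_a`, `u_s` and `w` generate the special orthogonal group (`mem_of_generators`): after
multiplication by elements `h_a` the lower right block of an isometry is diagonal; exchanging the
vectors of the hyperbolic pairs where it vanishes makes this block invertible, and the isometry then
lies in the big cell. The determinant shows that the number of exchanged pairs is even, and an even
number of exchanges is generated by the given elements. Hence two generalized Weil representations
agree on this subgroup.

Finally, an `A`-linear automorphism of `M` is the left multiplication by a `2 × 2` matrix, and it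
preserves `χ` if and only if this matrix has determinant `1` (`slToU_surjective`). So `U(γ, χ)` is
`SL₂(k)`, with the same action on `L²(M)`, which commutes with the action of `O_q(2n,2n)`. The
isotypic decomposition is that of a module over the group algebra, which is semisimple by Maschke's
theorem.
-/

namespace WeilO

/-! ### Operators on the functions on a finite set -/

section Operators

variable {S : Type*} [Fintype S] [DecidableEq S]

lemma trace_eq_sum_single (A : (S → ℂ) →ₗ[ℂ] (S → ℂ)) :
    LinearMap.trace ℂ (S → ℂ) A = ∑ x, A (Pi.single x 1) x := by
  rw [LinearMap.trace_eq_matrix_trace ℂ (Pi.basisFun ℂ S)]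
  simp [Matrix.trace]

lemma ext_single {A B : (S → ℂ) →ₗ[ℂ] (S → ℂ)}
    (h : ∀ z x, A (Pi.single z 1) x = B (Pi.single z 1) x) : A = B := by
  refine LinearMap.pi_ext' fun z => LinearMap.ext_ring ?_
  funext x
  exact h z x

/-- The operator `f ↦ f(x) e_z`, a matrix unit. -/
def matrixUnit (z x : S) : (S → ℂ) →ₗ[ℂ] (S → ℂ) := (LinearMap.proj x).smulRight (Pi.single z 1)

lemma trace_comp_matrixUnit (A : (S → ℂ) →ₗ[ℂ] (S → ℂ)) (z x : S) :
    LinearMap.trace ℂ (S → ℂ) (A ∘ₗ matrixUnit z x) = A (Pi.single z 1) x := by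
  rw [trace_eq_sum_single]
  rw [Finset.sum_eq_single x]
  · simp [matrixUnit]
  · intro y _ hy
    simp [matrixUnit, hy.symm]
  · simp

lemma exists_trace_comp_ne_zero {A : (S → ℂ) →ₗ[ℂ] (S → ℂ)} (hA : A ≠ 0) :
    ∃ C, LinearMap.trace ℂ (S → ℂ) (A ∘ₗ C) ≠ 0 := by
  by_contra! h
  refine hA (ext_single fun z x => ?_)
  rw [← trace_comp_matrixUnit, h]
  rfl

end Operators

/-! ### The duality between `X` and `Y` -/

section Pairing

variable {k : Type*} [Field k] {n : ℕ}

lemma brk_eq (x y : Idx n → k) : brk x y = -(x ᵥ* J k n) ⬝ᵥ y := by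
  rw [brk, ← mulVec_transpose, J_transpose, neg_mulVec, dotProduct_neg, dotProduct_mulVec,
    neg_dotProduct]

lemma brk_swap (x y : Idx n → k) : brk y x = -brk x y := by
  rw [brk_eq, neg_dotProduct, dotProduct_comm, brk]

lemma brk_add_left (x x' y : Idx n → k) : brk (x + x') y = brk x y + brk x' y := by
  simp [brk]

lemma brk_add_right (x y y' : Idx n → k) : brk x (y + y') = brk x y + brk x y' := by
  simp [brk, add_vecMul]

lemma brk_smul_left (c : k) (x y : Idx n → k) : brk (c • x) y = c * brk x y := by
  simp [brk]

lemma brk_smul_right (c : k) (x y : Idx n → k) : brk x (c • y) = c * brk x y := by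
  simp [brk, smul_vecMul]

lemma brk_sub_left (x x' y : Idx n → k) : brk (x - x') y = brk x y - brk x' y := by
  simp [brk]

lemma brk_sub_right (x y y' : Idx n → k) : brk x (y - y') = brk x y - brk x y' := by
  simp [brk, sub_vecMul]

lemma brk_zero_left (y : Idx n → k) : brk 0 y = 0 := by simp [brk]

lemma brk_zero_right (y : Idx n → k) : brk y 0 = 0 := by simp [brk]

lemma brk_nondegenerate {x : Idx n → k} (h : ∀ y, brk y x = 0) : x = 0 := by
  have h1 : x ᵥ* J k n = 0 := dotProduct_eq_zero _ fun y => by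
    rw [dotProduct_comm]; exact h y
  have h2 : x ᵥ* J k n ᵥ* J k n = -x := by
    rw [vecMul_vecMul, J_mul_J, vecMul_neg, vecMul_one]
  rw [h1, zero_vecMul] at h2
  exact neg_eq_zero.mp h2.symm

lemma form_inY_inX (y x : X k n) :
    form (inY y) (inX x) = brk (y 1) (x 0) - brk (y 0) (x 1) := by
  have h : inY y * F k n * (inX x)ᵀ = -(y * J k n * xᵀ) := by
    simp [inY, inX, F, fromCols_mul_fromBlocks, transpose_fromCols, fromCols_mul_fromRows]
  have e : ∀ i j, (y * J k n * xᵀ) i j = -brk (y i) (x j) := fun i j => by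
    rw [brk_eq, neg_dotProduct, neg_neg]; rfl
  rw [form, h, trace_fin_two, Matrix.mul_apply, Matrix.mul_apply]
  simp [Fin.sum_univ_two, e]
  ring

lemma inY_neg (y : X k n) : inY (-y) = -inY y := by
  ext i (j | j) <;> simp [inY]

lemma inX_neg (y : X k n) : inX (-y) = -inX y := by
  ext i (j | j) <;> simp [inX]

lemma inX_zero : inX (0 : X k n) = 0 := by
  ext i (j | j) <;> simp [inX]

lemma inY_zero : inY (0 : X k n) = 0 := by
  ext i (j | j) <;> simp [inY]

lemma pairing_nondegenerate {x : X k n} (h : ∀ y : X k n, form (inY y) (inX x) = 0) : x = 0 := by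
  have h0 : x 0 = 0 := brk_nondegenerate fun v => by
    have := h (Matrix.of ![0, v])
    rw [form_inY_inX] at this
    change brk v (x 0) - brk 0 (x 1) = 0 at this
    simpa [brk_zero_left] using this
  have h1 : x 1 = 0 := brk_nondegenerate fun v => by
    have := h (Matrix.of ![v, 0])
    rw [form_inY_inX] at this
    change brk 0 (x 0) - brk v (x 1) = 0 at this
    simpa [brk_zero_left] using this
  ext i j
  fin_cases i
  · exact congrFun h0 j
  · exact congrFun h1 j

lemma pairing_nondegenerate' {y : X k n} (h : ∀ x : X k n, form (inY y) (inX x) = 0) : y = 0 := by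
  have h1 : y 1 = 0 := brk_nondegenerate fun v => by
    have := h (Matrix.of ![v, 0])
    rw [form_inY_inX] at this
    rw [brk_swap, neg_eq_zero]
    change brk (y 1) v - brk (y 0) 0 = 0 at this
    simpa [brk_zero_right] using this
  have h0 : y 0 = 0 := brk_nondegenerate fun v => by
    have := h (Matrix.of ![0, v])
    rw [form_inY_inX] at this
    rw [brk_swap, neg_eq_zero]
    change brk (y 1) 0 - brk (y 0) v = 0 at this
    simpa [brk_zero_right] using this
  ext i j
  fin_cases i
  · exact congrFun h0 j
  · exact congrFun h1 j

/-- A non-trivial additive character of a field takes a value different from `1` on every multiple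
of a non-zero element. -/
lemma eq_zero_of_forall_addChar {ψ : AddChar k ℂ} (hψ : ψ ≠ 1) {a : k}
    (h : ∀ t, ψ (t * a) = 1) : a = 0 := by
  by_contra ha
  obtain ⟨t, ht⟩ := AddChar.ne_one_iff.mp hψ
  exact ht (by simpa [ha] using h (t / a))

lemma form_smul_left (c : k) (a b : W k n) : form (c • a) b = c * form a b := by
  simp [form]

lemma form_smul_right (c : k) (a b : W k n) : form a (c • b) = c * form a b := by
  simp [form]

lemma inX_smul (c : k) (x : X k n) : inX (c • x) = c • inX x := by
  ext i (j | j) <;> simp [inX]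

lemma inY_smul (c : k) (x : X k n) : inY (c • x) = c • inY x := by
  ext i (j | j) <;> simp [inY]

variable [Fintype k] [DecidableEq k]

lemma sum_addChar_pairing_left {ψ : AddChar k ℂ} (hψ : ψ ≠ 1) (x : X k n) :
    ∑ y : X k n, ψ (form (inY y) (inX x)) = if x = 0 then (Fintype.card (X k n) : ℂ) else 0 := by
  classical
  let χ : AddChar (X k n) ℂ := ψ.compAddMonoidHom
    (AddMonoidHom.mk' (fun y => form (inY y) (inX x)) fun y y' => by
      rw [inY_add, form_add_left])
  have h := AddChar.sum_eq_ite χ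
  have e : χ = 0 ↔ x = 0 := by
    constructor
    · intro h
      refine pairing_nondegenerate fun y => eq_zero_of_forall_addChar hψ fun t => ?_
      have := DFunLike.congr_fun h (t • y)
      change ψ (form (inY (t • y)) (inX x)) = 1 at this
      rwa [inY_smul, form_smul_left] at this
    · rintro rfl
      refine AddChar.ext _ _ fun y => ?_
      change ψ (form (inY y) (inX 0)) = 1
      rw [inX_zero, form_zero_right, AddChar.map_zero_eq_one]
  simp only [e] at h
  exact h

lemma sum_addChar_pairing_right {ψ : AddChar k ℂ} (hψ : ψ ≠ 1) (y : X k n) :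
    ∑ x : X k n, ψ (form (inY y) (inX x)) = if y = 0 then (Fintype.card (X k n) : ℂ) else 0 := by
  classical
  let χ : AddChar (X k n) ℂ := ψ.compAddMonoidHom
    (AddMonoidHom.mk' (fun x => form (inY y) (inX x)) fun y y' => by
      rw [inX_add, form_add_right])
  have h := AddChar.sum_eq_ite χ
  have e : χ = 0 ↔ y = 0 := by
    constructor
    · intro h
      refine pairing_nondegenerate' fun x => eq_zero_of_forall_addChar hψ fun t => ?_
      have := DFunLike.congr_fun h (t • x)
      change ψ (form (inY y) (inX (t • x))) = 1 at this
      rwa [inX_smul, form_smul_right] at this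
    · rintro rfl
      refine AddChar.ext _ _ fun x => ?_
      change ψ (form (inY 0) (inX x)) = 1
      rw [inY_zero, form_zero_left, AddChar.map_zero_eq_one]
  simp only [e] at h
  exact h

end Pairing

/-! ### The Schrödinger representation -/

section Schrodinger

variable {k : Type*} [Field k] {n : ℕ}

lemma form_self [NeZero (2 : k)] (a : W k n) : form a a = 0 := by
  have h := form_swap a a
  have h2 : (2 : k) ≠ 0 := NeZero.ne 2
  have : 2 * form a a = 0 := by linear_combination h
  simpa [h2] using this

lemma Heis.inv_def [NeZero (2 : k)] (h : Heis k n) : h⁻¹ = ⟨-h.vec, -h.cen⟩ := by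
  change (⟨-h.vec, -h.cen + form h.vec h.vec / 2⟩ : Heis k n) = _
  simp [form_self]

/-- An element of the Heisenberg group is given by its components in `X`, `Y` and the centre. -/
def heisEquiv : Heis k n ≃ (X k n × X k n) × k where
  toFun h := ((h.vec.toCols₁, h.vec.toCols₂), h.cen)
  invFun p := ⟨inX p.1.1 + inY p.1.2, p.2⟩
  left_inv h := Heis.ext (eq_inX_add_inY h.vec).symm rfl
  right_inv p := by
    obtain ⟨⟨x, y⟩, t⟩ := p
    refine Prod.ext (Prod.ext ?_ ?_) rfl
    · ext i j; simp [inX, inY]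
    · ext i j; simp [inX, inY]

instance [Fintype k] : Fintype (Heis k n) := by
  classical exact Fintype.ofEquiv _ heisEquiv.symm

lemma toCols₁_inX_add_inY (x y : X k n) : (inX x + inY y).toCols₁ = x := by
  ext i j; simp [inX, inY]

lemma toCols₂_inX_add_inY (x y : X k n) : (inX x + inY y).toCols₂ = y := by
  ext i j; simp [inX, inY]

lemma sum_heis [Fintype k] {E : Type*} [AddCommMonoid E] (f : Heis k n → E) :
    ∑ h, f h = ∑ t : k, ∑ x : X k n, ∑ y : X k n, f ⟨inX x + inY y, t⟩ := by
  classical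
  rw [← heisEquiv.symm.sum_comp, Fintype.sum_prod_type, Finset.sum_comm]
  refine Finset.sum_congr rfl fun t _ => ?_
  rw [Fintype.sum_prod_type]
  rfl

/-- The symplectic automorphism `g` of the Heisenberg group. -/
def spAut (g : Sp k n) : Heis k n ≃* Heis k n where
  toFun := spAct g
  invFun := spAct g⁻¹
  left_inv h := Heis.ext (g.1.symm_apply_apply h.vec) rfl
  right_inv h := Heis.ext (g.1.apply_symm_apply h.vec) rfl
  map_mul' a b := Heis.ext (map_add g.1 a.vec b.vec) (by
    change _ = a.cen + b.cen + form (g.1 a.vec) (g.1 b.vec) / 2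
    rw [g.2]
    rfl)

variable [NeZero (2 : k)]

lemma schrodinger_apply (ψ : AddChar k ℂ) (h : Heis k n) (f : X k n → ℂ) (x : X k n) :
    schrodinger ψ h f x = ψ (h.cen + form (inY h.vec.toCols₂) (inX x) -
          form (inY h.vec.toCols₂) (inX h.vec.toCols₁) / 2) * f (x - h.vec.toCols₁) := rfl

lemma schrodinger_single [DecidableEq k] (ψ : AddChar k ℂ) (h : Heis k n) (z : X k n) :
    schrodinger ψ h (Pi.single z 1) = ψ (h.cen + form (inY h.vec.toCols₂) (inX z) +
          form (inY h.vec.toCols₂) (inX h.vec.toCols₁) / 2) •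
            Pi.single (z + h.vec.toCols₁) 1 := by
  funext x
  rw [schrodinger_apply, Pi.smul_apply, smul_eq_mul, Pi.single_apply, Pi.single_apply]
  by_cases hx : x = z + h.vec.toCols₁
  · subst hx
    have h2 : (2 : k) ≠ 0 := NeZero.ne 2
    simp only [add_sub_cancel_right, if_true, mul_one, inX_add, form_add_right]
    congr 1
    field_simp
    ring
  · rw [if_neg hx, if_neg fun h' => hx (sub_eq_iff_eq_add.mp h'), mul_zero, mul_zero]

/-- `T` intertwines the Schrödinger representation `S` with its twist `h ↦ S(g · h)`. -/
def Intertwines (ψ : AddChar k ℂ) (g : Sp k n) (T : (X k n → ℂ) →ₗ[ℂ] (X k n → ℂ)) : Prop :=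
  ∀ h : Heis k n, T ∘ₗ schrodinger ψ h = schrodinger ψ (spAct g h) ∘ₗ T

lemma Intertwines.mul {ψ : AddChar k ℂ} {g g' : Sp k n} {T T' : (X k n → ℂ) →ₗ[ℂ] (X k n → ℂ)}
    (hT : Intertwines ψ g T) (hT' : Intertwines ψ g' T') : Intertwines ψ (g * g') (T ∘ₗ T') := by
  intro h
  have e : spAct (g * g') h = spAct g (spAct g' h) := rfl
  rw [LinearMap.comp_assoc, hT' h, ← LinearMap.comp_assoc, hT, e, LinearMap.comp_assoc]

lemma Intertwines.one (ψ : AddChar k ℂ) : Intertwines ψ (1 : Sp k n) LinearMap.id := fun _ => rfl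

variable [Fintype k] [DecidableEq k]

/-- The orthogonality relation behind the irreducibility of the Schrödinger representation:
averaging an operator over the Heisenberg group gives a multiple of its trace. -/
lemma sum_schrodinger_conj {ψ : AddChar k ℂ} (hψ : ψ ≠ 1) (A : (X k n → ℂ) →ₗ[ℂ] (X k n → ℂ)) :
    ∑ h : Heis k n, schrodinger ψ h ∘ₗ A ∘ₗ schrodinger ψ h⁻¹ =
      (Fintype.card k * Fintype.card (X k n) * LinearMap.trace ℂ _ A) • LinearMap.id := by
  refine ext_single fun z x => ?_
  have key : ∀ (t : k) (x₀ y₀ : X k n),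
      (schrodinger ψ (⟨inX x₀ + inY y₀, t⟩ : Heis k n) ∘ₗ A ∘ₗ
        schrodinger ψ (⟨inX x₀ + inY y₀, t⟩ : Heis k n)⁻¹) (Pi.single z 1) x =
      ψ (form (inY y₀) (inX (x - z))) * A (Pi.single (z - x₀) 1) (x - x₀) := by
    intro t x₀ y₀
    have e1 : (-(inX x₀ + inY y₀) : W k n).toCols₁ = -x₀ := by
      rw [neg_add, ← inX_neg, ← inY_neg, toCols₁_inX_add_inY]
    have e2 : (-(inX x₀ + inY y₀) : W k n).toCols₂ = -y₀ := by
      rw [neg_add, ← inX_neg, ← inY_neg, toCols₂_inX_add_inY]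
    rw [LinearMap.comp_apply, LinearMap.comp_apply, schrodinger_single, map_smul,
      schrodinger_apply, Heis.inv_def, e1, e2, toCols₁_inX_add_inY, toCols₂_inX_add_inY,
      Pi.smul_apply, smul_eq_mul, ← mul_assoc, ← AddChar.map_add_eq_mul, ← sub_eq_add_neg]
    have h2 : (2 : k) ≠ 0 := NeZero.ne 2
    simp only [inY_neg, inX_neg, inX_sub, form_neg_left, form_neg_right, form_sub_right]
    congr 2
    field_simp
    ring
  rw [LinearMap.sum_apply, Finset.sum_apply, sum_heis]
  simp_rw [key, ← Finset.sum_mul, sum_addChar_pairing_left hψ, sub_eq_zero]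
  rw [Finset.sum_const, Finset.card_univ, LinearMap.smul_apply, LinearMap.id_apply, Pi.smul_apply,
    Pi.single_apply]
  split_ifs with hx
  · subst hx
    rw [← Finset.mul_sum, trace_eq_sum_single,
      ← (Equiv.subLeft x).sum_comp (fun z => A (Pi.single z 1) z)]
    simp [mul_assoc]
  · simp

/-- The character of the Schrödinger representation is supported on the centre. -/
lemma trace_schrodinger {ψ : AddChar k ℂ} (hψ : ψ ≠ 1) (h : Heis k n) :
    LinearMap.trace ℂ _ (schrodinger ψ h) =
      if h.vec = 0 then ψ h.cen * Fintype.card (X k n) else 0 := by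
  rw [trace_eq_sum_single]
  simp_rw [schrodinger_single]
  simp only [Pi.smul_apply, Pi.single_apply, left_eq_add, smul_eq_mul, mul_ite, mul_one,
    mul_zero]
  by_cases h1 : h.vec.toCols₁ = 0
  · simp only [h1, if_true, inX_zero, form_zero_right, zero_div, add_zero,
      AddChar.map_add_eq_mul, ← Finset.mul_sum, sum_addChar_pairing_right hψ]
    by_cases h2 : h.vec.toCols₂ = 0
    · have : h.vec = 0 := by rw [eq_inX_add_inY h.vec, h1, h2, inX_zero, inY_zero, add_zero]
      rw [if_pos this, if_pos h2]
    · rw [if_neg h2, if_neg fun h' => h2 (by rw [h']; rfl), mul_zero]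
  · rw [if_neg fun h' => h1 (by rw [h']; rfl)]
    simp [h1]

end Schrodinger

/-! ### Schur's lemma and the existence of intertwining operators -/

section StoneVonNeumann

variable {k : Type*} [Field k] {n : ℕ} [Fintype k]

lemma card_mul_card_ne_zero : (Fintype.card k * Fintype.card (X k n) : ℂ) ≠ 0 := by
  have : Nonempty (X k n) := ⟨0⟩
  exact mul_ne_zero (Nat.cast_ne_zero.mpr Fintype.card_ne_zero)
    (Nat.cast_ne_zero.mpr Fintype.card_ne_zero)

variable [NeZero (2 : k)] [DecidableEq k]

/-- Schur's lemma for the Schrödinger representation. -/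
lemma exists_eq_smul_id {ψ : AddChar k ℂ} (hψ : ψ ≠ 1) {B : (X k n → ℂ) →ₗ[ℂ] (X k n → ℂ)}
    (hB : Intertwines ψ 1 B) : ∃ c : ℂ, B = c • LinearMap.id := by
  have hk := card_mul_card_ne_zero (k := k) (n := n)
  -- average `B ∘ E` for a matrix unit `E` of trace one
  have h1 := sum_schrodinger_conj hψ (matrixUnit (0 : X k n) 0)
  have h2 := sum_schrodinger_conj hψ (B ∘ₗ matrixUnit (0 : X k n) 0)
  have h3 : ∑ h : Heis k n, schrodinger ψ h ∘ₗ (B ∘ₗ matrixUnit (0 : X k n) 0) ∘ₗ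
      schrodinger ψ h⁻¹ = B ∘ₗ ∑ h : Heis k n, schrodinger ψ h ∘ₗ matrixUnit (0 : X k n) 0 ∘ₗ
      schrodinger ψ h⁻¹ := by
    refine LinearMap.ext fun f => ?_
    simp only [LinearMap.sum_apply, LinearMap.comp_apply, map_sum]
    exact Finset.sum_congr rfl fun h _ => (LinearMap.congr_fun (hB h) _).symm
  have h4 : LinearMap.trace ℂ _ (matrixUnit (0 : X k n) 0) = 1 := by
    have := trace_comp_matrixUnit LinearMap.id (0 : X k n) 0
    simpa using this
  rw [h3, h1, h4, mul_one, LinearMap.comp_smul, LinearMap.comp_id] at h2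
  refine ⟨LinearMap.trace ℂ _ (B ∘ₗ matrixUnit (0 : X k n) 0), ?_⟩
  rw [mul_smul (_ * _ : ℂ)] at h2
  exact smul_right_injective _ hk h2

/-- The twist `h ↦ S(g · h)` of the Schrödinger representation is equivalent to `S`, as both have
the same character. -/
lemma exists_intertwines {ψ : AddChar k ℂ} (hψ : ψ ≠ 1) (g : Sp k n) :
    ∃ T, Intertwines ψ g T ∧ T ≠ 0 := by
  have hk := card_mul_card_ne_zero (k := k) (n := n)
  let T := fun A : (X k n → ℂ) →ₗ[ℂ] (X k n → ℂ) =>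
    ∑ h : Heis k n, schrodinger ψ (spAct g h) ∘ₗ A ∘ₗ schrodinger ψ h⁻¹
  have hT : ∀ A, Intertwines ψ g (T A) := by
    intro A a
    refine LinearMap.ext fun f => ?_
    simp only [T, LinearMap.sum_apply, LinearMap.comp_apply, map_sum]
    refine (Fintype.sum_equiv (Equiv.mulLeft a) _ _ fun h => ?_).symm
    have e1 : spAct g (a * h) = spAct g a * spAct g h := map_mul (spAut g) a h
    rw [Equiv.coe_mulLeft, e1, map_mul, Module.End.mul_apply, _root_.mul_inv_rev, map_mul,
      Module.End.mul_apply, ← Module.End.mul_apply (schrodinger ψ a⁻¹), ← map_mul, inv_mul_cancel,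
      map_one, Module.End.one_apply]
  by_contra! hT0
  -- the traces of the operators attached to the matrix units in the row of `0` add up to
  -- `∑ h, tr (S h⁻¹) * ⟨S(g · h) e₀, e₀⟩`, to which only the centre contributes
  have h0 : ∑ z : X k n, T (matrixUnit 0 z) (Pi.single z 1) 0 = 0 :=
    Finset.sum_eq_zero fun z _ => by rw [hT0 _ (hT _)]; rfl
  have h1 : ∀ z : X k n, T (matrixUnit 0 z) (Pi.single z 1) 0 =
      ∑ h : Heis k n, schrodinger ψ h⁻¹ (Pi.single z 1) z *
        schrodinger ψ (spAct g h) (Pi.single 0 1) 0 := by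
    intro z
    simp [T, matrixUnit, LinearMap.sum_apply]
  simp_rw [h1] at h0
  rw [Finset.sum_comm] at h0
  simp_rw [← Finset.sum_mul, ← trace_eq_sum_single, trace_schrodinger hψ] at h0
  have h2 : ∀ h : Heis k n, ((if h⁻¹.vec = 0 then ψ h⁻¹.cen * Fintype.card (X k n) else 0) *
      schrodinger ψ (spAct g h) (Pi.single 0 1) 0 : ℂ) =
        if h.vec = 0 then (Fintype.card (X k n) : ℂ) else 0 := by
    intro h
    simp only [Heis.inv_def, neg_eq_zero]
    split_ifs with hv
    · have e1 : (spAct g h).vec = 0 := by rw [spAct, hv, map_zero]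
      have e2 : (spAct g h).cen = h.cen := rfl
      have e3 : (0 : W k n).toCols₁ = 0 := rfl
      have e4 : (0 : W k n).toCols₂ = 0 := rfl
      rw [schrodinger_single, e1, e2, e3, e4, inX_zero, form_zero_right, zero_div, add_zero,
        add_zero, add_zero, Pi.smul_apply, Pi.single_eq_same, smul_eq_mul, mul_one,
        mul_right_comm, ← AddChar.map_add_eq_mul, neg_add_cancel, AddChar.map_zero_eq_one, one_mul]
    · rw [zero_mul]
  simp_rw [h2] at h0
  rw [← Finset.sum_filter, Finset.sum_const, nsmul_eq_mul] at h0
  refine mul_ne_zero (Nat.cast_ne_zero.mpr (Finset.card_ne_zero.mpr ⟨1, ?_⟩))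
    (right_ne_zero_of_mul hk) h0
  exact Finset.mem_filter.mpr ⟨Finset.mem_univ _, rfl⟩

/-- A non-zero intertwining operator is invertible: it becomes a non-zero scalar when composed with
a suitable average over the Heisenberg group. -/
lemma Intertwines.isUnit {ψ : AddChar k ℂ} (hψ : ψ ≠ 1) {g : Sp k n}
    {T : Module.End ℂ (X k n → ℂ)} (hT : Intertwines ψ g T) (h0 : T ≠ 0) : IsUnit T := by
  have hk := card_mul_card_ne_zero (k := k) (n := n)
  obtain ⟨C, hC⟩ := exists_trace_comp_ne_zero h0
  have h1 := sum_schrodinger_conj hψ (T ∘ₗ C)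
  set c := (Fintype.card k * Fintype.card (X k n) * LinearMap.trace ℂ _ (T ∘ₗ C) : ℂ) with hc
  have hc0 : c ≠ 0 := mul_ne_zero hk hC
  let R : Module.End ℂ (X k n → ℂ) :=
    ∑ h : Heis k n, schrodinger ψ h ∘ₗ C ∘ₗ schrodinger ψ (spAct g h)⁻¹
  have h2 : T * R = c • 1 := by
    refine Eq.trans ?_ h1
    refine LinearMap.ext fun f => ?_
    simp only [R, Module.End.mul_apply, LinearMap.sum_apply, LinearMap.comp_apply, map_sum]
    refine Fintype.sum_equiv (spAut g).toEquiv _ _ fun h => ?_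
    exact LinearMap.congr_fun (hT h) _
  have h3 : T * (c⁻¹ • R) = 1 := by
    rw [mul_smul_comm, h2, smul_smul, inv_mul_cancel₀ hc0, one_smul]
  exact IsUnit.of_mul_eq_one _ h3

/-- Two invertible operators that intertwine `S` with the same twist are proportional. -/
lemma Intertwines.exists_eq_smul {ψ : AddChar k ℂ} (hψ : ψ ≠ 1) {g : Sp k n}
    {T T' : Module.End ℂ (X k n → ℂ)} (hT : Intertwines ψ g T) (hT' : Intertwines ψ g T')
    (h0 : T ≠ 0) : ∃ c : ℂ, T' = c • T := by
  obtain ⟨u, rfl⟩ := hT.isUnit hψ h0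
  have h1 : Intertwines ψ 1 (u⁻¹.1 ∘ₗ T') := by
    intro h
    have e1 : u⁻¹.1 * u.1 = 1 := u.inv_mul
    have e2 : u.1 * schrodinger ψ h = schrodinger ψ (spAct g h) * u.1 := hT h
    have e3 : T' * schrodinger ψ h = schrodinger ψ (spAct g h) * T' := hT' h
    have e4 : spAct 1 h = h := rfl
    change u⁻¹.1 * T' * schrodinger ψ h = schrodinger ψ (spAct 1 h) * (u⁻¹.1 * T')
    rw [e4, mul_assoc, e3, ← mul_assoc, ← mul_assoc]
    congr 1
    rw [Units.inv_mul_eq_iff_eq_mul, ← mul_assoc, e2, mul_assoc, Units.mul_inv, mul_one]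
  obtain ⟨c, hc⟩ := exists_eq_smul_id hψ h1
  refine ⟨c, ?_⟩
  have e5 : u.1 * (u⁻¹.1 * T') = u.1 * (c • 1) := congrArg (u.1 * ·) hc
  rwa [← mul_assoc, Units.mul_inv, one_mul, mul_smul_comm, mul_one] at e5

end StoneVonNeumann

/-! ### The parity operator -/

section Parity

variable {k : Type*} [Field k] {n : ℕ}

variable (k n) in
/-- The parity operator `f ↦ f(-·)`. -/
def parity : Module.End ℂ (X k n → ℂ) := LinearMap.funLeft ℂ ℂ fun x => -x

lemma parity_mul_parity : parity k n * parity k n = 1 := by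
  refine LinearMap.ext fun f => funext fun x => ?_
  simp [parity, LinearMap.funLeft_apply]

variable (k n) in
/-- The element `-1` of `Sp(W)`. -/
def negSp : Sp k n := ⟨LinearEquiv.neg k, fun a b => by
  simp [form_neg_left, form_neg_right]⟩

lemma mul_negSp (g : Sp k n) : g * negSp k n = negSp k n * g :=
  Subtype.ext (LinearEquiv.ext fun w => map_neg g.1 w)

variable [NeZero (2 : k)]

lemma intertwines_parity (ψ : AddChar k ℂ) : Intertwines ψ (negSp k n) (parity k n) := by
  intro h
  refine LinearMap.ext fun f => funext fun x => ?_
  have e1 : (-h.vec).toCols₁ = -h.vec.toCols₁ := rfl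
  have e2 : (-h.vec).toCols₂ = -h.vec.toCols₂ := rfl
  change schrodinger ψ h f (-x) = schrodinger ψ ⟨-h.vec, h.cen⟩ (parity k n f) x
  rw [schrodinger_apply, schrodinger_apply, e1, e2, parity, LinearMap.funLeft_apply]
  simp only [inX_neg, inY_neg, form_neg_left, form_neg_right, neg_neg]
  congr 2
  abel

variable [Fintype k] [DecidableEq k]

lemma trace_parity : LinearMap.trace ℂ _ (parity k n) = 1 := by
  have h2 : (2 : k) ≠ 0 := NeZero.ne 2
  rw [trace_eq_sum_single, Finset.sum_eq_single 0]
  · simp [parity, LinearMap.funLeft_apply]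
  · intro x _ hx
    have : -x ≠ x := fun h => hx (by
      have h3 : (2 : k) • x = 0 := by
        rw [two_smul]; nth_rewrite 1 [← h]; exact neg_add_cancel x
      exact (smul_eq_zero.mp h3).resolve_left h2)
    simp [parity, LinearMap.funLeft_apply, this]
  · simp

/-- Intertwining operators commute with the parity operator, as `-1` is central in `Sp(W)` and the
parity operator has a non-zero trace. -/
lemma Intertwines.commute_parity {ψ : AddChar k ℂ} (hψ : ψ ≠ 1) {g : Sp k n}
    {T : Module.End ℂ (X k n → ℂ)} (hT : Intertwines ψ g T) : Commute T (parity k n) := by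
  by_cases h0 : T = 0
  · rw [h0]; exact Commute.zero_left _
  have hP := intertwines_parity (k := k) (n := n) ψ
  obtain ⟨u, rfl⟩ := hT.isUnit hψ h0
  have h1 : Intertwines ψ (g * negSp k n) (u.1 ∘ₗ parity k n) := hT.mul hP
  have h2 : Intertwines ψ (g * negSp k n) (parity k n ∘ₗ u.1) := by
    rw [mul_negSp]; exact hP.mul hT
  have h3 : u.1 ∘ₗ parity k n ≠ 0 := by
    intro h
    have h4 : u⁻¹.1 * (u.1 * parity k n) * parity k n = 0 := by
      change u⁻¹.1 * (u.1 ∘ₗ parity k n) * parity k n = 0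
      rw [h, mul_zero, zero_mul]
    rw [← mul_assoc, Units.inv_mul, one_mul, parity_mul_parity] at h4
    exact h0 (by rw [← mul_one u.1, h4, mul_zero])
  obtain ⟨c, hc⟩ := h1.exists_eq_smul hψ h2 h3
  have hc' : parity k n * u.1 = c • (u.1 * parity k n) := hc
  have h5 : LinearMap.trace ℂ _ (parity k n * u.1 * u⁻¹.1) =
      LinearMap.trace ℂ _ (c • (u.1 * parity k n) * u⁻¹.1) := by rw [hc']
  rw [mul_assoc, Units.mul_inv, mul_one, smul_mul_assoc, map_smul, LinearMap.trace_mul_comm,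
    ← mul_assoc, Units.inv_mul, one_mul, trace_parity, smul_eq_mul, mul_one] at h5
  rw [Commute, SemiconjBy, hc', ← h5, one_smul]

end Parity

/-! ### Determinants on the range of an idempotent -/

section DetOn

variable {V : Type*} [AddCommGroup V] [Module ℂ V]

/-- The determinant of `T` on the range of an idempotent `e` that commutes with `T`. -/
noncomputable def detOn (e T : Module.End ℂ V) : ℂ := LinearMap.det (T * e + (1 - e))

variable {e T T' : Module.End ℂ V}

lemma detOn_one : detOn e (1 : Module.End ℂ V) = 1 := by
  rw [detOn, one_mul, add_sub_cancel, map_one]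

lemma detOn_mul (he : IsIdempotentElem e) (hT' : Commute T' e) :
    detOn e (T * T') = detOn e T * detOn e T' := by
  have h1 : e * e = e := he
  have h2 : T' * e = e * T' := hT'
  have h3 : (T * e + (1 - e)) * (T' * e + (1 - e)) = T * T' * e + (1 - e) := by
    calc (T * e + (1 - e)) * (T' * e + (1 - e))
        = T * (e * T') * e + T * (e - e * e) + T' * e - e * T' * e + (1 - e) - (e - e * e) := by
          noncomm_ring
      _ = T * T' * e + (1 - e) := by
          rw [h1, ← h2, mul_assoc T' e e, h1, sub_self]
          rw [mul_assoc T (T' * e) e, mul_assoc T' e e, h1]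
          noncomm_ring
  rw [detOn, detOn, detOn, ← map_mul, h3]

lemma detOn_ne_zero (he : IsIdempotentElem e) (hT : IsUnit T) (hc : Commute T e) :
    detOn e T ≠ 0 := by
  obtain ⟨u, rfl⟩ := hT
  have hc' : Commute u⁻¹.1 e := hc.units_inv_left
  have h := detOn_mul (T := u.1) he hc'
  rw [Units.mul_inv, detOn_one] at h
  exact left_ne_zero_of_mul (h ▸ one_ne_zero)

variable [FiniteDimensional ℂ V]

lemma detOn_smul_one (he : IsIdempotentElem e) (c : ℂ) :
    detOn e (c • (1 : Module.End ℂ V)) = c ^ Module.finrank ℂ (LinearMap.range e) := by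
  have hp := (LinearMap.isProj_range_iff_isIdempotentElem e).mpr he
  set ε := (LinearMap.range e).prodEquivOfIsCompl e.ker hp.isCompl with hε
  have h1 : e = ε.conj (LinearMap.prodMap LinearMap.id 0) := hp.eq_conj_prodMap
  have h2 : c • (1 : Module.End ℂ V) * e + (1 - e) =
      ε.conj (LinearMap.prodMap (c • LinearMap.id) LinearMap.id) := by
    have h3 : (LinearMap.prodMap (c • LinearMap.id) LinearMap.id :
        Module.End ℂ (LinearMap.range e × LinearMap.ker e)) =
        c • LinearMap.prodMap LinearMap.id 0 +
          (LinearMap.id - LinearMap.prodMap LinearMap.id 0) := by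
      refine LinearMap.ext fun x => Prod.ext ?_ ?_ <;> simp
    rw [h3, map_add, map_sub, map_smul, ← h1, LinearEquiv.conj_id, smul_mul_assoc, one_mul]
    rfl
  rw [detOn, h2, LinearEquiv.conj_apply, LinearMap.comp_assoc, LinearMap.det_conj,
    LinearMap.det_prodMap, LinearMap.det_smul]
  simp

lemma detOn_smul (he : IsIdempotentElem e) (hT : Commute T e) (c : ℂ) :
    detOn e (c • T) = c ^ Module.finrank ℂ (LinearMap.range e) * detOn e T := by
  rw [← detOn_smul_one he, ← detOn_mul he hT, smul_mul_assoc, one_mul]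

lemma trace_eq_finrank_range (he : IsIdempotentElem e) :
    LinearMap.trace ℂ V e = Module.finrank ℂ (LinearMap.range e) :=
  ((LinearMap.isProj_range_iff_isIdempotentElem e).mpr he).trace

end DetOn

/-! ### Existence of the Weil representation -/

section Existence

variable {k : Type*} [Field k] {n : ℕ}

variable (k n) in
/-- The projection to the even functions. -/
noncomputable def evenProj : Module.End ℂ (X k n → ℂ) := (2⁻¹ : ℂ) • (1 + parity k n)

variable (k n) in
/-- The projection to the odd functions. -/
noncomputable def oddProj : Module.End ℂ (X k n → ℂ) := (2⁻¹ : ℂ) • (1 - parity k n)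

lemma isIdempotentElem_evenProj : IsIdempotentElem (evenProj k n) := by
  have h : (1 + parity k n) * (1 + parity k n) = (2 : ℂ) • (1 + parity k n) := by
    rw [add_mul, mul_add, mul_add, parity_mul_parity, one_mul, mul_one, two_smul]
    noncomm_ring
  rw [IsIdempotentElem, evenProj, smul_mul_assoc, mul_smul_comm, h, smul_smul, smul_smul]
  norm_num

lemma isIdempotentElem_oddProj : IsIdempotentElem (oddProj k n) := by
  have h : (1 - parity k n) * (1 - parity k n) = (2 : ℂ) • (1 - parity k n) := by
    rw [sub_mul, mul_sub, mul_sub, parity_mul_parity, one_mul, mul_one, two_smul]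
    noncomm_ring
  rw [IsIdempotentElem, oddProj, smul_mul_assoc, mul_smul_comm, h, smul_smul, smul_smul]
  norm_num

lemma commute_evenProj {T : Module.End ℂ (X k n → ℂ)} (h : Commute T (parity k n)) :
    Commute T (evenProj k n) := ((Commute.one_right T).add_right h).smul_right _

lemma commute_oddProj {T : Module.End ℂ (X k n → ℂ)} (h : Commute T (parity k n)) :
    Commute T (oddProj k n) := ((Commute.one_right T).sub_right h).smul_right _

/-- The operator `T` is normalised if it has the same determinant on the even and on the odd
functions. As the dimensions of these spaces differ by one, every invertible operator that commutes
with the parity operator has exactly one non-zero multiple that is normalised. -/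
def IsNormalised (T : Module.End ℂ (X k n → ℂ)) : Prop :=
  detOn (evenProj k n) T = detOn (oddProj k n) T

lemma isNormalised_one : IsNormalised (1 : Module.End ℂ (X k n → ℂ)) := by
  rw [IsNormalised, detOn_one, detOn_one]

lemma IsNormalised.mul {T T' : Module.End ℂ (X k n → ℂ)} (hT : IsNormalised T)
    (hT' : IsNormalised T') (hc : Commute T' (parity k n)) : IsNormalised (T * T') := by
  rw [IsNormalised, detOn_mul isIdempotentElem_evenProj (commute_evenProj hc),
    detOn_mul isIdempotentElem_oddProj (commute_oddProj hc), hT, hT']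

variable [NeZero (2 : k)] [Fintype k] [DecidableEq k]

/-- The dimensions of the spaces of even and of odd functions differ by one, as `0` is the only
fixed point of `x ↦ -x`. -/
lemma finrank_even : Module.finrank ℂ (LinearMap.range (evenProj k n)) =
    Module.finrank ℂ (LinearMap.range (oddProj k n)) + 1 := by
  have h1 := trace_eq_finrank_range (isIdempotentElem_evenProj (k := k) (n := n))
  have h2 := trace_eq_finrank_range (isIdempotentElem_oddProj (k := k) (n := n))
  rw [evenProj, map_smul, map_add, trace_parity] at h1
  rw [oddProj, map_smul, map_sub, trace_parity] at h2
  rw [← @Nat.cast_inj ℂ, Nat.cast_add, evenProj, oddProj, ← h1, ← h2]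
  simp only [smul_eq_mul, Nat.cast_one]
  ring

lemma isNormalised_smul_iff {T : Module.End ℂ (X k n → ℂ)} (hc : Commute T (parity k n)) {c : ℂ}
    (h0 : c ≠ 0) : IsNormalised (c • T) ↔
      c * detOn (evenProj k n) T = detOn (oddProj k n) T := by
  rw [IsNormalised, detOn_smul isIdempotentElem_evenProj (commute_evenProj hc),
    detOn_smul isIdempotentElem_oddProj (commute_oddProj hc), finrank_even, pow_succ, mul_assoc,
    mul_right_inj' (pow_ne_zero _ h0)]

/-- Every twist of the Schrödinger representation has a normalised intertwining operator. -/
lemma exists_normalised {ψ : AddChar k ℂ} (hψ : ψ ≠ 1) (g : Sp k n) :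
    ∃ T : Module.End ℂ (X k n → ℂ), Intertwines ψ g T ∧ T ≠ 0 ∧ IsNormalised T := by
  obtain ⟨T, hT, h0⟩ := exists_intertwines hψ g
  have hc := hT.commute_parity hψ
  have h1 := detOn_ne_zero isIdempotentElem_evenProj (hT.isUnit hψ h0) (commute_evenProj hc)
  have h2 := detOn_ne_zero isIdempotentElem_oddProj (hT.isUnit hψ h0) (commute_oddProj hc)
  have h3 := div_ne_zero h2 h1
  refine ⟨(detOn (oddProj k n) T / detOn (evenProj k n) T) • T, fun h => ?_, smul_ne_zero h3 h0,
    (isNormalised_smul_iff hc h3).mpr (div_mul_cancel₀ _ h1)⟩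
  rw [LinearMap.smul_comp, hT, LinearMap.comp_smul]

lemma Intertwines.eq_of_isNormalised {ψ : AddChar k ℂ} (hψ : ψ ≠ 1) {g : Sp k n}
    {T T' : Module.End ℂ (X k n → ℂ)} (hT : Intertwines ψ g T) (hT' : Intertwines ψ g T')
    (h0 : T ≠ 0) (h0' : T' ≠ 0) (hn : IsNormalised T) (hn' : IsNormalised T') : T = T' := by
  obtain ⟨c, rfl⟩ := hT.exists_eq_smul hψ hT' h0
  have hc : c ≠ 0 := fun h => h0' (by rw [h, zero_smul])
  have hP := hT.commute_parity hψ
  have h1 := detOn_ne_zero isIdempotentElem_evenProj (hT.isUnit hψ h0) (commute_evenProj hP)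
  have h2 : c * detOn (evenProj k n) T = 1 * detOn (evenProj k n) T := by
    rw [(isNormalised_smul_iff hP hc).mp hn', one_mul, hn]
  rw [mul_right_cancel₀ h1 h2, one_smul]

/-- The Weil representation exists: the normalised intertwining operators are closed under
composition. -/
theorem exists_isWeil {ψ : AddChar k ℂ} (hψ : ψ ≠ 1) :
    ∃ ω : Representation ℂ (Sp k n) (X k n → ℂ), IsWeil ψ ω := by
  choose T hT h0 hn using exists_normalised (k := k) (n := n) hψ
  have hne : (1 : Module.End ℂ (X k n → ℂ)) ≠ 0 := one_ne_zero
  refine ⟨⟨⟨T, ?_⟩, ?_⟩, hT⟩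
  · exact (hT 1).eq_of_isNormalised hψ (Intertwines.one ψ) (h0 1) hne (hn 1) isNormalised_one
  · intro g g'
    refine (hT _).eq_of_isNormalised hψ ((hT g).mul (hT g')) (h0 _) ?_ (hn _)
      ((hn g).mul (hn g') ((hT g').commute_parity hψ))
    exact (((hT g).isUnit hψ (h0 g)).mul ((hT g').isUnit hψ (h0 g'))).ne_zero

end Existence

/-! ### Substitution operators -/

section Substitution

variable {k : Type*} [Field k] {n : ℕ}

/-- The operator `f ↦ f(a⁻¹ ·)`. -/
def substOp (a : X k n ≃+ X k n) : Module.End ℂ (X k n → ℂ) := LinearMap.funLeft ℂ ℂ a.symm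

lemma substOp_apply (a : X k n ≃+ X k n) (f : X k n → ℂ) (x : X k n) :
    substOp a f x = f (a.symm x) := rfl

lemma substOp_mul (a b : X k n ≃+ X k n) : substOp a * substOp b = substOp (b.trans a) := rfl

lemma substOp_ne_zero (a : X k n ≃+ X k n) : substOp a ≠ 0 := fun h => by
  have := congrFun (LinearMap.congr_fun h fun _ => 1) 0
  simp [substOp_apply] at this

/-- A symplectic automorphism that preserves both `X` and `Y` is intertwined by the substitution
operator of its restriction to `X`. -/
lemma intertwines_substOp [NeZero (2 : k)] (ψ : AddChar k ℂ) {g : Sp k n} (a : X k n ≃+ X k n)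
    (hX : ∀ x, g.1 (inX x) = inX (a x)) (hY : ∀ y, (g.1 (inY y)).toCols₁ = 0) :
    Intertwines ψ g (substOp a) := by
  intro h
  refine LinearMap.ext fun f => funext fun x => ?_
  have hY' : ∀ y, g.1 (inY y) = inY (g.1 (inY y)).toCols₂ := fun y => by
    conv_lhs => rw [eq_inX_add_inY (g.1 (inY y)), hY, inX_zero, zero_add]
  set y' := (g.1 (inY h.vec.toCols₂)).toCols₂ with hy'
  have hv : (spAct g h).vec = inX (a h.vec.toCols₁) + inY y' := by
    rw [← hY', ← hX, ← map_add, ← eq_inX_add_inY]; rfl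
  have e1 : (spAct g h).vec.toCols₁ = a h.vec.toCols₁ := by rw [hv, toCols₁_inX_add_inY]
  have e2 : (spAct g h).vec.toCols₂ = y' := by rw [hv, toCols₂_inX_add_inY]
  have e3 : ∀ x', form (inY y') (inX (a x')) = form (inY h.vec.toCols₂) (inX x') := by
    intro x'
    rw [← hY', ← hX, g.2]
  have e4 : form (inY y') (inX x) = form (inY h.vec.toCols₂) (inX (a.symm x)) := by
    rw [← e3, a.apply_symm_apply]
  rw [LinearMap.comp_apply, LinearMap.comp_apply, substOp_apply, schrodinger_apply,
    schrodinger_apply, substOp_apply, e1, e2, e3, e4, map_sub a.symm,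
    a.symm_apply_apply]
  rfl

lemma trace_substOp [Fintype k] [DecidableEq k] (a : X k n ≃+ X k n) :
    LinearMap.trace ℂ _ (substOp a) = Finset.card {x : X k n | a x = x} := by
  rw [trace_eq_sum_single, Finset.card_filter, Nat.cast_sum]
  refine Finset.sum_congr rfl fun x _ => ?_
  simp [substOp_apply, Pi.single_apply, AddEquiv.symm_apply_eq, eq_comm (a := x)]

lemma trace_substOp_ne_zero [Fintype k] [DecidableEq k] (a : X k n ≃+ X k n) :
    LinearMap.trace ℂ _ (substOp a) ≠ 0 := by
  rw [trace_substOp]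
  exact Nat.cast_ne_zero.mpr (Finset.card_ne_zero.mpr ⟨0, by simp⟩)

lemma trace_substOp_symm [Fintype k] [DecidableEq k] (a : X k n ≃+ X k n) :
    LinearMap.trace ℂ _ (substOp a.symm) = LinearMap.trace ℂ _ (substOp a) := by
  rw [trace_substOp, trace_substOp]
  congr 2
  ext x
  simp [AddEquiv.symm_apply_eq, eq_comm (a := x)]

end Substitution

/-! ### The Weil representation on commutators -/

section Scalars

variable {k : Type*} [Field k] {n : ℕ} [NeZero (2 : k)] [Fintype k] [DecidableEq k]
  {ψ : AddChar k ℂ} {ω : Representation ℂ (Sp k n) (X k n → ℂ)}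

lemma isUnit_rep {G V : Type*} [Group G] [AddCommGroup V] [Module ℂ V]
    (ω : Representation ℂ G V) (g : G) : IsUnit (ω g) := (Group.isUnit g).map ω

lemma IsWeil.exists_smul (hω : IsWeil ψ ω) (hψ : ψ ≠ 1) {g : Sp k n}
    {T : Module.End ℂ (X k n → ℂ)} (hT : Intertwines ψ g T) (h0 : T ≠ 0) :
    ∃ c : ℂ, c ≠ 0 ∧ T = c • ω g := by
  obtain ⟨c, rfl⟩ := Intertwines.exists_eq_smul hψ (hω g) hT (isUnit_rep ω g).ne_zero
  exact ⟨c, fun h => h0 (by rw [h, zero_smul]), rfl⟩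

/-- On commutators the Weil representation is determined by any choice of intertwining
operators. -/
lemma IsWeil.eq_of_commutator (hω : IsWeil ψ ω) (hψ : ψ ≠ 1) {g h z : Sp k n}
    {A B C : Module.End ℂ (X k n → ℂ)} (hA : Intertwines ψ g A) (hA0 : A ≠ 0)
    (hB : Intertwines ψ h B) (hB0 : B ≠ 0) (hz : z * (h * g) = g * h)
    (hC : C * (B * A) = A * B) : ω z = C := by
  obtain ⟨a, ha, rfl⟩ := hω.exists_smul hψ hA hA0
  obtain ⟨b, hb, rfl⟩ := hω.exists_smul hψ hB hB0
  simp only [smul_mul_assoc, mul_smul_comm, smul_smul, ← map_mul] at hC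
  rw [mul_comm b a, ← hz, map_mul ω z] at hC
  exact (((isUnit_rep ω (h * g)).mul_left_inj).mp
    (smul_right_injective _ (mul_ne_zero ha hb) hC)).symm

end Scalars

/-! ### The action of `SL₂(k)` -/

section SL

variable {k : Type*} [Field k] {n : ℕ}

/-- Left multiplication by `g ∈ SL₂(k)` on `X`. -/
def slX (g : SpecialLinearGroup (Fin 2) k) : X k n ≃+ X k n where
  toFun x := g.1 * x
  invFun x := g⁻¹.1 * x
  left_inv x := by
    have h : g⁻¹.1 * g.1 = 1 := congrArg Subtype.val (inv_mul_cancel g)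
    change g⁻¹.1 * (g.1 * x) = x
    rw [← Matrix.mul_assoc, h, Matrix.one_mul]
  right_inv x := by
    have h : g.1 * g⁻¹.1 = 1 := congrArg Subtype.val (mul_inv_cancel g)
    change g.1 * (g⁻¹.1 * x) = x
    rw [← Matrix.mul_assoc, h, Matrix.one_mul]
  map_add' x y := Matrix.mul_add _ x y

lemma slX_mul (g h : SpecialLinearGroup (Fin 2) k) :
    (slX (g * h) : X k n ≃+ X k n) = (slX h).trans (slX g) :=
  AddEquiv.ext fun x => Matrix.mul_assoc g.1 h.1 x

lemma sl_val_mul (g h : SpecialLinearGroup (Fin 2) k) : (g * h).1 = g.1 * h.1 := rfl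

lemma intertwines_slX [NeZero (2 : k)] (ψ : AddChar k ℂ) (g : SpecialLinearGroup (Fin 2) k) :
    Intertwines ψ (slToSp g : Sp k n) (substOp (slX g)) := by
  refine intertwines_substOp ψ _ (fun x => ?_) fun y => ?_
  · change g.1 * inX x = inX (g.1 * x)
    rw [inX, inX, mul_fromCols, Matrix.mul_zero]
  · change (g.1 * inY y).toCols₁ = 0
    rw [inY, mul_fromCols, Matrix.mul_zero, toCols₁_fromCols]

/-- The upper unipotent element of `SL₂(k)`. -/
def slU (x : k) : SpecialLinearGroup (Fin 2) k := ⟨!![1, x; 0, 1], by simp [det_fin_two]⟩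

/-- The lower unipotent element of `SL₂(k)`. -/
def slL (x : k) : SpecialLinearGroup (Fin 2) k := ⟨!![1, 0; x, 1], by simp [det_fin_two]⟩

/-- The diagonal element of `SL₂(k)`. -/
def slD (t : k) (ht : t ≠ 0) : SpecialLinearGroup (Fin 2) k :=
  ⟨!![t, 0; 0, t⁻¹], by simp [det_fin_two, ht]⟩

lemma slU_val (x : k) : (slU x).1 = !![1, x; 0, 1] := rfl

lemma slL_val (x : k) : (slL x).1 = !![1, 0; x, 1] := rfl

lemma slD_val (t : k) (ht : t ≠ 0) : (slD t ht).1 = !![t, 0; 0, t⁻¹] := rfl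

/-- `SL₂` is generated by its unipotent elements. -/
lemma sl_induction {p : SpecialLinearGroup (Fin 2) k → Prop} (hU : ∀ x, p (slU x))
    (hL : ∀ x, p (slL x)) (hmul : ∀ g h, p g → p h → p (g * h))
    (g : SpecialLinearGroup (Fin 2) k) : p g := by
  have key : ∀ g : SpecialLinearGroup (Fin 2) k, g.1 1 0 ≠ 0 → p g := by
    intro g hc
    have hdet := g.2
    rw [det_fin_two] at hdet
    have e : g = slU ((g.1 0 0 - 1) / g.1 1 0) * slL (g.1 1 0) *
        slU ((g.1 1 1 - 1) / g.1 1 0) := by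
      apply Subtype.ext
      simp only [sl_val_mul, slU_val, slL_val]
      ext i j
      fin_cases i <;> fin_cases j <;>
        simp [Matrix.mul_apply, Fin.sum_univ_two, hc]
      · field_simp
        linear_combination -hdet
      · field_simp
        ring
    rw [e]
    exact hmul _ _ (hmul _ _ (hU _) (hL _)) (hU _)
  by_cases hc : g.1 1 0 = 0
  · have hdet := g.2
    rw [det_fin_two, hc, mul_zero, sub_zero] at hdet
    have hd : g.1 1 1 ≠ 0 := right_ne_zero_of_mul (hdet ▸ one_ne_zero)
    have e : g = g * slL 1 * slL (-1) := by
      have : slL (1 : k) * slL (-1) = 1 := by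
        apply Subtype.ext
        rw [sl_val_mul, slL_val, slL_val]
        ext i j
        fin_cases i <;> fin_cases j <;> simp [Matrix.mul_apply, Fin.sum_univ_two]
      rw [mul_assoc, this, mul_one]
    rw [e]
    refine hmul _ _ (key _ ?_) (hL _)
    rw [sl_val_mul, slL_val]
    simpa [Matrix.mul_apply, Fin.sum_univ_two, hc] using hd
  · exact key g hc

/-- A field with more than three elements contains an element different from `0`, `1` and `-1`. -/
lemma exists_sq_ne_one [Fintype k] (hq : 3 < Fintype.card k) : ∃ t : k, t ≠ 0 ∧ t ^ 2 - 1 ≠ 0 := by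
  classical
  have h : ({0, 1, -1} : Finset k).card < (Finset.univ : Finset k).card :=
    Finset.card_le_three.trans_lt (by rwa [Finset.card_univ])
  obtain ⟨t, -, ht⟩ := Finset.exists_mem_notMem_of_card_lt_card h
  simp only [Finset.mem_insert, Finset.mem_singleton, not_or] at ht
  refine ⟨t, ht.1, fun h' => ?_⟩
  rcases sq_eq_one_iff.mp (sub_eq_zero.mp h') with h1 | h1
  · exact ht.2.1 h1
  · exact ht.2.2 h1

variable [NeZero (2 : k)] [Fintype k] [DecidableEq k]
  {ψ : AddChar k ℂ} {ω : Representation ℂ (Sp k n) (X k n → ℂ)}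

/-- `SL₂(k)` acts through the Weil representation by substitutions: the unipotent elements are
commutators as `q > 3`. -/
lemma IsWeil.apply_sl (hω : IsWeil ψ ω) (hψ : ψ ≠ 1) (hq : 3 < Fintype.card k)
    (g : SpecialLinearGroup (Fin 2) k) : ω (slToSp g) = substOp (slX g) := by
  obtain ⟨t, ht, ht2⟩ := exists_sq_ne_one hq
  have key : ∀ a b z : SpecialLinearGroup (Fin 2) k, z * (b * a) = a * b →
      ω (slToSp z) = substOp (slX z) := by
    intro a b z h
    refine hω.eq_of_commutator hψ (intertwines_slX ψ a) (substOp_ne_zero _)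
      (intertwines_slX ψ b) (substOp_ne_zero _) ?_ ?_
    · rw [← map_mul, ← map_mul, ← map_mul, h]
    · rw [substOp_mul, substOp_mul, substOp_mul, ← slX_mul, ← slX_mul, ← slX_mul, h]
  induction g using sl_induction with
  | hU x =>
    refine key (slD t ht) (slU (x / (t ^ 2 - 1))) _ (Subtype.ext ?_)
    simp only [sl_val_mul, slU_val, slD_val]
    ext i j
    fin_cases i <;> fin_cases j <;> simp [Matrix.mul_apply, Fin.sum_univ_two]
    field_simp
    ring
  | hL x =>
    refine key (slD t⁻¹ (inv_ne_zero ht)) (slL (x / (t ^ 2 - 1))) _ (Subtype.ext ?_)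
    simp only [sl_val_mul, slL_val, slD_val]
    ext i j
    fin_cases i <;> fin_cases j <;> simp [Matrix.mul_apply, Fin.sum_univ_two]
    field_simp
    ring
  | hmul g h hg hh => rw [map_mul, map_mul, hg, hh, substOp_mul, ← slX_mul]

end SL

/-! ### The elements of the orthogonal group and their action on `W` -/

section Orthogonal

variable {k : Type*} [Field k] {n : ℕ}

lemma Oq.ext_val {g h : Oq k n} (e : g.1.1 = h.1.1) : g = h := Subtype.ext (Units.ext e)

lemma Oq.val_mul (g h : Oq k n) : (g * h).1.1 = g.1.1 * h.1.1 := rfl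

lemma Oq.val_inv (g : Oq k n) : g⁻¹.1.1 = F k n * g.1.1ᵀ * F k n := by
  have h1 : g.1.1 * (F k n * g.1.1ᵀ * F k n) = 1 := by
    have hg : g.1.1 * F k n * g.1.1ᵀ = F k n := g.2
    rw [← Matrix.mul_assoc, ← Matrix.mul_assoc, hg, F_mul_F]
  have h2 : g⁻¹.1.1 * g.1.1 = 1 := by
    rw [← Oq.val_mul, inv_mul_cancel]; rfl
  calc g⁻¹.1.1 = g⁻¹.1.1 * (g.1.1 * (F k n * g.1.1ᵀ * F k n)) := by rw [h1, Matrix.mul_one]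
    _ = F k n * g.1.1ᵀ * F k n := by rw [← Matrix.mul_assoc, h2, Matrix.one_mul]

lemma tilde_neg (a : A k n) : tilde (-a) = -tilde a := by simp [tilde_eq]

lemma tilde_smul (c : k) (a : A k n) : tilde (c • a) = c • tilde a := by simp [tilde_eq]

lemma tilde_mul_tilde_inv (a : (A k n)ˣ) : tilde a.1 * tilde a⁻¹.1 = 1 := by
  rw [← tilde_mul, Units.inv_mul, tilde_one]

lemma tilde_inv (a : (A k n)ˣ) : (tilde a.1)⁻¹ = tilde a⁻¹.1 :=
  Matrix.inv_eq_right_inv (tilde_mul_tilde_inv a)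

lemma hElt_val (a : (A k n)ˣ) : (hElt a).1.1 = fromBlocks a.1 0 0 (tilde a⁻¹.1) := by
  rw [← tilde_inv]; rfl

lemma uElt_val (s : A k n) (hs : tilde s = s) : (uElt s hs).1.1 = fromBlocks 1 s 0 1 := rfl

lemma wElt_val : (wElt : Oq k n).1.1 = fromBlocks 0 1 (-1) 0 := rfl

lemma hElt_mul (a b : (A k n)ˣ) : hElt (a * b) = hElt a * hElt b := by
  apply Oq.ext_val
  rw [Oq.val_mul, hElt_val, hElt_val, hElt_val, _root_.mul_inv_rev, Units.val_mul, Units.val_mul,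
    tilde_mul]
  simp [fromBlocks_multiply]

lemma hElt_inv (a : (A k n)ˣ) : (hElt a)⁻¹ = hElt a⁻¹ := by
  rw [inv_eq_iff_mul_eq_one, ← hElt_mul, mul_inv_cancel]
  apply Oq.ext_val
  rw [hElt_val, inv_one, Units.val_one, tilde_one, fromBlocks_one]
  rfl

lemma uElt_inv_val (s : A k n) (hs : tilde s = s) :
    (uElt s hs)⁻¹.1.1 = fromBlocks 1 (-s) 0 1 := by
  have h : (uElt s hs)⁻¹ = uElt (-s) (by rw [tilde_neg, hs]) := by
    rw [inv_eq_iff_mul_eq_one]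
    apply Oq.ext_val
    rw [Oq.val_mul, uElt_val, uElt_val, fromBlocks_multiply]
    simp only [Matrix.one_mul, Matrix.mul_one, Matrix.mul_zero, Matrix.zero_mul, add_zero,
      zero_add, neg_add_cancel]
    exact fromBlocks_one
  rw [h, uElt_val]

lemma wElt_inv_val : (wElt : Oq k n)⁻¹.1.1 = fromBlocks 0 (-1) 1 0 := by
  have h : (wElt : Oq k n).1.1 * fromBlocks 0 (-1) 1 0 = 1 := by
    rw [wElt_val, fromBlocks_multiply]
    simp [fromBlocks_one]
  have h2 : (wElt : Oq k n)⁻¹.1.1 * (wElt : Oq k n).1.1 = 1 := by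
    rw [← Oq.val_mul, inv_mul_cancel]; rfl
  exact left_inv_eq_right_inv h2 h

lemma orthToSp_apply (g : Oq k n) (v : W k n) : (orthToSp g).1 v = v * g⁻¹.1.1 := rfl

lemma inX_add_inY_mul_fromBlocks (x y : X k n) (a b c d : A k n) :
    (inX x + inY y) * fromBlocks a b c d = inX (x * a + y * c) + inY (x * b + y * d) := by
  rw [Matrix.add_mul, inX, inY, fromCols_mul_fromBlocks, fromCols_mul_fromBlocks]
  ext i (j | j) <;> simp [inX, inY]

lemma inX_mul_fromBlocks (x : X k n) (a b c d : A k n) :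
    inX x * fromBlocks a b c d = inX (x * a) + inY (x * b) := by
  simpa [inY_zero] using inX_add_inY_mul_fromBlocks x 0 a b c d

lemma inY_mul_fromBlocks (y : X k n) (a b c d : A k n) :
    inY y * fromBlocks a b c d = inX (y * c) + inY (y * d) := by
  simpa [inX_zero] using inX_add_inY_mul_fromBlocks 0 y a b c d

/-- The action of `O_q(2n,2n)` commutes with that of `SL₂(k)` on `W`. -/
lemma commute_orthToSp_slToSp (g : Oq k n) (h : SpecialLinearGroup (Fin 2) k) :
    Commute (orthToSp g) (slToSp h : Sp k n) :=
  Subtype.ext (LinearEquiv.ext fun v => Matrix.mul_assoc h.1 v g⁻¹.1.1)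

end Orthogonal

/-! ### Matrices with two rows -/

section Rows

lemma ext_rows {R ι : Type*} {v v' : Matrix (Fin 2) ι R} (h0 : v 0 = v' 0) (h1 : v 1 = v' 1) :
    v = v' := by
  funext i
  fin_cases i
  · exact h0
  · exact h1

/-- The matrix with rows `u` and `v`. -/
def rows {R ι : Type*} (u v : ι → R) : Matrix (Fin 2) ι R := of ![u, v]

lemma rows_zero {R ι : Type*} (u v : ι → R) : rows u v 0 = u := rfl

lemma rows_one {R ι : Type*} (u v : ι → R) : rows u v 1 = v := rfl

end Rows

/-! ### The action of `h_a` -/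

section Levi

variable {k : Type*} [Field k] {n : ℕ}

/-- Right multiplication by `a⁻¹` on `X`. -/
def leviX (a : (A k n)ˣ) : X k n ≃+ X k n where
  toFun x := x * a⁻¹.1
  invFun x := x * a.1
  left_inv x := by
    change x * a⁻¹.1 * a.1 = x
    rw [Matrix.mul_assoc, Units.inv_mul, Matrix.mul_one]
  right_inv x := by
    change x * a.1 * a⁻¹.1 = x
    rw [Matrix.mul_assoc, Units.mul_inv, Matrix.mul_one]
  map_add' x y := Matrix.add_mul x y _

lemma leviX_mul (a b : (A k n)ˣ) : leviX (a * b) = (leviX b).trans (leviX a) := by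
  refine AddEquiv.ext fun x => ?_
  change x * (a * b)⁻¹.1 = x * b⁻¹.1 * a⁻¹.1
  rw [_root_.mul_inv_rev, Units.val_mul, Matrix.mul_assoc]

lemma intertwines_leviX [NeZero (2 : k)] (ψ : AddChar k ℂ) (a : (A k n)ˣ) :
    Intertwines ψ (orthToSp (hElt a)) (substOp (leviX a)) := by
  have h : (hElt a)⁻¹.1.1 = fromBlocks a⁻¹.1 0 0 (tilde a.1) := by
    rw [hElt_inv, hElt_val, inv_inv]
  refine intertwines_substOp ψ _ (fun x => ?_) fun y => ?_
  · rw [orthToSp_apply, h, inX_mul_fromBlocks, Matrix.mul_zero, inY_zero, add_zero]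
    rfl
  · rw [orthToSp_apply, h, inY_mul_fromBlocks, toCols₁_inX_add_inY, Matrix.mul_zero]

lemma form_eq_rows (v v' : W k n) :
    form v v' = (v 1 ᵥ* F k n) ⬝ᵥ v' 0 - (v 0 ᵥ* F k n) ⬝ᵥ v' 1 := by
  have e : ∀ i j, (v * F k n * v'ᵀ) i j = (v i ᵥ* F k n) ⬝ᵥ v' j := fun i j => rfl
  rw [form, trace_fin_two, Matrix.mul_apply, Matrix.mul_apply]
  simp [Fin.sum_univ_two, e]
  ring

/-- The endomorphism of `W` that multiplies the first row by `P` and the second row by `Q`. -/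
def rowMul (P Q : Matrix (Idx n ⊕ Idx n) (Idx n ⊕ Idx n) k) : W k n →ₗ[k] W k n where
  toFun v := rows (v 0 ᵥ* P) (v 1 ᵥ* Q)
  map_add' v v' := by
    ext i j
    fin_cases i
    · exact congrFun (add_vecMul P (v 0) (v' 0)) j
    · exact congrFun (add_vecMul Q (v 1) (v' 1)) j
  map_smul' c v := by
    ext i j
    fin_cases i
    · exact congrFun (smul_vecMul c (v 0) P) j
    · exact congrFun (smul_vecMul c (v 1) Q) j

lemma rowMul_zero (P Q : Matrix (Idx n ⊕ Idx n) (Idx n ⊕ Idx n) k) (v : W k n) :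
    rowMul P Q v 0 = v 0 ᵥ* P := rfl

lemma rowMul_one (P Q : Matrix (Idx n ⊕ Idx n) (Idx n ⊕ Idx n) k) (v : W k n) :
    rowMul P Q v 1 = v 1 ᵥ* Q := rfl

lemma rowMul_rowMul (P Q P' Q' : Matrix (Idx n ⊕ Idx n) (Idx n ⊕ Idx n) k) (v : W k n) :
    rowMul P' Q' (rowMul P Q v) = rowMul (P * P') (Q * Q') v :=
  ext_rows (vecMul_vecMul (v 0) P P') (vecMul_vecMul (v 1) Q Q')

lemma rowMul_one_one (v : W k n) : rowMul 1 1 v = v :=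
  ext_rows (vecMul_one (v 0)) (vecMul_one (v 1))

/-- The form on `W` pairs the first row of one argument with the second row of the other. -/
lemma form_rowMul {P Q : Matrix (Idx n ⊕ Idx n) (Idx n ⊕ Idx n) k} (h : Q * F k n * Pᵀ = F k n)
    (v v' : W k n) : form (rowMul P Q v) (rowMul P Q v') = form v v' := by
  have h' : P * F k n * Qᵀ = F k n := by
    have := congrArg transpose h
    rwa [transpose_mul, transpose_mul, transpose_transpose, F_transpose, ← Matrix.mul_assoc] at this
  simp only [form_eq_rows, rowMul_zero, rowMul_one]
  rw [← mulVec_transpose P (v' 0), ← mulVec_transpose Q (v' 1), dotProduct_mulVec,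
    dotProduct_mulVec]
  simp only [vecMul_vecMul, h, h']

lemma rowMul_blocks (a : (A k n)ˣ) :
    fromBlocks 1 0 0 (tilde a.1) * F k n * (fromBlocks a⁻¹.1 0 0 1 : Matrix _ _ k)ᵀ = F k n := by
  have h : tilde a.1 * J k n * a⁻¹.1ᵀ = J k n := by
    rw [← mul_J_transpose, Matrix.mul_assoc, ← transpose_mul, Units.inv_mul, transpose_one,
      Matrix.mul_one]
  simp [F, fromBlocks_multiply, fromBlocks_transpose, h, -coe_units_inv]

/-- The symplectic automorphism of `W` that acts like `h_a` on the first component of `X`, trivially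
on the second component, and dually on `Y`. For `a ≠ 1` it does not belong to the image of
`O_q(2n,2n)`, but `h_a` is the product of two of its conjugates under `SL₂(k)`. -/
noncomputable def rowSp (a : (A k n)ˣ) : Sp k n :=
  ⟨{ rowMul (fromBlocks a⁻¹.1 0 0 1) (fromBlocks 1 0 0 (tilde a.1)) with
      invFun := rowMul (fromBlocks a.1 0 0 1) (fromBlocks 1 0 0 (tilde a⁻¹.1))
      left_inv := fun v => by
        change rowMul _ _ (rowMul _ _ v) = v
        rw [rowMul_rowMul]
        conv_rhs => rw [← rowMul_one_one v]
        rw [← fromBlocks_one]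
        simp [fromBlocks_multiply, tilde_mul_tilde_inv, -coe_units_inv]
      right_inv := fun v => by
        have h := tilde_mul_tilde_inv a⁻¹
        rw [inv_inv] at h
        change rowMul _ _ (rowMul _ _ v) = v
        rw [rowMul_rowMul]
        conv_rhs => rw [← rowMul_one_one v]
        rw [← fromBlocks_one]
        simp [fromBlocks_multiply, h, -coe_units_inv] },
    form_rowMul (rowMul_blocks a)⟩

lemma rowSp_apply (a : (A k n)ˣ) (v : W k n) :
    (rowSp a).1 v = rowMul (fromBlocks a⁻¹.1 0 0 1) (fromBlocks 1 0 0 (tilde a.1)) v := rfl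

/-- The restriction of `rowSp a` to `X`. -/
def rowX (a : (A k n)ˣ) : X k n ≃+ X k n where
  toFun x := rows (x 0 ᵥ* a⁻¹.1) (x 1)
  invFun x := rows (x 0 ᵥ* a.1) (x 1)
  left_inv x := ext_rows (by
    change x 0 ᵥ* a⁻¹.1 ᵥ* a.1 = x 0
    rw [vecMul_vecMul, Units.inv_mul, vecMul_one]) rfl
  right_inv x := ext_rows (by
    change x 0 ᵥ* a.1 ᵥ* a⁻¹.1 = x 0
    rw [vecMul_vecMul, Units.mul_inv, vecMul_one]) rfl
  map_add' x y := ext_rows (add_vecMul a⁻¹.1 (x 0) (y 0)) rfl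

lemma inX_row (x : X k n) (i : Fin 2) : inX x i = Sum.elim (x i) (0 : Idx n → k) := by
  funext j; rcases j with j | j <;> simp [inX]

lemma inY_row (x : X k n) (i : Fin 2) : inY x i = Sum.elim (0 : Idx n → k) (x i) := by
  funext j; rcases j with j | j <;> simp [inY]

lemma intertwines_rowX [NeZero (2 : k)] (ψ : AddChar k ℂ) (a : (A k n)ˣ) :
    Intertwines ψ (rowSp a) (substOp (rowX a)) := by
  refine intertwines_substOp ψ _ (fun x => ext_rows ?_ ?_) fun y => ext_rows ?_ ?_
  · rw [rowSp_apply, rowMul_zero, inX_row, inX_row, vecMul_fromBlocks]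
    simp [rowX, rows_zero, -coe_units_inv]
  · rw [rowSp_apply, rowMul_one, inX_row, inX_row, vecMul_fromBlocks]
    simp [rowX, rows_one, -coe_units_inv]
  · funext j
    change (rowMul (fromBlocks a⁻¹.1 0 0 1) (fromBlocks 1 0 0 (tilde a.1)) (inY y)) 0
      (Sum.inl j) = 0
    rw [rowMul_zero, inY_row, vecMul_fromBlocks]
    simp
  · funext j
    change (rowMul (fromBlocks a⁻¹.1 0 0 1) (fromBlocks 1 0 0 (tilde a.1)) (inY y)) 1
      (Sum.inl j) = 0
    rw [rowMul_one, inY_row, vecMul_fromBlocks]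
    simp

variable (k) in
/-- The Weyl element of `SL₂(k)`. -/
def slW : SpecialLinearGroup (Fin 2) k := ⟨!![0, 1; -1, 0], by simp [det_fin_two]⟩

lemma slW_mul_zero {ι : Type*} (v : Matrix (Fin 2) ι k) : ((slW k).1 * v) 0 = v 1 := by
  funext j; simp [slW, Matrix.mul_apply, Fin.sum_univ_two]

lemma slW_mul_one {ι : Type*} (v : Matrix (Fin 2) ι k) : ((slW k).1 * v) 1 = -v 0 := by
  funext j; simp [slW, Matrix.mul_apply, Fin.sum_univ_two]

variable (k n) in
/-- The matrix `F` as an element of `O_q(2n,2n)`. -/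
def fElt : Oq k n := Oq.ofMatrix (F k n) (by rw [F_mul_F, F_transpose, Matrix.one_mul])

lemma fElt_inv_val : (fElt k n)⁻¹.1.1 = F k n := by
  have h : (fElt k n).1.1 = F k n := rfl
  rw [Oq.val_inv, h, F_transpose, F_mul_F, Matrix.one_mul]

/-- For symmetric `a` the automorphism `rowSp a` is conjugate to its inverse. -/
lemma rowSp_conj {a : (A k n)ˣ} (ha : a.1ᵀ = a.1) :
    rowSp a * (slToSp (slW k) * orthToSp (fElt k n)) * rowSp a =
      slToSp (slW k) * orthToSp (fElt k n) := by
  have ha' : a⁻¹.1ᵀ = a⁻¹.1 := by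
    rw [coe_units_inv, transpose_nonsing_inv, ha]
  have hT : (tilde a.1)ᵀ = tilde a.1 := by
    rw [tilde_eq, transpose_neg, transpose_mul, transpose_mul, J_transpose, ha, ha]
    simp [Matrix.mul_assoc]
  have h1 := rowMul_blocks a
  have h2 := congrArg transpose h1
  rw [transpose_mul, transpose_mul, transpose_transpose, F_transpose, ← Matrix.mul_assoc] at h2
  simp only [fromBlocks_transpose, transpose_zero, transpose_one, ha', hT] at h1 h2
  refine Subtype.ext (LinearEquiv.ext fun v => ?_)
  change rowMul _ _ ((slW k).1 * (rowMul _ _ v * (fElt k n)⁻¹.1.1)) =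
    (slW k).1 * (v * (fElt k n)⁻¹.1.1)
  rw [fElt_inv_val]
  have e : ∀ (v : W k n) i, (v * F k n) i = v i ᵥ* F k n := fun v i => rfl
  refine ext_rows ?_ ?_
  · rw [rowMul_zero, slW_mul_zero, slW_mul_zero, e, e, rowMul_one, vecMul_vecMul, vecMul_vecMul,
      ← Matrix.mul_assoc, h1]
  · rw [rowMul_one, slW_mul_one, slW_mul_one, e, e, rowMul_zero, neg_vecMul, vecMul_vecMul,
      vecMul_vecMul, ← Matrix.mul_assoc, h2]

/-- Conjugating `rowSp a` by the Weyl element of `SL₂(k)` exchanges the two components of `X`, and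
the product of `rowSp a` with this conjugate is `h_a`. -/
lemma rowSp_mul (a : (A k n)ˣ) :
    slToSp (slW k) * rowSp a * (slToSp (slW k) * rowSp a) =
      orthToSp (hElt a) * (slToSp (slW k) * slToSp (slW k)) := by
  have h : (hElt a)⁻¹.1.1 = fromBlocks a⁻¹.1 0 0 (tilde a.1) := by
    rw [hElt_inv, hElt_val, inv_inv]
  have h1 : (fromBlocks a⁻¹.1 0 0 1 : Matrix (Idx n ⊕ Idx n) _ k) *
      fromBlocks 1 0 0 (tilde a.1) = (hElt a)⁻¹.1.1 := by
    rw [h]; simp [fromBlocks_multiply]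
  have h2 : (fromBlocks 1 0 0 (tilde a.1) : Matrix (Idx n ⊕ Idx n) _ k) *
      fromBlocks a⁻¹.1 0 0 1 = (hElt a)⁻¹.1.1 := by
    rw [h]; simp [fromBlocks_multiply]
  refine Subtype.ext (LinearEquiv.ext fun v => ?_)
  change (slW k).1 * rowMul _ _ ((slW k).1 * rowMul _ _ v) =
    (slW k).1 * ((slW k).1 * v) * (hElt a)⁻¹.1.1
  have e : ∀ (v : W k n) i, (v * (hElt a)⁻¹.1.1) i = v i ᵥ* (hElt a)⁻¹.1.1 := fun v i => rfl
  refine ext_rows ?_ ?_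
  · rw [slW_mul_zero, rowMul_one, slW_mul_one, rowMul_zero, e, slW_mul_zero, slW_mul_one,
      neg_vecMul, neg_vecMul, vecMul_vecMul, h1]
  · rw [slW_mul_one, rowMul_zero, slW_mul_zero, rowMul_one, e, slW_mul_one, slW_mul_zero,
      neg_vecMul, vecMul_vecMul, h2]

variable [NeZero (2 : k)] [Fintype k] [DecidableEq k]
  {ψ : AddChar k ℂ} {ω : Representation ℂ (Sp k n) (X k n → ℂ)}

/-- For symmetric `a` the Weil representation of `rowSp a` is a substitution up to a sign. By
`rowSp_conj` the element is conjugate to its inverse, so that the scalar is equal to its inverse: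
compare the traces. -/
lemma IsWeil.apply_rowSp (hω : IsWeil ψ ω) (hψ : ψ ≠ 1) {a : (A k n)ˣ} (ha : a.1ᵀ = a.1) :
    ∃ c : ℂ, c * c = 1 ∧ ω (rowSp a) = c • substOp (rowX a) := by
  obtain ⟨c, hc⟩ := (intertwines_rowX ψ a).exists_eq_smul hψ (hω (rowSp a)) (substOp_ne_zero _)
  refine ⟨c, ?_, hc⟩
  set T := substOp (rowX a) with hT
  set T' := substOp (rowX a).symm with hT'
  have hTT : T * T' = 1 := by
    rw [hT, hT', substOp_mul, AddEquiv.symm_trans_self]; rfl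
  obtain ⟨u, hu⟩ := isUnit_rep ω (slToSp (slW k) * orthToSp (fElt k n))
  have h1 := congrArg ω (rowSp_conj ha)
  rw [map_mul, map_mul, hc, ← hu] at h1
  have h2 : (c * c) • (u⁻¹.1 * T * u.1) = T' := by
    have h3 : u⁻¹.1 * (c • T * u.1 * c • T) * T' = u⁻¹.1 * u.1 * T' := by
      rw [h1]
    rw [Units.inv_mul, one_mul] at h3
    rw [← h3]
    simp only [smul_mul_assoc, mul_smul_comm, smul_smul, mul_assoc, hTT, mul_one]
  have h4 := congrArg (LinearMap.trace ℂ _) h2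
  rw [map_smul, LinearMap.trace_mul_comm, ← mul_assoc, Units.mul_inv, one_mul, hT',
    trace_substOp_symm, smul_eq_mul] at h4
  exact mul_right_cancel₀ (trace_substOp_ne_zero (rowX a)) (by rw [h4, one_mul])

/-- For symmetric `a` the sign of `IsWeil.apply_rowSp` disappears, as `h_a` is a product of two
conjugates of `rowSp a`. -/
lemma IsWeil.apply_h_of_symm (hω : IsWeil ψ ω) (hψ : ψ ≠ 1) (hq : 3 < Fintype.card k)
    {a : (A k n)ˣ} (ha : a.1ᵀ = a.1) : ω (orthToSp (hElt a)) = substOp (leviX a) := by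
  obtain ⟨c, hc, h⟩ := hω.apply_rowSp hψ ha
  have h1 := congrArg ω (rowSp_mul a)
  simp only [map_mul, hω.apply_sl hψ hq, h, mul_smul_comm, smul_mul_assoc, smul_smul, hc,
    one_smul] at h1
  have h2 : IsUnit (substOp (slX (slW k) : X k n ≃+ X k n) * substOp (slX (slW k))) := by
    rw [← hω.apply_sl hψ hq]
    exact (isUnit_rep ω _).mul (isUnit_rep ω _)
  refine h2.mul_left_injective (h1.symm.trans ?_)
  simp only [substOp_mul]
  congr 1
  refine AddEquiv.ext fun x => ?_
  change (slW k).1 * rows (((slW k).1 * rows (x 0 ᵥ* a⁻¹.1) (x 1)) 0 ᵥ* a⁻¹.1)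
    (((slW k).1 * rows (x 0 ᵥ* a⁻¹.1) (x 1)) 1) = (slW k).1 * ((slW k).1 * x) * a⁻¹.1
  have e : ∀ (v : X k n) i, (v * a⁻¹.1) i = v i ᵥ* a⁻¹.1 := fun v i => rfl
  refine ext_rows ?_ ?_
  · rw [slW_mul_zero, rows_one, slW_mul_one, rows_zero, e, slW_mul_zero, slW_mul_one, neg_vecMul]
  · rw [slW_mul_one, rows_zero, slW_mul_zero, rows_one, e, slW_mul_one, slW_mul_zero, neg_vecMul]

/-- Every `h_a` acts by a substitution: diagonal matrices are symmetric, and a transvection is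
conjugate to its square by a diagonal matrix. -/
lemma IsWeil.apply_h (hω : IsWeil ψ ω) (hψ : ψ ≠ 1) (hq : 3 < Fintype.card k) (a : (A k n)ˣ) :
    ω (orthToSp (hElt a)) = substOp (leviX a) := by
  have h2 : (2 : k) ≠ 0 := NeZero.ne 2
  suffices h : ∀ b : A k n, b.det ≠ 0 → ∀ u : (A k n)ˣ, u.1 = b →
      ω (orthToSp (hElt u)) = substOp (leviX u) from
    h a.1 ((isUnit_iff_isUnit_det _).mp a.isUnit).ne_zero a rfl
  intro b hb
  refine diagonal_transvection_induction_of_det_ne_zero (fun b => ∀ u : (A k n)ˣ, u.1 = b →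
    ω (orthToSp (hElt u)) = substOp (leviX u)) b hb ?_ ?_ ?_
  · intro D _ u hu
    exact hω.apply_h_of_symm hψ hq (by rw [hu, diagonal_transpose])
  · intro t u hu
    let d : (A k n)ˣ := GeneralLinearGroup.mkOfDetNeZero (diagonal (Function.update 1 t.i 2)) (by
      rw [det_diagonal, Finset.prod_ne_zero_iff]
      intro i _
      rcases eq_or_ne i t.i with rfl | hi
      · simpa using h2
      · simp [hi])
    have hd : d.1 = diagonal (Function.update 1 t.i 2) := rfl
    have key : u * (u * d) = d * u := by
      apply Units.ext
      rw [Units.val_mul, Units.val_mul, Units.val_mul, hu, hd]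
      rw [← Matrix.mul_assoc, TransvectionStruct.toMatrix,
        transvection_mul_transvection_same _ _ t.hij]
      ext x y
      have hij := t.hij
      simp only [mul_diagonal, diagonal_mul, transvection, Matrix.add_apply, Matrix.one_apply,
        single_apply, Function.update_apply, Pi.one_apply]
      grind
    refine hω.eq_of_commutator hψ (intertwines_leviX ψ d) (substOp_ne_zero _)
      (intertwines_leviX ψ u) (substOp_ne_zero _) ?_ ?_
    · simp only [← map_mul, ← hElt_mul, key]
    · simp only [substOp_mul, ← leviX_mul, key]
  · intro b c hb hc hb' hc' u hu
    have e : u = GeneralLinearGroup.mkOfDetNeZero b hb * GeneralLinearGroup.mkOfDetNeZero c hc :=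
      Units.ext hu
    rw [e, hElt_mul, map_mul, map_mul, hb' _ rfl, hc' _ rfl, substOp_mul, ← leviX_mul]

end Levi

/-! ### The action of `u_s` -/

section Unipotent

variable {k : Type*} [Field k] {n : ℕ}

lemma brk_vecMul (a : A k n) (x y : Idx n → k) : brk (x ᵥ* a) y = brk x (y ᵥ* tilde a) := by
  rw [brk, brk, vecMul_vecMul, ← mul_J_transpose, ← vecMul_vecMul, vecMul_transpose,
    dotProduct_mulVec]

/-- For `s = s^~` the form `(x, y) ↦ [x s, y]` is alternating. -/
lemma brk_vecMul_swap {s : A k n} (hs : tilde s = s) (x y : Idx n → k) :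
    brk (y ᵥ* s) x = -brk (x ᵥ* s) y := by
  rw [brk_vecMul, hs, brk_swap]

/-- The quadratic form `x ↦ [x₀ s, x₁]` on `X`. -/
def quad (s : A k n) (x : X k n) : k := brk (x 0 ᵥ* s) (x 1)

lemma quad_smul_left (c : k) (s : A k n) (x : X k n) : quad (c • s) x = c * quad s x := by
  rw [quad, quad, vecMul_smul, brk_smul_left]

lemma quad_smul_right (c : k) (s : A k n) (x : X k n) : quad s (c • x) = c ^ 2 * quad s x := by
  have e : ∀ i, (c • x) i = c • x i := fun i => rfl
  rw [quad, quad, e, e, smul_vecMul, brk_smul_left, brk_smul_right]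
  ring

lemma quad_sub {s : A k n} (hs : tilde s = s) (x z : X k n) :
    quad s (x - z) = quad s x + quad s z + form (inY (z * s)) (inX x) := by
  have e : ∀ i, (x - z) i = x i - z i := fun i => rfl
  have e' : ∀ i, (z * s) i = z i ᵥ* s := fun i => rfl
  rw [form_inY_inX, quad, quad, quad, e, e, e', e', sub_vecMul, brk_sub_left, brk_sub_right,
    brk_sub_right, brk_vecMul_swap hs (x 0) (z 1)]
  ring

lemma form_inY_mul_self {s : A k n} (hs : tilde s = s) (z : X k n) :
    form (inY (z * s)) (inX z) = -2 * quad s z := by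
  have e' : ∀ i, (z * s) i = z i ᵥ* s := fun i => rfl
  rw [form_inY_inX, quad, e', e', brk_vecMul_swap hs (z 0) (z 1)]
  ring

/-- Multiplication by the function `γ(s, ·)`. -/
def gamOp (ψ : AddChar k ℂ) (s : A k n) : Module.End ℂ (X k n → ℂ) where
  toFun f x := ψ (quad s x) * f x
  map_add' _ _ := funext fun _ => mul_add _ _ _
  map_smul' _ _ := funext fun _ => mul_left_comm _ _ _

lemma gamOp_apply (ψ : AddChar k ℂ) (s : A k n) (f : X k n → ℂ) (x : X k n) :
    gamOp ψ s f x = ψ (quad s x) * f x := rfl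

lemma gamOp_ne_zero (ψ : AddChar k ℂ) (s : A k n) : gamOp ψ s ≠ 0 := fun h => by
  have := congrFun (LinearMap.congr_fun h fun _ => 1) 0
  have e : quad s 0 = 0 := by rw [quad]; exact brk_zero_right _
  rw [gamOp_apply, e] at this
  simp at this

lemma intertwines_gamOp [NeZero (2 : k)] (ψ : AddChar k ℂ) (s : A k n) (hs : tilde s = s) :
    Intertwines ψ (orthToSp (uElt s hs)) (gamOp ψ s) := by
  intro h
  have h2 : (2 : k) ≠ 0 := NeZero.ne 2
  refine LinearMap.ext fun f => funext fun x => ?_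
  set x₀ := h.vec.toCols₁ with hx₀
  set y₀ := h.vec.toCols₂ with hy₀
  have hv : (spAct (orthToSp (uElt s hs)) h).vec = inX x₀ + inY (x₀ * -s + y₀) := by
    change h.vec * (uElt s hs)⁻¹.1.1 = _
    rw [uElt_inv_val, eq_inX_add_inY h.vec, inX_add_inY_mul_fromBlocks]
    simp [hx₀, hy₀]
  have e1 : (spAct (orthToSp (uElt s hs)) h).vec.toCols₁ = x₀ := by
    rw [hv, toCols₁_inX_add_inY]
  have e2 : (spAct (orthToSp (uElt s hs)) h).vec.toCols₂ = -(x₀ * s) + y₀ := by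
    rw [hv, toCols₂_inX_add_inY, Matrix.mul_neg]
  have e3 : (spAct (orthToSp (uElt s hs)) h).cen = h.cen := rfl
  rw [LinearMap.comp_apply, LinearMap.comp_apply, gamOp_apply, schrodinger_apply,
    schrodinger_apply, gamOp_apply, e1, e2, e3, ← hx₀, ← hy₀, ← mul_assoc, ← mul_assoc,
    ← AddChar.map_add_eq_mul, ← AddChar.map_add_eq_mul, quad_sub hs, inY_add, inY_neg,
    form_add_left, form_add_left, form_neg_left, form_neg_left, form_inY_mul_self hs]
  congr 2
  field_simp
  ring

/-- The scalar matrix `t` as a unit of `A`. -/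
def scalarUnit (n : ℕ) (t : kˣ) : (A k n)ˣ where
  val := t.1 • 1
  inv := t⁻¹.1 • 1
  val_inv := by rw [Matrix.smul_mul, Matrix.one_mul, smul_smul, Units.mul_inv, one_smul]
  inv_val := by rw [Matrix.smul_mul, Matrix.one_mul, smul_smul, Units.inv_mul, one_smul]

lemma hElt_scalarUnit_val (t : kˣ) :
    (hElt (scalarUnit n t)).1.1 = fromBlocks (t.1 • 1) 0 0 (t⁻¹.1 • 1) := by
  rw [hElt_val]
  change fromBlocks (t.1 • 1) 0 0 (tilde (t⁻¹.1 • 1)) = _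
  rw [tilde_smul, tilde_one]

variable [NeZero (2 : k)] [Fintype k] [DecidableEq k]
  {ψ : AddChar k ℂ} {ω : Representation ℂ (Sp k n) (X k n → ℂ)}

/-- The element `u_s` acts by multiplication by `γ(s, ·)`: it is a commutator of a scalar `h_t`,
with `t² ≠ 1`, and of another `u_{s'}`. -/
lemma IsWeil.apply_u (hω : IsWeil ψ ω) (hψ : ψ ≠ 1) (hq : 3 < Fintype.card k) (s : A k n)
    (hs : tilde s = s) : ω (orthToSp (uElt s hs)) = gamOp ψ s := by
  obtain ⟨t, ht, ht2⟩ := exists_sq_ne_one hq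
  lift t to kˣ using ht.isUnit
  have hs' : tilde ((t.1 ^ 2 - 1)⁻¹ • s) = (t.1 ^ 2 - 1)⁻¹ • s := by rw [tilde_smul, hs]
  refine hω.eq_of_commutator hψ (intertwines_leviX ψ (scalarUnit n t)) (substOp_ne_zero _)
    (intertwines_gamOp ψ _ hs') (gamOp_ne_zero _ _) ?_ ?_
  · rw [← map_mul, ← map_mul, ← map_mul]
    congr 1
    apply Oq.ext_val
    simp only [Oq.val_mul, uElt_val, hElt_scalarUnit_val, fromBlocks_multiply]
    rw [fromBlocks_inj]
    refine ⟨by simp, ?_, by simp, by simp⟩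
    simp only [Matrix.one_mul, Matrix.mul_one, Matrix.mul_zero, add_zero, zero_add,
      Matrix.mul_smul, Matrix.smul_mul, smul_smul, ← add_smul]
    congr 1
    rw [Units.val_inv_eq_inv_val]
    field_simp
    ring
  · refine LinearMap.ext fun f => funext fun x => ?_
    have e : x * (t.1 • 1 : A k n) = t.1 • x := by rw [Matrix.mul_smul, Matrix.mul_one]
    change ψ (quad s x) * (ψ (quad _ x) * f (x * (t.1 • 1 : A k n))) =
      ψ (quad _ (x * (t.1 • 1 : A k n))) * f (x * (t.1 • 1 : A k n))
    rw [e, ← mul_assoc, ← AddChar.map_add_eq_mul, quad_smul_right, quad_smul_left]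
    congr 2
    field_simp
    ring

end Unipotent

/-! ### The action of `w` -/

section Fourier

variable {k : Type*} [Field k] {n : ℕ}

lemma form_inY_inX_symm (x y : X k n) : form (inY y) (inX x) = form (inY x) (inX y) := by
  rw [form_inY_inX, form_inY_inX, brk_swap (x 0) (y 1), brk_swap (x 1) (y 0)]
  ring

lemma form_inY_inX_eq_quad (x z : X k n) :
    -form (inY x) (inX z) = quad 1 (x + z) - quad 1 x - quad 1 z := by
  have h := quad_sub (tilde_one (k := k) (n := n)) x (-z)
  have e : quad 1 (-z) = quad 1 z := by
    have := quad_smul_right (-1) (1 : A k n) z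
    simpa using this
  rw [sub_neg_eq_add, e, Matrix.mul_one, inY_neg, form_neg_left, form_inY_inX_symm] at h
  rw [h]
  ring

variable [Fintype k]

/-- The Fourier transform on `X`. -/
noncomputable def fourierOp (ψ : AddChar k ℂ) : Module.End ℂ (X k n → ℂ) where
  toFun f x := ((Fintype.card k : ℂ) ^ (2 * n))⁻¹ *
    ∑ z : X k n, ψ (-form (inY x) (inX z)) * f z
  map_add' f f' := funext fun x => by
    simp only [Pi.add_apply, mul_add, Finset.sum_add_distrib]
  map_smul' c f := funext fun x => by
    simp only [Pi.smul_apply, smul_eq_mul, RingHom.id_apply, Finset.mul_sum]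
    exact Finset.sum_congr rfl fun z _ => by ring

lemma fourierOp_apply (ψ : AddChar k ℂ) (f : X k n → ℂ) (x : X k n) :
    fourierOp ψ f x = ((Fintype.card k : ℂ) ^ (2 * n))⁻¹ *
      ∑ z : X k n, ψ (-form (inY x) (inX z)) * f z := rfl

lemma intertwines_fourierOp [NeZero (2 : k)] (ψ : AddChar k ℂ) :
    Intertwines ψ (orthToSp (wElt : Oq k n)) (fourierOp ψ) := by
  intro h
  have h2 : (2 : k) ≠ 0 := NeZero.ne 2
  refine LinearMap.ext fun f => funext fun x => ?_
  set x₀ := h.vec.toCols₁ with hx₀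
  set y₀ := h.vec.toCols₂ with hy₀
  have hv : (spAct (orthToSp (wElt : Oq k n)) h).vec = inX y₀ + inY (-x₀) := by
    change h.vec * (wElt : Oq k n)⁻¹.1.1 = _
    rw [wElt_inv_val, eq_inX_add_inY h.vec, inX_add_inY_mul_fromBlocks]
    simp [hx₀, hy₀]
  have e1 : (spAct (orthToSp (wElt : Oq k n)) h).vec.toCols₁ = y₀ := by
    rw [hv, toCols₁_inX_add_inY]
  have e2 : (spAct (orthToSp (wElt : Oq k n)) h).vec.toCols₂ = -x₀ := by
    rw [hv, toCols₂_inX_add_inY]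
  have e3 : (spAct (orthToSp (wElt : Oq k n)) h).cen = h.cen := rfl
  rw [LinearMap.comp_apply, LinearMap.comp_apply, fourierOp_apply, schrodinger_apply,
    fourierOp_apply, e1, e2, e3, mul_left_comm]
  congr 1
  rw [Finset.mul_sum]
  symm
  refine Fintype.sum_equiv (Equiv.addRight x₀) _ _ fun z => ?_
  symm
  rw [Equiv.coe_addRight, schrodinger_apply, ← hx₀, ← hy₀, add_sub_cancel_right, ← mul_assoc,
    ← mul_assoc, ← AddChar.map_add_eq_mul, ← AddChar.map_add_eq_mul]
  congr 2
  rw [sub_eq_add_neg x y₀, inY_add]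
  simp only [inX_add, inY_neg, form_add_left, form_add_right, form_neg_left,
    form_inY_inX_symm x x₀,
    form_inY_inX_symm x₀ y₀]
  field_simp
  ring

/-- The Gauss sum of the quadratic form `x ↦ [x₀, x₁]`, which is hyperbolic. -/
lemma sum_addChar_quad [DecidableEq k] {ψ : AddChar k ℂ} (hψ : ψ ≠ 1) :
    ∑ x : X k n, ψ (-quad 1 x) = (Fintype.card k : ℂ) ^ (2 * n) := by
  classical
  have h1 : ∀ y : Idx n → k, ∑ x : Idx n → k, ψ (-brk x y) =
      if y = 0 then (Fintype.card k : ℂ) ^ (2 * n) else 0 := by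
    intro y
    let χ : AddChar (Idx n → k) ℂ := ψ.compAddMonoidHom
      (AddMonoidHom.mk' (fun x => -brk x y) fun x x' => by rw [brk_add_left]; ring)
    have h := AddChar.sum_eq_ite χ
    have e : χ = 0 ↔ y = 0 := by
      constructor
      · intro h
        refine brk_nondegenerate fun x => eq_zero_of_forall_addChar hψ fun t => ?_
        have := DFunLike.congr_fun h (-t • x)
        change ψ (-brk (-t • x) y) = 1 at this
        rwa [brk_smul_left, neg_mul, neg_neg] at this
      · rintro rfl
        refine AddChar.ext _ _ fun x => ?_
        change ψ (-brk x 0) = 1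
        rw [brk_zero_right, neg_zero, AddChar.map_zero_eq_one]
    simp only [e] at h
    rw [Fintype.card_fun, Fintype.card_sum, Fintype.card_fin, ← two_mul, Nat.cast_pow] at h
    exact h
  rw [← toX.sum_comp, Fintype.sum_prod_type, Finset.sum_comm]
  have h2 : ∀ x y : Idx n → k, quad 1 (toX (x, y)) = brk x y := fun x y => by
    rw [quad]
    change brk (x ᵥ* 1) y = _
    rw [vecMul_one]
  simp_rw [h2, h1]
  simp

variable [DecidableEq k] {ψ : AddChar k ℂ}

/-- The relation `w u₋₁ w = u₁ w u₁` holds for the Fourier transform and the multiplication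
operators. The normalisation of the Fourier transform matters here. -/
lemma fourierOp_gamOp (hψ : ψ ≠ 1) :
    fourierOp ψ * gamOp ψ (-1 : A k n) * fourierOp ψ =
      gamOp ψ 1 * fourierOp ψ * gamOp ψ 1 := by
  have hq : ((Fintype.card k : ℂ) ^ (2 * n)) ≠ 0 :=
    pow_ne_zero _ (Nat.cast_ne_zero.mpr Fintype.card_ne_zero)
  have e1 : ∀ z : X k n, quad (-1) z = -quad 1 z := fun z => by
    simpa using quad_smul_left (-1) (1 : A k n) z
  refine LinearMap.ext fun f => funext fun x => ?_
  simp only [Module.End.mul_apply]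
  rw [fourierOp_apply, gamOp_apply, fourierOp_apply, mul_left_comm]
  congr 1
  simp only [gamOp_apply, fourierOp_apply, e1]
  have h1 : ∀ y z : X k n, ψ (-form (inY x) (inX z)) * (ψ (-quad 1 z) *
      (ψ (-form (inY z) (inX y)) * f y)) =
        ψ (quad 1 (x + y)) * f y * ψ (-quad 1 (x + y - z)) := by
    intro y z
    rw [mul_right_comm, ← mul_assoc, ← mul_assoc, ← AddChar.map_add_eq_mul,
      ← AddChar.map_add_eq_mul, ← AddChar.map_add_eq_mul]
    congr 2
    have h2 := quad_sub (tilde_one (k := k) (n := n)) (x + y) z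
    rw [Matrix.mul_one, inX_add, form_add_right, form_inY_inX_symm x z] at h2
    rw [h2]
    ring
  calc ∑ z : X k n, ψ (-form (inY x) (inX z)) * (ψ (-quad 1 z) *
        (((Fintype.card k : ℂ) ^ (2 * n))⁻¹ * ∑ y : X k n, ψ (-form (inY z) (inX y)) * f y))
      = ((Fintype.card k : ℂ) ^ (2 * n))⁻¹ * ∑ y : X k n, ∑ z : X k n,
          ψ (quad 1 (x + y)) * f y * ψ (-quad 1 (x + y - z)) := by
        rw [Finset.sum_comm, Finset.mul_sum]
        refine Finset.sum_congr rfl fun z _ => ?_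
        rw [mul_left_comm (ψ (-quad 1 z)), mul_left_comm, Finset.mul_sum, Finset.mul_sum]
        congr 1
        exact Finset.sum_congr rfl fun y _ => h1 y z
    _ = ∑ y : X k n, ψ (quad 1 (x + y)) * f y := by
        rw [Finset.mul_sum]
        refine Finset.sum_congr rfl fun y _ => ?_
        have h3 : ∑ z : X k n, ψ (-quad 1 (x + y - z)) = ∑ z : X k n, ψ (-quad 1 z) :=
          (Equiv.subLeft (x + y)).sum_comp (fun z => ψ (-quad 1 z))
        rw [← Finset.mul_sum, h3, sum_addChar_quad hψ, mul_left_comm, inv_mul_cancel₀ hq, mul_one]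
    _ = _ := by
        rw [Finset.mul_sum]
        refine Finset.sum_congr rfl fun y _ => ?_
        rw [← mul_assoc, ← mul_assoc, ← AddChar.map_add_eq_mul, ← AddChar.map_add_eq_mul,
          form_inY_inX_eq_quad]
        congr 2
        ring

/-- The element `w` acts by the Fourier transform: the scalar between the two operators is equal to
its square, by the relation `w u₋₁ w = u₁ w u₁`. -/
lemma IsWeil.apply_w [NeZero (2 : k)] {ω : Representation ℂ (Sp k n) (X k n → ℂ)}
    (hω : IsWeil ψ ω) (hψ : ψ ≠ 1) (hq : 3 < Fintype.card k) :
    ω (orthToSp wElt) = fourierOp ψ := by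
  have hF0 : fourierOp ψ ≠ (0 : Module.End ℂ (X k n → ℂ)) := by
    intro h0
    have h := congrFun (LinearMap.congr_fun h0 fun x => ψ (-quad 1 x)) 0
    have hq' : ((Fintype.card k : ℂ) ^ (2 * n)) ≠ 0 :=
      pow_ne_zero _ (Nat.cast_ne_zero.mpr Fintype.card_ne_zero)
    rw [fourierOp_apply] at h
    simp [inY_zero, form_zero_left, sum_addChar_quad hψ, hq'] at h
  obtain ⟨c, hc, h⟩ := hω.exists_smul hψ (intertwines_fourierOp ψ) hF0
  have h1 := fourierOp_gamOp (n := n) hψ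
  have hs : tilde (-1 : A k n) = -1 := by rw [tilde_neg, tilde_one]
  rw [← hω.apply_u hψ hq 1 tilde_one, ← hω.apply_u hψ hq (-1) hs, h] at h1
  have h2 : (wElt * uElt (-1) hs * wElt : Oq k n) = uElt 1 tilde_one * wElt * uElt 1 tilde_one := by
    apply Oq.ext_val
    simp only [Oq.val_mul, uElt_val, wElt_val, fromBlocks_multiply]
    simp
  simp only [smul_mul_assoc, mul_smul_comm, smul_smul, ← map_mul] at h1
  rw [h2] at h1
  have h3 : c * c = c := smul_left_injective ℂ (isUnit_rep ω _).ne_zero h1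
  have h4 : c = 1 := mul_left_cancel₀ hc (by rw [h3, mul_one])
  rw [h, h4, one_smul]

end Fourier

/-! ### The restriction to the orthogonal group -/

section Restriction

variable {k : Type*} [Field k] {n : ℕ}

lemma resO_apply (ω : Representation ℂ (Sp k n) (X k n → ℂ)) (g : Oq k n) (f : M k n → ℂ)
    (m : M k n) : resO ω g f m = ω (orthToSp g) (f ∘ toX.symm) (toX m) := rfl

lemma resSL_apply (ω : Representation ℂ (Sp k n) (X k n → ℂ))
    (g : SpecialLinearGroup (Fin 2) k) (f : M k n → ℂ) (m : M k n) :
    resSL ω g f m = ω (slToSp g) (f ∘ toX.symm) (toX m) := rfl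

variable [NeZero (2 : k)] [Fintype k] [DecidableEq k]
  {ψ : AddChar k ℂ} {ω : Representation ℂ (Sp k n) (X k n → ℂ)}

theorem IsWeil.isGeneralizedWeil (hω : IsWeil ψ ω) (hψ : ψ ≠ 1) (hq : 3 < Fintype.card k) :
    IsGeneralizedWeil ψ (resO ω) where
  apply_h a f m := by
    rw [resO_apply, hω.apply_h hψ hq]
    rfl
  apply_u s hs f m := by
    rw [resO_apply, hω.apply_u hψ hq]
    rfl
  apply_w f m := by
    rw [resO_apply, hω.apply_w hψ hq, fourierOp_apply, ← toX.sum_comp]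
    congr 1
    refine Finset.sum_congr rfl fun m' _ => ?_
    rw [form_inY_inX, Function.comp_apply, Equiv.symm_apply_apply, neg_sub]
    rfl

end Restriction

/-! ### Generators of the special orthogonal group of a hyperbolic space -/

section Generation

variable {K ι : Type*} [Field K] [Fintype ι] [DecidableEq ι]

variable (K ι) in
/-- The hyperbolic matrix `(0, 1; 1, 0)`. -/
def hyp : Matrix (ι ⊕ ι) (ι ⊕ ι) K := fromBlocks 0 1 1 0

lemma hyp_mul_hyp : hyp K ι * hyp K ι = 1 := by
  simp [hyp, fromBlocks_multiply, fromBlocks_one]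

/-- The relations between the blocks of an element of the orthogonal group of `hyp`. -/
lemma hyp_relations {a b c d : Matrix ι ι K}
    (h : fromBlocks a b c d * hyp K ι * (fromBlocks a b c d)ᵀ = hyp K ι) :
    c * dᵀ + d * cᵀ = 0 ∧ c * bᵀ + d * aᵀ = 1 ∧ bᵀ * d + dᵀ * b = 0 ∧ dᵀ * a + bᵀ * c = 1 := by
  have h' : (fromBlocks a b c d)ᵀ * hyp K ι * fromBlocks a b c d = hyp K ι := by
    have h1 : fromBlocks a b c d * (hyp K ι * (fromBlocks a b c d)ᵀ * hyp K ι) = 1 := by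
      rw [← Matrix.mul_assoc, ← Matrix.mul_assoc, h, hyp_mul_hyp]
    have h2 := mul_eq_one_comm.mp h1
    calc (fromBlocks a b c d)ᵀ * hyp K ι * fromBlocks a b c d
        = hyp K ι * (hyp K ι * (fromBlocks a b c d)ᵀ * hyp K ι * fromBlocks a b c d) := by
          simp only [← Matrix.mul_assoc, hyp_mul_hyp, Matrix.one_mul]
      _ = hyp K ι := by rw [h2, Matrix.mul_one]
  simp only [hyp, fromBlocks_transpose, fromBlocks_multiply, fromBlocks_inj] at h h'
  simp only [Matrix.mul_zero, Matrix.mul_one, zero_add, add_zero] at h h'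
  exact ⟨by rw [add_comm]; exact h.2.2.2, by rw [add_comm]; exact h.2.2.1,
    by rw [add_comm]; exact h'.2.2.2, h'.2.2.1⟩

/-- The diagonal idempotent with support `S`. -/
def idem (K : Type*) [Field K] (S : Finset ι) : Matrix ι ι K :=
  diagonal fun i => if i ∈ S then 1 else 0

lemma idem_mul_idem (S : Finset ι) : idem K S * idem K S = idem K S := by
  simp [idem, diagonal_mul_diagonal]

lemma idem_mul_one_sub (S : Finset ι) : idem K S * (1 - idem K S) = 0 := by
  rw [Matrix.mul_sub, idem_mul_idem, Matrix.mul_one, sub_self]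

lemma one_sub_mul_idem (S : Finset ι) : (1 - idem K S) * idem K S = 0 := by
  rw [Matrix.sub_mul, idem_mul_idem, Matrix.one_mul, sub_self]

lemma one_sub_mul_one_sub (S : Finset ι) :
    (1 - idem K S) * (1 - idem K S) = 1 - idem K S := by
  rw [Matrix.mul_sub, Matrix.mul_one, one_sub_mul_idem, sub_zero]

/-- The isometry of the hyperbolic space that exchanges the two vectors of the `i`-th hyperbolic
pair, for `i ∈ S`. -/
def swap (K : Type*) [Field K] (S : Finset ι) : Matrix (ι ⊕ ι) (ι ⊕ ι) K :=
  fromBlocks (1 - idem K S) (idem K S) (idem K S) (1 - idem K S)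

lemma swap_mul_swap (S : Finset ι) : swap K S * swap K S = 1 := by
  rw [swap, fromBlocks_multiply]
  simp only [idem_mul_idem, idem_mul_one_sub, one_sub_mul_idem, one_sub_mul_one_sub,
    sub_add_cancel, add_zero, add_sub_cancel, fromBlocks_one]

lemma swap_mul_swap_of_disjoint {S S' : Finset ι} (h : Disjoint S S') :
    swap K S * swap K S' = swap K (S ∪ S') := by
  have h1 : idem K S * idem K S' = 0 := by
    rw [idem, idem, diagonal_mul_diagonal, ← diagonal_zero]
    congr 1
    funext i
    have : i ∈ S → i ∉ S' := fun hi => Finset.disjoint_left.mp h hi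
    by_cases hi : i ∈ S <;> simp [hi, this]
  have h2 : idem K (S ∪ S') = idem K S + idem K S' := by
    rw [idem, idem, idem, diagonal_add]
    congr 1
    funext i
    have : i ∈ S → i ∉ S' := fun hi => Finset.disjoint_left.mp h hi
    by_cases hi : i ∈ S <;> simp [hi, this]
  rw [swap, swap, swap, fromBlocks_multiply, h2]
  simp only [Matrix.sub_mul, Matrix.mul_sub, Matrix.one_mul, Matrix.mul_one, h1]
  congr 1 <;> abel

lemma swap_isometry (S : Finset ι) : swap K S * hyp K ι * (swap K S)ᵀ = hyp K ι := by
  have h1 : (idem K S)ᵀ = idem K S := diagonal_transpose _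
  rw [swap, hyp, fromBlocks_multiply, fromBlocks_transpose, fromBlocks_multiply]
  simp only [transpose_sub, transpose_one, h1, Matrix.mul_zero, Matrix.mul_one, zero_add,
    add_zero, idem_mul_idem, idem_mul_one_sub, one_sub_mul_idem, one_sub_mul_one_sub,
    add_sub_cancel, sub_add_cancel]

lemma det_swap (S : Finset ι) : (swap K S).det = (-1) ^ S.card := by
  have h1 : fromBlocks 1 0 1 1 * swap K S * fromBlocks 1 0 (-1) 1 =
      fromBlocks (1 - idem K S - idem K S) (idem K S) 0 1 := by
    rw [swap, fromBlocks_multiply, fromBlocks_multiply]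
    simp [sub_eq_add_neg]
  have h2 : 1 - idem K S - idem K S = diagonal fun i => if i ∈ S then -1 else 1 := by
    rw [idem, ← diagonal_one, diagonal_sub, diagonal_sub]
    congr 1
    funext i
    by_cases hi : i ∈ S <;> simp [hi]
  have h3 := congrArg det h1
  rw [det_mul, det_mul, det_fromBlocks_zero₁₂, det_fromBlocks_zero₁₂, det_fromBlocks_zero₂₁, h2,
    det_diagonal] at h3
  simpa [Finset.prod_ite] using h3

/-- A monoid of matrices that contains the Siegel parabolic subgroup of the orthogonal group of
`hyp` and the element `hyp` contains the swaps of an even number of hyperbolic pairs. -/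
lemma swap_mem {N : Submonoid (Matrix (ι ⊕ ι) (ι ⊕ ι) K)}
    (hL : ∀ a b : Matrix ι ι K, a * b = 1 → fromBlocks a 0 0 bᵀ ∈ N)
    (hU : ∀ s : Matrix ι ι K, sᵀ = -s → fromBlocks 1 s 0 1 ∈ N)
    (hV : ∀ s : Matrix ι ι K, sᵀ = -s → fromBlocks 1 0 s 1 ∈ N) {S : Finset ι} (hS : Even S.card) :
    swap K S ∈ N := by
  have key : ∀ i j : ι, i ≠ j → swap K {i, j} ∈ N := by
    intro i j hij
    set s : Matrix ι ι K := single i j 1 - single j i 1 with hs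
    set e := idem K {i, j} with he
    have hsT : sᵀ = -s := by
      rw [hs, transpose_sub, transpose_single, transpose_single, neg_sub]
    have he' : e = single i i 1 + single j j 1 := by
      ext x y
      simp only [he, idem, diagonal_apply, Matrix.add_apply, single_apply, Finset.mem_insert,
        Finset.mem_singleton]
      grind
    have hss : s * s = -e := by
      rw [hs, he']
      simp [Matrix.sub_mul, Matrix.mul_sub, single_mul_single_of_ne, hij, hij.symm]
      rw [sub_eq_add_neg]
    have hes : e * s = s := by
      rw [hs, he']
      simp [Matrix.add_mul, Matrix.mul_sub, single_mul_single_of_ne, hij, hij.symm]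
    have hse : s * e = s := by
      rw [hs, he']
      simp [Matrix.sub_mul, Matrix.mul_add, single_mul_single_of_ne, hij, hij.symm]
      rw [neg_add_eq_sub]
    have hee : e * e = e := idem_mul_idem _
    have heT : eᵀ = e := diagonal_transpose _
    have h1 : (1 - e - s) * (1 - e + s) = 1 := by
      simp only [Matrix.sub_mul, Matrix.mul_add, Matrix.mul_sub, Matrix.one_mul, Matrix.mul_one,
        hee, hes, hse, hss]
      abel
    have h2 : swap K {i, j} = fromBlocks 1 s 0 1 * fromBlocks 1 0 s 1 * fromBlocks 1 s 0 1 *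
        fromBlocks (1 - e - s) 0 0 (1 - e + s)ᵀ := by
      rw [swap, ← he]
      simp only [fromBlocks_multiply, Matrix.mul_add, Matrix.mul_sub,
        Matrix.one_mul, Matrix.mul_one, Matrix.zero_mul, Matrix.mul_zero, hee, hes, hse, hss,
        transpose_add, transpose_sub, transpose_one, hsT, heT, Matrix.add_mul, Matrix.neg_mul,
        Matrix.mul_neg]
      congr 1 <;> abel
    rw [h2]
    exact mul_mem (mul_mem (mul_mem (hU s hsT) (hV s hsT)) (hU s hsT)) (hL _ _ h1)
  induction hm : S.card using Nat.strong_induction_on generalizing S with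
  | _ m ih =>
    rcases Nat.eq_zero_or_pos m with h0 | h0
    · have : S = ∅ := Finset.card_eq_zero.mp (hm.trans h0)
      have h1 : swap K S = 1 := by
        simp [this, swap, idem, fromBlocks_one]
      rw [h1]
      exact one_mem N
    · have h1 : 1 < S.card := by
        rcases hS with ⟨r, hr⟩; omega
      obtain ⟨i, hi, j, hj, hij⟩ := Finset.one_lt_card.mp h1
      have hsub : ({i, j} : Finset ι) ⊆ S := by
        intro x hx
        rcases Finset.mem_insert.mp hx with rfl | hx
        · exact hi
        · rwa [Finset.mem_singleton.mp hx]
      have hc : (S \ {i, j}).card = m - 2 := by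
        rw [Finset.card_sdiff_of_subset hsub, Finset.card_pair hij, hm]
      have h2 : swap K S = swap K {i, j} * swap K (S \ {i, j}) := by
        rw [swap_mul_swap_of_disjoint Finset.disjoint_sdiff, Finset.union_sdiff_of_subset hsub]
      rw [h2]
      refine mul_mem (key i j hij) (ih (m - 2) (by omega) ?_ hc)
      rw [hc, ← hm]
      exact (Nat.even_sub (by omega)).mpr (by simp [hS])

/-- The isometries whose lower right block is invertible belong to the big cell. -/
lemma mem_of_isUnit {N : Submonoid (Matrix (ι ⊕ ι) (ι ⊕ ι) K)}
    (hL : ∀ a b : Matrix ι ι K, a * b = 1 → fromBlocks a 0 0 bᵀ ∈ N)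
    (hU : ∀ s : Matrix ι ι K, sᵀ = -s → fromBlocks 1 s 0 1 ∈ N)
    (hV : ∀ s : Matrix ι ι K, sᵀ = -s → fromBlocks 1 0 s 1 ∈ N) {a b c d d' : Matrix ι ι K}
    (h : fromBlocks a b c d * hyp K ι * (fromBlocks a b c d)ᵀ = hyp K ι) (hd : d * d' = 1) :
    fromBlocks a b c d ∈ N := by
  obtain ⟨h1, h2, h3, h4⟩ := hyp_relations h
  have hd' : d' * d = 1 := mul_eq_one_comm.mp hd
  have hdT : dᵀ * d'ᵀ = 1 := by rw [← transpose_mul, hd', transpose_one]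
  have hdT' : d'ᵀ * dᵀ = 1 := by rw [← transpose_mul, hd, transpose_one]
  have e1 : (b * d')ᵀ = -(b * d') := by
    have h5 : d'ᵀ * (bᵀ * d + dᵀ * b) * d' = d'ᵀ * bᵀ * (d * d') + d'ᵀ * dᵀ * (b * d') := by
      simp only [Matrix.mul_add, Matrix.add_mul, Matrix.mul_assoc]
    rw [h3, hd, hdT', Matrix.mul_zero, Matrix.zero_mul, Matrix.mul_one, Matrix.one_mul] at h5
    rw [transpose_mul]
    exact eq_neg_of_add_eq_zero_left h5.symm
  have e2 : (d' * c)ᵀ = -(d' * c) := by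
    have h5 : d' * (c * dᵀ + d * cᵀ) * d'ᵀ = d' * c * (dᵀ * d'ᵀ) + d' * d * (cᵀ * d'ᵀ) := by
      simp only [Matrix.mul_add, Matrix.add_mul, Matrix.mul_assoc]
    rw [h1, hdT, hd', Matrix.mul_zero, Matrix.zero_mul, Matrix.mul_one, Matrix.one_mul] at h5
    rw [transpose_mul]
    exact eq_neg_of_add_eq_zero_right h5.symm
  have e3 : d'ᵀ + b * d' * c = a := by
    have h5 : d'ᵀ * (dᵀ * a + bᵀ * c) = d'ᵀ * dᵀ * a + (b * d')ᵀ * c := by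
      rw [transpose_mul]
      simp only [Matrix.mul_add, Matrix.mul_assoc]
    rw [h4, hdT', e1, Matrix.mul_one, Matrix.one_mul] at h5
    rw [h5, Matrix.neg_mul]
    abel
  have h6 : fromBlocks a b c d = fromBlocks 1 (b * d') 0 1 * fromBlocks d'ᵀ 0 0 dᵀᵀ *
      fromBlocks 1 0 (d' * c) 1 := by
    simp only [fromBlocks_multiply, Matrix.one_mul, Matrix.mul_one, Matrix.zero_mul,
      Matrix.mul_zero, add_zero, zero_add, transpose_transpose]
    have h7 : b * d' * d = b := by rw [Matrix.mul_assoc, hd', Matrix.mul_one]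
    have h8 : d * (d' * c) = c := by rw [← Matrix.mul_assoc, hd, Matrix.one_mul]
    rw [h7, h8, ← Matrix.mul_assoc, e3]
  rw [h6]
  exact mul_mem (mul_mem (hU _ e1) (hL _ _ hdT')) (hV _ e2)

/-- The orthogonal group of `hyp` is the union of the double cosets of the swaps: if `d` is
diagonal, swapping the hyperbolic pairs given by the zeros of `d` makes this block invertible. -/
lemma exists_swap_mem {N : Submonoid (Matrix (ι ⊕ ι) (ι ⊕ ι) K)}
    (hL : ∀ a b : Matrix ι ι K, a * b = 1 → fromBlocks a 0 0 bᵀ ∈ N)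
    (hU : ∀ s : Matrix ι ι K, sᵀ = -s → fromBlocks 1 s 0 1 ∈ N)
    (hV : ∀ s : Matrix ι ι K, sᵀ = -s → fromBlocks 1 0 s 1 ∈ N) {a b c : Matrix ι ι K} {D : ι → K}
    (h : fromBlocks a b c (diagonal D) * hyp K ι * (fromBlocks a b c (diagonal D))ᵀ = hyp K ι) :
    ∃ S : Finset ι, fromBlocks a b c (diagonal D) * swap K S ∈ N := by
  classical
  set S : Finset ι := {i | D i = 0} with hS
  refine ⟨S, ?_⟩
  obtain ⟨h1, h2, -, -⟩ := hyp_relations h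
  set d := diagonal D with hd
  set e := idem K S with he
  set d' : Matrix ι ι K := diagonal fun i => (D i)⁻¹ with hd'
  have hee : e * e = e := idem_mul_idem _
  have hed : e * d = 0 := by
    rw [he, hd, idem, diagonal_mul_diagonal, ← diagonal_zero]
    congr 1; funext i
    by_cases hi : D i = 0 <;> simp [hS, hi]
  have hde : d * e = 0 := by
    rw [he, hd, idem, diagonal_mul_diagonal, ← diagonal_zero]
    congr 1; funext i
    by_cases hi : D i = 0 <;> simp [hS, hi]
  have hed' : e * d' = 0 := by
    rw [he, hd', idem, diagonal_mul_diagonal, ← diagonal_zero]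
    congr 1; funext i
    by_cases hi : D i = 0 <;> simp [hS, hi]
  have hdd : d * d' = 1 - e := by
    rw [he, hd, hd', idem, diagonal_mul_diagonal, ← diagonal_one, diagonal_sub]
    congr 1; funext i
    by_cases hi : D i = 0 <;> simp [hS, hi]
  have hec : e * c * (1 - e) = 0 := by
    have h5 : e * (c * dᵀ + d * cᵀ) * d' = e * c * (dᵀ * d') + e * d * (cᵀ * d') := by
      simp only [Matrix.mul_add, Matrix.add_mul, Matrix.mul_assoc]
    have h6 : dᵀ = d := diagonal_transpose _
    rw [h1, hed, h6, hdd, Matrix.mul_zero, Matrix.zero_mul, Matrix.zero_mul, add_zero] at h5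
    exact h5.symm
  have hece : e * (c * e * bᵀ) = e := by
    have h5 : e * (c * bᵀ + d * aᵀ) = e * c * (e + (1 - e)) * bᵀ + e * d * aᵀ := by
      rw [add_sub_cancel, Matrix.mul_one]
      simp only [Matrix.mul_add, Matrix.mul_assoc]
    rw [h2, hed, Matrix.mul_one, Matrix.mul_add, hec, add_zero, Matrix.zero_mul, add_zero] at h5
    rw [← Matrix.mul_assoc, ← Matrix.mul_assoc]
    exact h5.symm
  have h3 : fromBlocks a b c d * swap K S = fromBlocks (a * (1 - e) + b * e)
      (a * e + b * (1 - e)) (c * (1 - e) + d * e) (c * e + d * (1 - e)) := by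
    rw [swap, fromBlocks_multiply]
  have h4 : (c * e + d * (1 - e)) * (e * bᵀ + d' * (1 - c * e * bᵀ)) = 1 := by
    have h5 : (c * e + d * (1 - e)) * (e * bᵀ + d' * (1 - c * e * bᵀ)) =
        c * (e * e) * bᵀ + (d * e - d * e * e) * bᵀ + c * (e * d') * (1 - c * e * bᵀ) +
          (d * d' - d * (e * d')) * (1 - c * e * bᵀ) := by
      noncomm_ring
    rw [h5, hee, hde, hed', hdd]
    simp only [Matrix.mul_zero, Matrix.zero_mul, sub_zero, add_zero]
    rw [Matrix.sub_mul, Matrix.mul_sub e, hece, Matrix.mul_one]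
    noncomm_ring
  rw [h3]
  refine mem_of_isUnit hL hU hV ?_ h4
  rw [← h3, transpose_mul]
  calc fromBlocks a b c d * swap K S * hyp K ι * ((swap K S)ᵀ * (fromBlocks a b c d)ᵀ)
      = fromBlocks a b c d * (swap K S * hyp K ι * (swap K S)ᵀ) * (fromBlocks a b c d)ᵀ := by
        simp only [Matrix.mul_assoc]
    _ = hyp K ι := by rw [swap_isometry, h]

/-- A monoid that contains the Siegel parabolic subgroup and its opposite contains every isometry
up to a swap. -/
lemma exists_mul_swap_mem {N : Submonoid (Matrix (ι ⊕ ι) (ι ⊕ ι) K)}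
    (hL : ∀ a b : Matrix ι ι K, a * b = 1 → fromBlocks a 0 0 bᵀ ∈ N)
    (hU : ∀ s : Matrix ι ι K, sᵀ = -s → fromBlocks 1 s 0 1 ∈ N)
    (hV : ∀ s : Matrix ι ι K, sᵀ = -s → fromBlocks 1 0 s 1 ∈ N) {g : Matrix (ι ⊕ ι) (ι ⊕ ι) K}
    (h : g * hyp K ι * gᵀ = hyp K ι) :
    ∃ (S : Finset ι) (l l' : Matrix (ι ⊕ ι) (ι ⊕ ι) K), l * l' = 1 ∧ l' ∈ N ∧
      g * l * swap K S ∈ N := by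
  have levi : ∀ p : Matrix ι ι K, p.det = 1 → ∃ r r' : Matrix ι ι K,
      (fromBlocks r 0 0 p * fromBlocks r' 0 0 p⁻¹ = 1 ∧
        fromBlocks r' 0 0 p⁻¹ * fromBlocks r 0 0 p = 1) ∧
      fromBlocks r 0 0 p ∈ N ∧ fromBlocks r' 0 0 p⁻¹ ∈ N ∧
      fromBlocks r 0 0 p * hyp K ι * (fromBlocks r 0 0 p)ᵀ = hyp K ι := by
    intro p hp
    have hu : IsUnit p.det := by rw [hp]; exact isUnit_one
    have h1 := mul_nonsing_inv p hu
    have h2 := nonsing_inv_mul p hu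
    have h3 : pᵀ * p⁻¹ᵀ = 1 := by rw [← transpose_mul, h2, transpose_one]
    have h4 : p⁻¹ᵀ * pᵀ = 1 := by rw [← transpose_mul, h1, transpose_one]
    refine ⟨p⁻¹ᵀ, pᵀ, ⟨?_, ?_⟩, ?_, ?_, ?_⟩
    · simp [fromBlocks_multiply, h1, h4, fromBlocks_one]
    · simp [fromBlocks_multiply, h2, h3, fromBlocks_one]
    · simpa using hL _ _ h4
    · exact hL _ _ h3
    · simp [hyp, fromBlocks_multiply, fromBlocks_transpose, h1, h4]
  obtain ⟨L, L', D, hD⟩ := Pivot.exists_list_transvec_mul_mul_list_transvec_eq_diagonal g.toBlocks₂₂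
  obtain ⟨r, r', ⟨-, hr⟩, -, hr', hri⟩ :=
    levi (L.map TransvectionStruct.toMatrix).prod (TransvectionStruct.det_toMatrix_prod L)
  obtain ⟨t, t', ⟨ht, -⟩, -, ht', hti⟩ :=
    levi (L'.map TransvectionStruct.toMatrix).prod (TransvectionStruct.det_toMatrix_prod L')
  generalize (L.map TransvectionStruct.toMatrix).prod = p at *
  generalize (L'.map TransvectionStruct.toMatrix).prod = q at *
  have hb : fromBlocks r 0 0 p * g * fromBlocks t 0 0 q = fromBlocks (r * g.toBlocks₁₁ * t)
      (r * g.toBlocks₁₂ * q) (p * g.toBlocks₂₁ * t) (diagonal D) := by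
    conv_lhs => rw [← fromBlocks_toBlocks g]
    simp [fromBlocks_multiply, hD]
  obtain ⟨S, hS⟩ := exists_swap_mem hL hU hV (a := r * g.toBlocks₁₁ * t)
    (b := r * g.toBlocks₁₂ * q) (c := p * g.toBlocks₂₁ * t) (D := D) (by
      rw [← hb, transpose_mul, transpose_mul]
      calc fromBlocks r 0 0 p * g * fromBlocks t 0 0 q * hyp K ι *
            ((fromBlocks t 0 0 q)ᵀ * (gᵀ * (fromBlocks r 0 0 p)ᵀ))
          = fromBlocks r 0 0 p * (g * (fromBlocks t 0 0 q * hyp K ι * (fromBlocks t 0 0 q)ᵀ) * gᵀ) *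
              (fromBlocks r 0 0 p)ᵀ := by simp only [Matrix.mul_assoc]
        _ = hyp K ι := by rw [hti, h, hri])
  refine ⟨S, fromBlocks t 0 0 q, fromBlocks t' 0 0 q⁻¹, ht, ht', ?_⟩
  have h5 : g * fromBlocks t 0 0 q * swap K S =
      fromBlocks r' 0 0 p⁻¹ * (fromBlocks r 0 0 p * g * fromBlocks t 0 0 q * swap K S) := by
    simp only [← Matrix.mul_assoc, hr, Matrix.one_mul]
  rw [h5, hb]
  exact mul_mem hr' hS

/-- The special orthogonal group of `hyp` is generated by the Siegel parabolic subgroup and its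
opposite: the parity of the number of swapped pairs is the determinant. -/
lemma mem_of_det_eq_one (h2 : (2 : K) ≠ 0) {N : Submonoid (Matrix (ι ⊕ ι) (ι ⊕ ι) K)}
    (hL : ∀ a b : Matrix ι ι K, a * b = 1 → fromBlocks a 0 0 bᵀ ∈ N)
    (hU : ∀ s : Matrix ι ι K, sᵀ = -s → fromBlocks 1 s 0 1 ∈ N)
    (hV : ∀ s : Matrix ι ι K, sᵀ = -s → fromBlocks 1 0 s 1 ∈ N) {g : Matrix (ι ⊕ ι) (ι ⊕ ι) K}
    (h : g * hyp K ι * gᵀ = hyp K ι) (hg : g.det = 1) : g ∈ N := by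
  obtain ⟨S, l, l', hl, ⟨hl', hl1⟩, hS, hS1⟩ := exists_mul_swap_mem
    (N := N ⊓ MonoidHom.mker (detMonoidHom (n := ι ⊕ ι) (R := K)))
    (fun a b hab => ⟨hL a b hab, by
      rw [SetLike.mem_coe, MonoidHom.mem_mker, coe_detMonoidHom, det_fromBlocks_zero₁₂,
        det_transpose, ← det_mul, hab, det_one]⟩)
    (fun s hs => ⟨hU s hs, by
      rw [SetLike.mem_coe, MonoidHom.mem_mker, coe_detMonoidHom, det_fromBlocks_zero₂₁]
      simp⟩)
    (fun s hs => ⟨hV s hs, by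
      rw [SetLike.mem_coe, MonoidHom.mem_mker, coe_detMonoidHom, det_fromBlocks_zero₁₂]
      simp⟩) h
  rw [SetLike.mem_coe, MonoidHom.mem_mker, coe_detMonoidHom] at hS1 hl1
  have hl2 := congrArg det hl
  rw [det_mul, hl1, mul_one, det_one] at hl2
  rw [det_mul, det_mul, hg, hl2, det_swap, one_mul, one_mul] at hS1
  have heven : Even S.card := by
    by_contra hodd
    rw [(Nat.not_even_iff_odd.mp hodd).neg_one_pow] at hS1
    exact h2 (by linear_combination -hS1)
  have e : g = g * l * swap K S * swap K S * l' := by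
    rw [Matrix.mul_assoc (g * l), swap_mul_swap, Matrix.mul_one, Matrix.mul_assoc, hl,
      Matrix.mul_one]
  rw [e]
  exact mul_mem (mul_mem hS (swap_mem hL hU hV heven)) hl'

end Generation

/-! ### Uniqueness on the special orthogonal group -/

section Uniqueness

variable {k : Type*} [Field k] {n : ℕ}

/-- The elements `h_a`, `u_s` and `w` generate the special orthogonal group. -/
lemma mem_of_generators (h2 : (2 : k) ≠ 0) {E : Submonoid (Oq k n)} (hE : ∀ a, hElt a ∈ E)
    (uE : ∀ s hs, uElt s hs ∈ E) (wE : wElt ∈ E) {g : Oq k n} (hg : g.1.1.det = 1) : g ∈ E := by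
  set T : Matrix (Idx n ⊕ Idx n) (Idx n ⊕ Idx n) k := fromBlocks (J k n) 0 0 1 with hT
  set T' : Matrix (Idx n ⊕ Idx n) (Idx n ⊕ Idx n) k := fromBlocks (-J k n) 0 0 1 with hT'
  have hTT : T * T' = 1 := by simp [hT, hT', fromBlocks_multiply, J_mul_J, fromBlocks_one]
  have hTT' : T' * T = 1 := mul_eq_one_comm.mp hTT
  have hF : F k n = T * hyp k (Idx n) * Tᵀ := F_split
  have hTt : Tᵀ * T'ᵀ = 1 := by rw [← transpose_mul, hTT', transpose_one]
  let N : Submonoid (Matrix (Idx n ⊕ Idx n) (Idx n ⊕ Idx n) k) :=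
    { carrier := {m | ∃ g ∈ E, g.1.1 * T = T * m}
      one_mem' := ⟨1, one_mem E, by simp⟩
      mul_mem' := by
        rintro a b ⟨x, hx, hxa⟩ ⟨y, hy, hyb⟩
        refine ⟨x * y, mul_mem hx hy, ?_⟩
        rw [Oq.val_mul, Matrix.mul_assoc, hyb, ← Matrix.mul_assoc, hxa, Matrix.mul_assoc] }
  have hL : ∀ a b : A k n, a * b = 1 → fromBlocks a 0 0 bᵀ ∈ N := by
    intro a b hab
    have hba : b * a = 1 := mul_eq_one_comm.mp hab
    have h1 : J k n * a * -J k n * (J k n * b * -J k n) = 1 := by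
      have : J k n * a * -J k n * (J k n * b * -J k n) =
          J k n * (a * -(J k n * J k n) * b) * -J k n := by noncomm_ring
      rw [this, J_mul_J, neg_neg, Matrix.mul_one, hab, Matrix.mul_one, mul_neg, J_mul_J, neg_neg]
    refine ⟨hElt ⟨J k n * a * -J k n, J k n * b * -J k n, h1, mul_eq_one_comm.mp h1⟩, hE _, ?_⟩
    have h3 : tilde (J k n * b * -J k n) = bᵀ := by
      rw [tilde_eq]
      simp only [transpose_mul, transpose_neg, J_transpose, neg_neg]
      have : J k n * (J k n * (bᵀ * -J k n)) * J k n =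
          (J k n * J k n) * bᵀ * -(J k n * J k n) := by noncomm_ring
      rw [this, J_mul_J]
      simp
    rw [hElt_val, hT, fromBlocks_multiply, fromBlocks_multiply]
    simp only [Units.inv_mk, h3, Matrix.mul_zero, Matrix.zero_mul, add_zero, zero_add,
      Matrix.mul_one, Matrix.one_mul]
    rw [Matrix.mul_assoc (J k n * a), neg_mul, J_mul_J, neg_neg, Matrix.mul_one]
  have hU : ∀ s : A k n, sᵀ = -s → fromBlocks 1 s 0 1 ∈ N := by
    intro s hs
    have h1 : tilde (J k n * s) = J k n * s := by
      rw [tilde_eq, transpose_mul, hs, J_transpose, neg_mul_neg, Matrix.mul_assoc,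
        Matrix.mul_assoc, J_mul_J]
      simp
    refine ⟨uElt (J k n * s) h1, uE _ _, ?_⟩
    rw [uElt_val, hT, fromBlocks_multiply, fromBlocks_multiply]
    simp
  have hw : hyp k (Idx n) ∈ N := by
    have h1 : J k n * -J k n = 1 := by rw [mul_neg, J_mul_J, neg_neg]
    refine ⟨wElt * hElt ⟨J k n, -J k n, h1, mul_eq_one_comm.mp h1⟩, mul_mem wE (hE _), ?_⟩
    rw [Oq.val_mul, wElt_val, hElt_val, hT, hyp, fromBlocks_multiply, fromBlocks_multiply,
      fromBlocks_multiply]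
    simp [tilde_eq, J_transpose, J_mul_J]
  have hV : ∀ s : A k n, sᵀ = -s → fromBlocks 1 0 s 1 ∈ N := by
    intro s hs
    have h1 : fromBlocks 1 0 s 1 = hyp k (Idx n) * fromBlocks 1 s 0 1 * hyp k (Idx n) := by
      simp [hyp, fromBlocks_multiply]
    rw [h1]
    exact mul_mem (mul_mem hw (hU s hs)) hw
  have h3 : T' * g.1.1 * T ∈ N := by
    refine mem_of_det_eq_one h2 hL hU hV ?_ ?_
    · have hg' : g.1.1 * F k n * g.1.1ᵀ = F k n := g.2
      rw [transpose_mul, transpose_mul]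
      calc T' * g.1.1 * T * hyp k (Idx n) * (Tᵀ * (g.1.1ᵀ * T'ᵀ))
          = T' * (g.1.1 * (T * hyp k (Idx n) * Tᵀ) * g.1.1ᵀ) * T'ᵀ := by
            simp only [Matrix.mul_assoc]
        _ = T' * (T * hyp k (Idx n) * Tᵀ) * T'ᵀ := by rw [← hF, hg']
        _ = (T' * T) * hyp k (Idx n) * (Tᵀ * T'ᵀ) := by simp only [Matrix.mul_assoc]
        _ = hyp k (Idx n) := by rw [hTT', hTt, Matrix.one_mul, Matrix.mul_one]
    · rw [det_mul, det_mul, hg, mul_one, ← det_mul, hTT', det_one]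
  obtain ⟨x, hx, hxg⟩ := h3
  have h4 : x = g := by
    apply Oq.ext_val
    calc x.1.1 = x.1.1 * T * T' := by rw [Matrix.mul_assoc, hTT, Matrix.mul_one]
      _ = (T * T') * g.1.1 * (T * T') := by rw [hxg]; simp only [Matrix.mul_assoc]
      _ = g.1.1 := by rw [hTT, Matrix.one_mul, Matrix.mul_one]
  exact h4 ▸ hx

/-- Two generalized Weil representations agree on the special orthogonal group. -/
lemma IsGeneralizedWeil.eq_of_det_eq_one [Fintype k] (h2 : (2 : k) ≠ 0) {ψ : AddChar k ℂ}
    {ρ ρ' : Representation ℂ (Oq k n) (M k n → ℂ)} (hρ : IsGeneralizedWeil ψ ρ)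
    (hρ' : IsGeneralizedWeil ψ ρ') {g : Oq k n} (hg : g.1.1.det = 1) : ρ g = ρ' g := by
  refine mem_of_generators (E := MonoidHom.eqLocusM ρ ρ') h2 (fun a => ?_) (fun s hs => ?_) ?_ hg
  · refine LinearMap.ext fun f => funext fun m => ?_
    rw [hρ.apply_h, hρ'.apply_h]
  · refine LinearMap.ext fun f => funext fun m => ?_
    rw [hρ.apply_u, hρ'.apply_u]
  · refine LinearMap.ext fun f => funext fun m => ?_
    rw [hρ.apply_w, hρ'.apply_w]

end Uniqueness

/-! ### Isotypic decompositions -/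

section Isotypic

open scoped MonoidAlgebra

variable {H L V : Type*} [Group H] [AddCommGroup L] [Module ℂ L] [AddCommGroup V] [Module ℂ V]

/-- A submodule over the group algebra, regarded as a complex subspace. -/
def under {σ : Representation ℂ H L} (N : Submodule ℂ[H] σ.asModule) : Submodule ℂ L :=
  (Subrepresentation.ofSubmodule' N).toSubmodule

lemma under_injective (σ : Representation ℂ H L) :
    Function.Injective (under : Submodule ℂ[H] σ.asModule → Submodule ℂ L) :=
  fun _ _ h => Subrepresentation.subrepresentationSubmoduleOrderIso.symm.injective
    (Subrepresentation.toSubmodule_injective h)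

lemma under_mono {σ : Representation ℂ H L} {N N' : Submodule ℂ[H] σ.asModule} (h : N ≤ N') :
    under N ≤ under N' := h

/-- The homomorphism of modules over the group algebra given by an intertwining operator. -/
noncomputable def homAsModule {π : Representation ℂ H V} {σ : Representation ℂ H L}
    {Φ : V →ₗ[ℂ] L} (hΦ : Φ ∈ homSpace π σ) : π.asModule →ₗ[ℂ[H]] σ.asModule :=
  Representation.IntertwiningMap.equivLinearMapAsModule π σ ⟨Φ, hΦ⟩

lemma under_range_homAsModule {π : Representation ℂ H V} {σ : Representation ℂ H L}
    {Φ : V →ₗ[ℂ] L} (hΦ : Φ ∈ homSpace π σ) :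
    under (LinearMap.range (homAsModule hΦ)) = LinearMap.range Φ := rfl

lemma exists_homAsModule_eq {π : Representation ℂ H V} {σ : Representation ℂ H L}
    (f : π.asModule →ₗ[ℂ[H]] σ.asModule) :
    ∃ (Φ : V →ₗ[ℂ] L) (hΦ : Φ ∈ homSpace π σ), homAsModule hΦ = f := by
  refine ⟨((Representation.IntertwiningMap.equivLinearMapAsModule π σ).symm f).toLinearMap,
    ((Representation.IntertwiningMap.equivLinearMapAsModule π σ).symm f).isIntertwining', ?_⟩
  exact (Representation.IntertwiningMap.equivLinearMapAsModule π σ).apply_symm_apply f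

lemma range_le_isotypic {π : Representation ℂ H V} {σ : Representation ℂ H L}
    {Φ : V →ₗ[ℂ] L} (hΦ : Φ ∈ homSpace π σ) : LinearMap.range Φ ≤ isotypic σ π :=
  le_iSup₂_of_le Φ hΦ le_rfl

/-- An operator that commutes with a representation preserves its isotypic parts. -/
lemma map_isotypic_le {π : Representation ℂ H V} {σ : Representation ℂ H L} {R : L →ₗ[ℂ] L}
    (hR : ∀ h, R ∘ₗ σ h = σ h ∘ₗ R) : (isotypic σ π).map R ≤ isotypic σ π := by
  rw [isotypic, Submodule.map_iSup]
  refine iSup_le fun Φ => ?_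
  rw [Submodule.map_iSup]
  refine iSup_le fun hΦ => ?_
  rw [← LinearMap.range_comp]
  refine range_le_isotypic fun h => ?_
  rw [LinearMap.comp_assoc, hΦ h, ← LinearMap.comp_assoc, hR, LinearMap.comp_assoc]

lemma apply_mem_isotypic {π : Representation ℂ H V} {σ : Representation ℂ H L} (h : H) {v : L}
    (hv : v ∈ isotypic σ π) : σ h v ∈ isotypic σ π := by
  have key : isotypic σ π ≤ (isotypic σ π).comap (σ h) := by
    refine iSup₂_le fun Φ hΦ => ?_
    rintro _ ⟨x, rfl⟩
    exact range_le_isotypic hΦ ⟨π h x, LinearMap.congr_fun (hΦ h) x⟩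
  exact key hv

/-- For an irreducible representation, the sum of the images of the intertwining operators is the
isotypic component of the module over the group algebra. -/
lemma isotypic_eq_under (σ : Representation ℂ H L) {π : Representation ℂ H V}
    (hπ : π.IsIrreducible) :
    isotypic σ π = under (isotypicComponent ℂ[H] σ.asModule π.asModule) := by
  have := (Representation.irreducible_iff_isSimpleModule_asModule π).mp hπ
  apply le_antisymm
  · refine iSup₂_le fun Φ hΦ => ?_
    rw [← under_range_homAsModule hΦ]
    apply under_mono
    rcases (homAsModule hΦ).injective_or_eq_zero with h | h
    · exact le_sSup ⟨(LinearEquiv.ofInjective _ h).symm⟩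
    · rw [h, LinearMap.range_zero]
      exact bot_le
  · have key : isotypicComponent ℂ[H] σ.asModule π.asModule ≤
        Subrepresentation.asSubmodule (ρ := σ)
          ⟨isotypic σ π, fun h _ hv => apply_mem_isotypic h hv⟩ := by
      refine sSup_le ?_
      rintro m ⟨e⟩
      obtain ⟨Φ, hΦ, hf⟩ := exists_homAsModule_eq (m.subtype ∘ₗ e.symm.toLinearMap)
      have h1 : LinearMap.range (homAsModule hΦ) = m := by
        rw [hf, LinearMap.range_comp, LinearEquiv.range, Submodule.map_top, Submodule.range_subtype]
      rw [← h1]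
      exact range_le_isotypic hΦ
    exact key

/-- A simple submodule of a finite-dimensional representation comes from an irreducible
representation on a coordinate space. -/
lemma exists_isotypic_eq [FiniteDimensional ℂ L] (σ : Representation ℂ H L)
    (S : Submodule ℂ[H] σ.asModule) [IsSimpleModule ℂ[H] S] :
    ∃ (d : ℕ) (π : Representation ℂ H (Fin d → ℂ)), π.IsIrreducible ∧
      isotypic σ π = under (isotypicComponent ℂ[H] σ.asModule S) := by
  set S' := Subrepresentation.ofSubmodule' S with hS'
  set b := (Module.finBasis ℂ S'.toSubmodule).equivFun with hb
  set π : Representation ℂ H (Fin (Module.finrank ℂ S'.toSubmodule) → ℂ) :=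
    { toFun := fun h => b.conj (S'.toRepresentation h)
      map_one' := by rw [map_one]; exact LinearEquiv.conj_id _
      map_mul' := fun x y => by rw [map_mul]; exact LinearEquiv.conj_comp _ _ _ } with hπ
  have hΦ : S'.toSubmodule.subtype ∘ₗ b.symm.toLinearMap ∈ homSpace π σ := by
    intro h
    ext v
    change (b.symm (b (S'.toRepresentation h (b.symm _)))).1 = σ h (b.symm _).1
    rw [LinearEquiv.symm_apply_apply]
    rfl
  have hinj : Function.Injective (homAsModule hΦ) := by
    intro x y hxy
    exact b.symm.injective (Subtype.ext hxy)
  have hr : LinearMap.range (homAsModule hΦ) = S := by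
    apply under_injective
    rw [under_range_homAsModule, LinearMap.range_comp, LinearEquiv.range, Submodule.map_top,
      Submodule.range_subtype]
    rfl
  have e : π.asModule ≃ₗ[ℂ[H]] S :=
    (LinearEquiv.ofInjective _ hinj).trans (LinearEquiv.ofEq _ _ hr)
  have hirr : π.IsIrreducible :=
    (Representation.irreducible_iff_isSimpleModule_asModule π).mpr (IsSimpleModule.congr e)
  exact ⟨_, π, hirr, by rw [isotypic_eq_under σ hirr, e.isotypicComponent_eq]⟩

/-- The isotypic decomposition consists of the isotypic components of the module over the group
algebra. Every simple submodule is finite-dimensional, hence isomorphic to a coordinate space. -/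
lemma isotypicDecomposition_eq [FiniteDimensional ℂ L] (σ : Representation ℂ H L) :
    isotypicDecomposition σ = under '' isotypicComponents ℂ[H] σ.asModule := by
  apply Set.Subset.antisymm
  · rintro N ⟨hN, d, π, hπ, rfl⟩
    have := (Representation.irreducible_iff_isSimpleModule_asModule π).mp hπ
    rw [isotypic_eq_under σ hπ] at hN ⊢
    by_cases hm : ∃ m : Submodule ℂ[H] σ.asModule, Nonempty (m ≃ₗ[ℂ[H]] π.asModule)
    · obtain ⟨m, ⟨e⟩⟩ := hm
      exact ⟨_, ⟨m, IsSimpleModule.congr e, e.isotypicComponent_eq.symm⟩, rfl⟩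
    · refine absurd ?_ hN
      have h1 : {m : Submodule ℂ[H] σ.asModule | Nonempty (m ≃ₗ[ℂ[H]] π.asModule)} = ∅ :=
        Set.eq_empty_of_forall_notMem fun m hm' => hm ⟨m, hm'⟩
      rw [isotypicComponent, h1, sSup_empty]
      rfl
  · rintro _ ⟨_, ⟨S, hS, rfl⟩, rfl⟩
    obtain ⟨d, π, hπ, h⟩ := exists_isotypic_eq σ S
    refine ⟨fun h0 => (bot_lt_isotypicComponent S).ne' (under_injective σ h0), d, π, hπ, h.symm⟩

lemma under_sSup {σ : Representation ℂ H L} (s : Set (Submodule ℂ[H] σ.asModule)) :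
    under (sSup s) = sSup (under '' s) := by
  apply le_antisymm
  · have h1 : ∀ h, sSup (under '' s) ≤ (sSup (under '' s)).comap (σ h) := by
      intro h
      refine sSup_le ?_
      rintro _ ⟨m, hm, rfl⟩ v hv
      exact le_sSup (Set.mem_image_of_mem under hm)
        ((Subrepresentation.ofSubmodule' m).apply_mem_toSubmodule h hv)
    have h2 : sSup s ≤ Subrepresentation.asSubmodule (ρ := σ)
        ⟨sSup (under '' s), fun h _ hv => h1 h hv⟩ :=
      sSup_le fun m hm => le_sSup (Set.mem_image_of_mem under hm)
    exact h2
  · refine sSup_le ?_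
    rintro _ ⟨m, hm, rfl⟩
    exact under_mono (le_sSup hm)

lemma sSupIndep_isotypicDecomposition [Finite H] [FiniteDimensional ℂ L]
    (σ : Representation ℂ H L) : sSupIndep (isotypicDecomposition σ) := by
  rw [isotypicDecomposition_eq]
  rintro _ ⟨c, hc, rfl⟩
  rw [← Set.image_singleton, ← Set.image_sdiff (under_injective σ), ← under_sSup]
  have h1 := Submodule.disjoint_def.mp (sSupIndep_isotypicComponents ℂ[H] σ.asModule hc)
  exact Submodule.disjoint_def.mpr h1

/-- A representation of a finite group is the sum of its isotypic parts, by Maschke's theorem. -/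
lemma sSup_isotypicDecomposition [Finite H] [FiniteDimensional ℂ L]
    (σ : Representation ℂ H L) : sSup (isotypicDecomposition σ) = ⊤ := by
  have : NeZero (Nat.card H : ℂ) := ⟨Nat.cast_ne_zero.mpr Nat.card_pos.ne'⟩
  rw [isotypicDecomposition_eq, ← under_sSup, sSup_isotypicComponents]
  rfl

end Isotypic

/-! ### Transport along an isomorphism of groups -/

section Pull

variable {H H' L V : Type*} [Group H] [Group H'] [AddCommGroup L] [Module ℂ L] [AddCommGroup V]
  [Module ℂ V]

lemma homSpace_pull (φ : H' ≃* H) (σ : Representation ℂ H L) (π : Representation ℂ H V) :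
    homSpace (pull φ.toMonoidHom σ) (pull φ.toMonoidHom π) = homSpace σ π := by
  ext Θ
  refine ⟨fun h x => ?_, fun h x => h (φ x)⟩
  have h1 := h (φ.symm x)
  change Θ ∘ₗ σ (φ (φ.symm x)) = π (φ (φ.symm x)) ∘ₗ Θ at h1
  rwa [φ.apply_symm_apply] at h1

lemma isotypic_pull (φ : H' ≃* H) (σ : Representation ℂ H L) (π : Representation ℂ H V) :
    isotypic (pull φ.toMonoidHom σ) (pull φ.toMonoidHom π) = isotypic σ π := by
  rw [isotypic, isotypic, homSpace_pull]

lemma isIrreducible_pull (φ : H' ≃* H) (π : Representation ℂ H V) :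
    π.IsIrreducible ↔ (pull φ.toMonoidHom π).IsIrreducible := by
  refine OrderIso.isSimpleOrder_iff
    { toFun := fun N => ⟨N.toSubmodule, fun h _ hv => N.apply_mem_toSubmodule (φ h) hv⟩
      invFun := fun N => ⟨N.toSubmodule, fun h v hv => ?_⟩
      left_inv := fun N => rfl
      right_inv := fun N => rfl
      map_rel_iff' := Iff.rfl }
  have h1 := N.apply_mem_toSubmodule (φ.symm h) hv
  change π (φ (φ.symm h)) v ∈ N.toSubmodule at h1
  rwa [φ.apply_symm_apply] at h1

lemma isotypicDecomposition_pull (φ : H' ≃* H) (σ : Representation ℂ H L) :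
    isotypicDecomposition (pull φ.toMonoidHom σ) = isotypicDecomposition σ := by
  ext N
  refine and_congr_right fun _ => exists_congr fun d => ⟨?_, ?_⟩
  · rintro ⟨π, hπ, rfl⟩
    have h1 : pull φ.toMonoidHom (pull φ.symm.toMonoidHom π) = π :=
      MonoidHom.ext fun x => congrArg π (φ.symm_apply_apply x)
    refine ⟨pull φ.symm.toMonoidHom π, (isIrreducible_pull φ.symm π).mp hπ, ?_⟩
    rw [← isotypic_pull φ, h1]
  · rintro ⟨π, hπ, rfl⟩
    exact ⟨pull φ.toMonoidHom π, (isIrreducible_pull φ π).mp hπ, (isotypic_pull φ σ π).symm⟩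

end Pull

/-! ### The action on intertwining operators by kernels -/

section Kernel

variable {H S V : Type*} [Group H] [Fintype S] [DecidableEq S] [AddCommGroup V] [Module ℂ V]

lemma kernelAct_single (R : (S → ℂ) →ₗ[ℂ] (S → ℂ)) (Θ : (S → ℂ) →ₗ[ℂ] V) (z : S) :
    kernelAct R Θ (Pi.single z 1) = ∑ y, R (Pi.single y 1) z • Θ (Pi.single y 1) := by
  simp [kernelAct, Pi.single_apply]

/-- If `R` commutes with a permutation representation, its kernel is invariant, so that `R` acts
on the spaces of intertwining operators. -/
lemma kernelAct_mem_homSpace {σ : Representation ℂ H (S → ℂ)} {p : H → Equiv.Perm S}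
    (hp : ∀ h f x, σ h f (p h x) = f x) {R : (S → ℂ) →ₗ[ℂ] (S → ℂ)}
    (hR : ∀ h, R ∘ₗ σ h = σ h ∘ₗ R) {π : Representation ℂ H V} {Θ : (S → ℂ) →ₗ[ℂ] V}
    (hΘ : Θ ∈ homSpace σ π) : kernelAct R Θ ∈ homSpace σ π := by
  intro h
  have h1 : ∀ z, σ h (Pi.single z 1) = Pi.single (p h z) 1 := by
    intro z
    funext x
    obtain ⟨x, rfl⟩ := (p h).surjective x
    rw [hp]
    simp [Pi.single_apply]
  have h2 : ∀ y z, R (Pi.single (p h y) 1) (p h z) = R (Pi.single y 1) z := by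
    intro y z
    rw [← h1]
    have h3 := congrFun (LinearMap.congr_fun (hR h) (Pi.single y 1)) (p h z)
    rw [LinearMap.comp_apply, LinearMap.comp_apply, hp] at h3
    exact h3
  refine LinearMap.pi_ext' fun z => LinearMap.ext_ring ?_
  change kernelAct R Θ (σ h (Pi.single z 1)) = π h (kernelAct R Θ (Pi.single z 1))
  rw [h1, kernelAct_single, kernelAct_single, map_sum, ← Equiv.sum_comp (p h)]
  refine Finset.sum_congr rfl fun y _ => ?_
  rw [h2, map_smul, ← h1]
  congr 1
  exact LinearMap.congr_fun (hΘ h) _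

end Kernel

/-! ### The isomorphism of `SL₂(k)` with `U(γ, χ)` -/

section Unitary

variable {k : Type*} [Field k] {n : ℕ}

lemma toX_symm_slX (g : SpecialLinearGroup (Fin 2) k) (m : M k n) :
    toX.symm (slX g (toX m)) =
      (g.1 0 0 • m.1 + g.1 0 1 • m.2, g.1 1 0 • m.1 + g.1 1 1 • m.2) := by
  refine Prod.ext (funext fun j => ?_) (funext fun j => ?_) <;>
    exact (Matrix.mul_apply ..).trans (Fin.sum_univ_two _)

lemma brk_vecMul_self (h2 : (2 : k) ≠ 0) {s : A k n} (hs : tilde s = s) (x : Idx n → k) :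
    brk (x ᵥ* s) x = 0 := by
  have h := brk_vecMul_swap hs x x
  have h' : 2 * brk (x ᵥ* s) x = 0 := by linear_combination h
  exact (mul_eq_zero.mp h').resolve_left h2

/-- The action of `SL₂(k)` on `M` by left multiplication, as a homomorphism to `U(γ, χ)`. -/
def slToU [NeZero (2 : k)] (ψ : AddChar k ℂ) : SpecialLinearGroup (Fin 2) k →* U n ψ where
  toFun g := ⟨(toX.trans (slX g).toEquiv).trans toX.symm, by
    have hd : g.1 0 0 * g.1 1 1 - g.1 0 1 * g.1 1 0 = 1 := by rw [← det_fin_two]; exact g.2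
    have hval : ∀ m : M k n, ((toX.trans (slX g).toEquiv).trans toX.symm) m =
        (g.1 0 0 • m.1 + g.1 0 1 • m.2, g.1 1 0 • m.1 + g.1 1 1 • m.2) := toX_symm_slX g
    refine ⟨fun m m' => ?_, fun m a => ?_, fun u hu m => ?_, fun m m' => ?_⟩
    · rw [hval, hval, hval]
      refine Prod.ext ?_ ?_
      · simp only [Prod.fst_add, Prod.snd_add, smul_add]
        abel
      · simp only [Prod.fst_add, Prod.snd_add, smul_add]
        abel
    · rw [hval, hval]
      simp only [rsmul, add_vecMul, smul_vecMul]
    · rw [hval]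
      have h0 := brk_vecMul_self (NeZero.ne (2 : k)) hu
      have h1 := brk_vecMul_swap hu m.1 m.2
      simp only [gam, add_vecMul, smul_vecMul, brk_add_left, brk_add_right, brk_smul_left,
        brk_smul_right, h0, h1]
      congr 1
      linear_combination brk (m.1 ᵥ* u) m.2 * hd
    · rw [hval, hval]
      simp only [chi, brk_add_left, brk_add_right, brk_smul_left, brk_smul_right]
      congr 1
      linear_combination (brk m.1 m'.2 - brk m.2 m'.1) * hd⟩
  map_one' := by
    refine Subtype.ext (Equiv.ext fun m => ?_)
    exact toX.symm_apply_eq.mpr (Matrix.one_mul _)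
  map_mul' g h := by
    refine Subtype.ext (Equiv.ext fun m => ?_)
    change toX.symm (slX (g * h) (toX m)) = toX.symm (slX g (toX (toX.symm (slX h (toX m)))))
    rw [slX_mul, Equiv.apply_symm_apply]
    rfl

lemma toX_slToU [NeZero (2 : k)] (ψ : AddChar k ℂ) (g : SpecialLinearGroup (Fin 2) k)
    (m : M k n) : toX ((slToU ψ g).1 m) = g.1 * toX m :=
  toX.apply_symm_apply _

lemma slToU_apply [NeZero (2 : k)] (ψ : AddChar k ℂ) (g : SpecialLinearGroup (Fin 2) k)
    (m : M k n) : (slToU ψ g).1 m =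
      (g.1 0 0 • m.1 + g.1 0 1 • m.2, g.1 1 0 • m.1 + g.1 1 1 • m.2) :=
  toX_symm_slX g m

lemma slToU_injective [NeZero (2 : k)] (hn : 0 < n) (ψ : AddChar k ℂ) :
    Function.Injective (slToU ψ : SpecialLinearGroup (Fin 2) k →* U n ψ) := by
  intro g h hgh
  let i : Idx n := Sum.inl ⟨0, hn⟩
  have h1 : ∀ m : M k n, (slToU ψ g).1 m = (slToU ψ h).1 m := fun m => by rw [hgh]
  have h2 := h1 (Pi.single i 1, 0)
  have h3 := h1 (0, Pi.single i 1)
  simp only [slToU_apply, smul_zero, add_zero, zero_add, Prod.mk.injEq] at h2 h3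
  have e : ∀ c c' : k, c • (Pi.single i 1 : Idx n → k) = c' • Pi.single i 1 → c = c' := by
    intro c c' hc
    simpa using congrFun hc i
  ext r s
  fin_cases r <;> fin_cases s
  · exact e _ _ h2.1
  · exact e _ _ h3.1
  · exact e _ _ h2.2
  · exact e _ _ h3.2

/-- An element of `U(γ, χ)` is determined by the images of `(e, 0)` and `(0, e)` for a unit vector
`e`; the matrices with a single non-zero row, the one given by `e`, show that it is the left
multiplication by a matrix, and the invariance of `χ` that this matrix has determinant `1`. -/
lemma slToU_surjective [NeZero (2 : k)] (hn : 0 < n) {ψ : AddChar k ℂ} (hψ : ψ ≠ 1) :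
    Function.Surjective (slToU ψ : SpecialLinearGroup (Fin 2) k →* U n ψ) := by
  intro β
  obtain ⟨hadd, hlin, -, hchi⟩ := β.2
  set e : Idx n → k := Pi.single (Sum.inl ⟨0, hn⟩) 1 with he
  have hee : e ⬝ᵥ e = 1 := by simp [he]
  have h1 : ∀ x : Idx n → k, β.1 (x, 0) =
      (((β.1 (e, 0)).1 ⬝ᵥ e) • x, ((β.1 (e, 0)).2 ⬝ᵥ e) • x) := by
    intro x
    have h := hlin (e, 0) (vecMulVec e x)
    simpa only [rsmul, vecMul_vecMulVec, hee, one_smul, zero_dotProduct, zero_smul] using h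
  have h2 : ∀ x : Idx n → k, β.1 (0, x) =
      (((β.1 (0, e)).1 ⬝ᵥ e) • x, ((β.1 (0, e)).2 ⬝ᵥ e) • x) := by
    intro x
    have h := hlin (0, e) (vecMulVec e x)
    simpa only [rsmul, vecMul_vecMulVec, hee, one_smul, zero_dotProduct, zero_smul] using h
  generalize (β.1 (e, 0)).1 ⬝ᵥ e = a at h1
  generalize (β.1 (e, 0)).2 ⬝ᵥ e = c at h1
  generalize (β.1 (0, e)).1 ⬝ᵥ e = b at h2
  generalize (β.1 (0, e)).2 ⬝ᵥ e = d at h2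
  have hdet : a * d - b * c = 1 := by
    have he0 : e ≠ 0 := fun h0 => by simp [h0] at hee
    obtain ⟨y, hy⟩ : ∃ y, brk y e ≠ 0 := by
      by_contra! hy
      exact he0 (brk_nondegenerate hy)
    refine sub_eq_zero.mp (eq_zero_of_forall_addChar hψ fun t => ?_)
    have h := hchi ((t / brk y e) • y, 0) (0, e)
    rw [h1, h2] at h
    simp only [chi, brk_smul_left, brk_smul_right, brk_zero_left, sub_zero] at h
    have e1 : t / brk y e * brk y e = t := div_mul_cancel₀ _ hy
    have e2 : a * (t / brk y e * (d * brk y e)) - c * (t / brk y e * (b * brk y e)) =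
        t * (a * d - b * c - 1) + t := by
      linear_combination (a * d - b * c) * e1
    have e3 : ψ (t * (a * d - b * c - 1)) * ψ t = ψ t := by
      rw [← AddChar.map_add_eq_mul, ← e2]
      rw [e1] at h
      rw [← h]
      congr 1
      linear_combination (a * d - b * c) * e1
    have e4 : ψ t ≠ 0 := (ψ.val_isUnit t).ne_zero
    exact (mul_eq_right₀ e4).mp e3
  refine ⟨⟨!![a, b; c, d], by rw [det_fin_two_of, hdet]⟩, Subtype.ext (Equiv.ext fun m => ?_)⟩
  have hm : m = (m.1, 0) + (0, m.2) := by simp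
  conv_rhs => rw [hm, hadd, h1, h2]
  exact slToU_apply ψ _ m

/-- Left multiplication on `M` as an isomorphism from `SL₂(k)` to `U(γ, χ)`. -/
noncomputable def slEquivU [NeZero (2 : k)] (hn : 0 < n) {ψ : AddChar k ℂ} (hψ : ψ ≠ 1) :
    SpecialLinearGroup (Fin 2) k ≃* U n ψ :=
  MulEquiv.ofBijective (slToU ψ) ⟨slToU_injective hn ψ, slToU_surjective hn hψ⟩

end Unitary

/-! ### The commuting actions of the two groups -/

section Correspondence

variable {k : Type*} [Field k] {n : ℕ}

/-- The groups `O_q(2n,2n)` and `SL₂(k)` commute in `Sp(W)`, and so do their actions on `L²(M)`. -/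
lemma resO_comp_resSL (ω : Representation ℂ (Sp k n) (X k n → ℂ)) (g : Oq k n)
    (h : SpecialLinearGroup (Fin 2) k) :
    resO ω g ∘ₗ resSL ω h = resSL ω h ∘ₗ resO ω g := by
  have h1 : ω (orthToSp g) ∘ₗ ω (slToSp h) = ω (slToSp h) ∘ₗ ω (orthToSp g) := by
    have h2 := congrArg ω (commute_orthToSp_slToSp g h)
    rwa [map_mul, map_mul] at h2
  refine LinearMap.ext fun f => funext fun m => ?_
  have h2 : (resSL ω h f) ∘ toX.symm = ω (slToSp h) (f ∘ toX.symm) := by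
    funext x
    rw [Function.comp_apply, resSL_apply, Equiv.apply_symm_apply]
  have h3 : (resO ω g f) ∘ toX.symm = ω (orthToSp g) (f ∘ toX.symm) := by
    funext x
    rw [Function.comp_apply, resO_apply, Equiv.apply_symm_apply]
  rw [LinearMap.comp_apply, LinearMap.comp_apply, resO_apply, resSL_apply, h2, h3]
  exact congrFun (LinearMap.congr_fun h1 (f ∘ toX.symm)) (toX m)

variable [NeZero (2 : k)] [Fintype k] [DecidableEq k]
  {ψ : AddChar k ℂ} {ω : Representation ℂ (Sp k n) (X k n → ℂ)}

lemma IsWeil.resSL_eq (hω : IsWeil ψ ω) (hψ : ψ ≠ 1) (hq : 3 < Fintype.card k)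
    (g : SpecialLinearGroup (Fin 2) k) : resSL ω g = natAction n ψ (slToU ψ g) := by
  refine LinearMap.ext fun f => funext fun m => ?_
  rw [resSL_apply, hω.apply_sl hψ hq]
  rfl

lemma IsWeil.resO_comp_natAction (hω : IsWeil ψ ω) (hn : 0 < n) (hψ : ψ ≠ 1)
    (hq : 3 < Fintype.card k) (g : Oq k n) (β : U n ψ) :
    resO ω g ∘ₗ natAction n ψ β = natAction n ψ β ∘ₗ resO ω g := by
  obtain ⟨h, rfl⟩ := slToU_surjective hn hψ β
  rw [← hω.resSL_eq hψ hq]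
  exact resO_comp_resSL ω g h

lemma IsWeil.map_isotypic (hω : IsWeil ψ ω) (hn : 0 < n) (hψ : ψ ≠ 1)
    (hq : 3 < Fintype.card k) (g : Oq k n) {V : Type*} [AddCommGroup V] [Module ℂ V]
    (π : Representation ℂ (U n ψ) V) :
    (isotypic (natAction n ψ) π).map (resO ω g) = isotypic (natAction n ψ) π := by
  refine le_antisymm (map_isotypic_le (hω.resO_comp_natAction hn hψ hq g)) fun v hv => ?_
  refine ⟨resO ω g⁻¹ v,
    map_isotypic_le (hω.resO_comp_natAction hn hψ hq g⁻¹) ⟨v, hv, rfl⟩, ?_⟩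
  change (resO ω g * resO ω g⁻¹) v = v
  rw [← map_mul, mul_inv_cancel, map_one]
  rfl

end Correspondence

end WeilO

open WeilO
theorem mainTheorem4 {k : Type*} [Field k] [Fintype k] [DecidableEq k] [NeZero (2 : k)]
    (hq : 3 < Fintype.card k) (n : ℕ) (hn : 0 < n) (ψ : AddChar k ℂ) (hψ : ψ ≠ 1) :
    (∃ ω : Representation ℂ (Sp k n) (X k n → ℂ), IsWeil ψ ω) ∧
    ∀ ω : Representation ℂ (Sp k n) (X k n → ℂ), IsWeil ψ ω →
      -- the restriction of `ω` to `O_q(2n,2n)` is given by the formulas on `h_a`, `u_s`, `w`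
      IsGeneralizedWeil ψ (resO ω) ∧
      -- these formulas determine the representation on `SO_q(2n,2n)`
      (∀ ρ : Representation ℂ (Oq k n) (M k n → ℂ), IsGeneralizedWeil ψ ρ →
        ∀ g : Oq k n, g.1.1.det = 1 → ρ g = resO ω g) ∧
      -- the actions of `U(γ, χ)` and of `SL₂(k)` on `L²(M)` coincide
      ∃ φ : SpecialLinearGroup (Fin 2) k ≃* U n ψ,
        (∀ (g : SpecialLinearGroup (Fin 2) k) (m : M k n), toX ((φ g).1 m) = g.1 * toX m) ∧
        (∀ g : SpecialLinearGroup (Fin 2) k, resSL ω g = natAction n ψ (φ g)) ∧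
        -- the isotypic decompositions coincide, and decompose the representation of `O_q(2n,2n)`
        isotypicDecomposition (natAction n ψ) = isotypicDecomposition (resSL ω) ∧
        sSupIndep (isotypicDecomposition (natAction n ψ)) ∧
        sSup (isotypicDecomposition (natAction n ψ)) = ⊤ ∧
        (∀ N ∈ isotypicDecomposition (natAction n ψ), ∀ g : Oq k n, N.map (resO ω g) = N) ∧
        -- component by component, with the multiplicity spaces and the action on them
        ∀ {V : Type*} [AddCommGroup V] [Module ℂ V] [FiniteDimensional ℂ V]
          (π : Representation ℂ (U n ψ) V),
          (π.IsIrreducible ↔ (pull φ.toMonoidHom π).IsIrreducible) ∧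
          isotypic (natAction n ψ) π = isotypic (resSL ω) (pull φ.toMonoidHom π) ∧
          homSpace (natAction n ψ) π = homSpace (resSL ω) (pull φ.toMonoidHom π) ∧
          ∀ Θ ∈ homSpace (natAction n ψ) π, ∀ g : Oq k n,
            kernelAct (resO ω g) Θ ∈ homSpace (natAction n ψ) π := by
  refine ⟨exists_isWeil hψ, fun ω hω => ⟨hω.isGeneralizedWeil hψ hq,
    fun ρ hρ g hg => hρ.eq_of_det_eq_one (NeZero.ne (2 : k)) (hω.isGeneralizedWeil hψ hq) hg,
    slEquivU hn hψ, toX_slToU ψ, hω.resSL_eq hψ hq, ?_⟩⟩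
  have hres : resSL ω = pull (slEquivU hn hψ).toMonoidHom (natAction n ψ) :=
    MonoidHom.ext (hω.resSL_eq hψ hq)
  rw [hres]
  refine ⟨(isotypicDecomposition_pull _ _).symm, sSupIndep_isotypicDecomposition _,
    sSup_isotypicDecomposition _, ?_, ?_⟩
  · rintro _ ⟨-, d, π, -, rfl⟩ g
    exact hω.map_isotypic hn hψ hq g π
  · intro V _ _ _ π
    refine ⟨isIrreducible_pull _ π, (isotypic_pull _ _ π).symm, (homSpace_pull _ _ π).symm,
      fun Θ hΘ g => kernelAct_mem_homSpace (p := Subtype.val) (fun β f x => ?_)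
        (hω.resO_comp_natAction hn hψ hq g) hΘ⟩
    exact congrArg f (β.1.symm_apply_apply x)
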